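/- **Lemma 1 (universality from nonidentical noisy $T$-type states).** Write $X,Y,Z$ for the Pauli matrices; the Bloch coordinates of a qubit state $\rho$ are $x=\operatorname{tr}(X\rho)$, $y=\operatorname{tr}(Y\rho)$, $z=\operatorname{tr}(Z\rho)$. For $\varepsilon>0$ an *$\varepsilon$-supply* is a sequence $\rho_1,\rho_2,\dots$ of qubit density matrices with $x_i=y_i=z_i=f_i/\sqrt3$ and $f_i\ge\sqrt{3/7}+\varepsilon$; the $f_i$ may be unequal and unknown. An *adaptive stabilizer protocol* is a finite procedure on $n$ data qubits and some number of work qubits, initially $|0\rangle$, built from the perfect operations: Hadamard, phase gate $\operatorname{diag}(1,i)$, CNOT, preparation of a fresh $|0\rangle$, measurement in the computational basis (later operations may depend on the outcomes), and preparation of the next unused state of the supply. Its size is the largest number of operations in a run. It *simulates* a unitary $U$ on the data qubits within $\delta$ if for every initial data state $\sigma$ the final data state (averaged over outcomes, work qubits discarded) has trace distance at most $\delta$ from $U\sigma U^\dagger$. Perfect adaptive stabilizer operations together with an $\varepsilon$-supply give quantum universality, by protocols that depend on $\varepsilon$ but not on the $f_i$: 1. For all $\varepsilon>0$, $n$, $\delta>0$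 and every unitary $U$ on $n$ qubits there is a protocol that simulates $U$ within $\delta$ for every $\varepsilon$-supply. 2. This is efficient: there is a finite, inverse-closed set $G$ of single-qubit unitaries such that circuits over $G\cup\{\mathrm{CNOT}\}$ approximate every unitary on any number of qubits arbitrarily well up to a global phase, and for every $\varepsilon>0$ there are constants $C,c$ such that for every $n$, every circuit of $m$ gates over $G\cup\{\mathrm{CNOT}\}$ on $n$ qubits and every $\delta\in(0,1)$ there is a protocol of size at most $C\,m\,(1+\log(m/\delta))^c$ (read as $0$ if $m=0$) that simulates the circuit within $\delta$ for every $\varepsilon$-supply. 3. Take five qubits in states with Bloch coordinates $x=y=z=f_i/\sqrt3$, $f=(f_1,\dots,f_5)\in[0,1]^5$, decode the five-qubit code stabilized by $X\otimes Z\otimes Z\otimes X\otimes I$ and its cyclic shifts (with $X,Y,Z$ encoded as $X^{\otimes5},Y^{\otimes5},Z^{\otimes5}$), and postselect on no detected error. The acceptance probability is positive, and the decoded qubit has Bloch coordinates $x=y=z=-f_{\mathrm{out}}/\sqrt3$ for a real number $f_{\mathrm{out}}=f_{\mathrm{out}}(f)$. The output fidelity parameter $f_{\mathrm{out}}$ and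 the acceptance probability are both nondecreasing in each $f_i$ on $[0,1]^5$, and strictly increasing in each $f_i$ on $(0,1)^5$. -/

import Mathlib

open scoped ComplexOrder

noncomputable section

namespace MagicDistill

/-- Operators on a register whose qubits are labelled by `Q`; the computational basis states are
the functions `Q → Fin 2`. -/
abbrev Op (Q : Type) := Matrix (Q → Fin 2) (Q → Fin 2) ℂ

/-- Operators on a single qubit. -/
abbrev Op1 := Matrix (Fin 2) (Fin 2) ℂ

/-! ### States and distances -/

/-- Density matrices: positive semidefinite with trace one. -/
def IsDensity {ι : Type} [Fintype ι] (σ : Matrix ι ι ℂ) : Prop :=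
  σ.PosSemidef ∧ σ.trace = 1

/-- Measurement effects: `0 ≤ E ≤ 1`. -/
def IsEffect {ι : Type} [Fintype ι] [DecidableEq ι] (E : Matrix ι ι ℂ) : Prop :=
  E.PosSemidef ∧ (1 - E).PosSemidef

/-- Trace distance at most `δ`: no measurement outcome has probabilities in the two states that
differ by more than `δ`. -/
def TraceClose {ι : Type} [Fintype ι] [DecidableEq ι] (δ : ℝ) (σ τ : Matrix ι ι ℂ) : Prop :=
  ∀ E : Matrix ι ι ℂ, IsEffect E → ‖(E * σ).trace - (E * τ).trace‖ ≤ δ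

/-! ### Single-qubit operators and gates -/

def pauliX : Op1 := !![0, 1; 1, 0]

def pauliY : Op1 := !![0, -Complex.I; Complex.I, 0]

def pauliZ : Op1 := !![1, 0; 0, -1]

def hadamardGate : Op1 := ((1 / √2 : ℝ) : ℂ) • !![1, 1; 1, -1]

def phaseGate : Op1 := !![1, 0; 0, Complex.I]

/-- The projector on the basis state `b`. -/
def basisProj (b : Fin 2) : Op1 := Matrix.single b b 1

/-- The operator `A` acting on qubit `q`, and the identity on every other qubit. -/
def onQubit {Q : Type} [Fintype Q] [DecidableEq Q] (q : Q) (A : Op1) : Op Q :=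
  Matrix.of fun s t => if ∀ j, j ≠ q → s j = t j then A (s q) (t q) else 0

/-- The CNOT gate with control `c` and target `t` (addition in `Fin 2` is exclusive or). -/
def cnotGate {Q : Type} [Fintype Q] [DecidableEq Q] (c t : Q) : Op Q :=
  Matrix.of fun s u => if s = Function.update u t (u t + u c) then 1 else 0

/-- Discard the content of qubit `q` and put a fresh qubit in state `τ` in its place. -/
def replaceQubit {Q : Type} [DecidableEq Q] (q : Q) (τ : Op1) (σ : Op Q) : Op Q :=
  Matrix.of fun s t =>
    τ (s q) (t q) * ∑ b : Fin 2, σ (Function.update s q b) (Function.update t q b)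

/-! ### Adaptive stabilizer protocols with access to a supply of single-qubit states -/

/-- Adaptive stabilizer protocols on the register `Q`: Clifford gates (generated by the Hadamard
gate, the phase gate and CNOT), preparation of fresh `|0⟩`, measurement in the computational basis
whose outcome decides how the protocol continues, and preparation of the next supplied state. -/
inductive Protocol (Q : Type) : Type
  | done : Protocol Q
  | hadamard (q : Q) (P : Protocol Q) : Protocol Q
  | phase (q : Q) (P : Protocol Q) : Protocol Q
  | cnot (c t : Q) (h : c ≠ t) (P : Protocol Q) : Protocol Q
  | prepZero (q : Q) (P : Protocol Q) : Protocol Q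
  | prepSupplied (q : Q) (P : Protocol Q) : Protocol Q
  | measure (q : Q) (P₀ P₁ : Protocol Q) : Protocol Q

/-- The number of operations in the longest branch. -/
def Protocol.numOps {Q : Type} : Protocol Q → ℕ
  | .done => 0
  | .hadamard _ P => P.numOps + 1
  | .phase _ P => P.numOps + 1
  | .cnot _ _ _ P => P.numOps + 1
  | .prepZero _ P => P.numOps + 1
  | .prepSupplied _ P => P.numOps + 1
  | .measure _ P₀ P₁ => max P₀.numOps P₁.numOps + 1

/-- The channel that a protocol performs with supply `ρ 0, ρ 1, …`, when the first `k` supplied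
states have already been used. Each supplied state is used at most once. The result is averaged
over the measurement outcomes. -/
def Protocol.run {Q : Type} [Fintype Q] [DecidableEq Q] (ρ : ℕ → Op1) :
    Protocol Q → ℕ → Op Q → Op Q
  | .done, _, σ => σ
  | .hadamard q P, k, σ =>
      P.run ρ k (onQubit q hadamardGate * σ * (onQubit q hadamardGate).conjTranspose)
  | .phase q P, k, σ =>
      P.run ρ k (onQubit q phaseGate * σ * (onQubit q phaseGate).conjTranspose)
  | .cnot c t _ P, k, σ =>
      P.run ρ k (cnotGate c t * σ * (cnotGate c t).conjTranspose)
  | .prepZero q P, k, σ => P.run ρ k (replaceQubit q (basisProj 0) σ)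
  | .prepSupplied q P, k, σ => P.run ρ (k + 1) (replaceQubit q (ρ k) σ)
  | .measure q P₀ P₁, k, σ =>
      P₀.run ρ k (onQubit q (basisProj 0) * σ * onQubit q (basisProj 0)) +
        P₁.run ρ k (onQubit q (basisProj 1) * σ * onQubit q (basisProj 1))

/-- The state `σ` of the `n` data qubits, together with `a` work qubits in state `|0⟩`. -/
def withWork {n : ℕ} (a : ℕ) (σ : Op (Fin n)) : Op (Fin n ⊕ Fin a) :=
  Matrix.of fun s t =>
    if (∀ j, s (Sum.inr j) = 0) ∧ (∀ j, t (Sum.inr j) = 0)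
    then σ (fun i => s (Sum.inl i)) (fun i => t (Sum.inl i)) else 0

/-- The partial trace over the work qubits. -/
def discardWork {n a : ℕ} (σ : Op (Fin n ⊕ Fin a)) : Op (Fin n) :=
  Matrix.of fun s t => ∑ r : Fin a → Fin 2, σ (Sum.elim s r) (Sum.elim t r)

/-- With supply `ρ`, the protocol `P` performs the unitary `U` on the data qubits up to trace
distance `δ`, whatever their initial state. -/
def Simulates {n a : ℕ} (P : Protocol (Fin n ⊕ Fin a)) (ρ : ℕ → Op1) (U : Op (Fin n))
    (δ : ℝ) : Prop :=
  ∀ σ : Op (Fin n), IsDensity σ →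
    TraceClose δ (discardWork (P.run ρ 0 (withWork a σ))) (U * σ * U.conjTranspose)

/-- Supplies of states `ρ i` with Bloch coordinates `x = y = z = f / √3`, where `f` may vary with
`i` but is at least `√(3/7) + ε`. -/
def IsSupply (ε : ℝ) (ρ : ℕ → Op1) : Prop :=
  ∃ f : ℕ → ℝ, ∀ i, √(3 / 7) + ε ≤ f i ∧ IsDensity (ρ i) ∧
    (pauliX * ρ i).trace = ((f i / √3 : ℝ) : ℂ) ∧
    (pauliY * ρ i).trace = ((f i / √3 : ℝ) : ℂ) ∧
    (pauliZ * ρ i).trace = ((f i / √3 : ℝ) : ℂ)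

/-! ### Quantum circuits -/

/-- Gates over `G`: a single-qubit gate from `G`, or a CNOT gate. -/
inductive Gate (G : Set (Matrix.unitaryGroup (Fin 2) ℂ)) (Q : Type) : Type
  | single (q : Q) (A : G) : Gate G Q
  | cnot (c t : Q) (h : c ≠ t) : Gate G Q

def Gate.op {G : Set (Matrix.unitaryGroup (Fin 2) ℂ)} {Q : Type} [Fintype Q] [DecidableEq Q] :
    Gate G Q → Op Q
  | .single q A => onQubit q (A : Matrix.unitaryGroup (Fin 2) ℂ).1
  | .cnot c t _ => cnotGate c t

/-- The unitary of a circuit; the head of the list is the gate that is applied first. -/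
def circuitOp {G : Set (Matrix.unitaryGroup (Fin 2) ℂ)} {Q : Type} [Fintype Q] [DecidableEq Q] :
    List (Gate G Q) → Op Q
  | [] => 1
  | g :: L => circuitOp L * g.op

/-- The gates in `G`, together with CNOT, approximate every unitary on any number of qubits (up to
a global phase) to any accuracy. -/
def IsUniversalGateSet (G : Set (Matrix.unitaryGroup (Fin 2) ℂ)) : Prop :=
  ∀ (n : ℕ) (U : Matrix.unitaryGroup (Fin n → Fin 2) ℂ) (δ : ℝ), 0 < δ →
    ∃ L : List (Gate G (Fin n)), ∀ σ : Op (Fin n), IsDensity σ →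
      TraceClose δ (circuitOp L * σ * (circuitOp L).conjTranspose) (U.1 * σ * U.1.conjTranspose)

/-! ### One round of distillation with the five-qubit code -/

/-- The tensor product of single-qubit operators. -/
def tensorOp {Q : Type} [Fintype Q] (A : Q → Op1) : Op Q :=
  Matrix.of fun s t => ∏ j, A j (s j) (t j)

/-- The single-qubit operator with trace one and Bloch coordinates `x = y = z = f / √3`. -/
def tState (f : ℝ) : Op1 :=
  (1 / 2 : ℂ) • (1 + ((f / √3 : ℝ) : ℂ) • (pauliX + pauliY + pauliZ))

/-- The `k`-th cyclic shift of `X ⊗ Z ⊗ Z ⊗ X ⊗ 1`. -/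
def codeStabilizer (k : Fin 5) : Op (Fin 5) :=
  tensorOp fun j => ![pauliX, pauliZ, pauliZ, pauliX, 1] (j - k)

/-- The projector on the five-qubit code: the product of the projectors on the `+1` eigenspaces of
the (commuting) stabilizers. -/
def codeProj : Op (Fin 5) :=
  (List.ofFn fun k : Fin 5 => (1 / 2 : ℂ) • (1 + codeStabilizer k)).prod

/-- The encoding isometry of the five-qubit code. Its columns are the normalized projections of
`|00000⟩` and `|11111⟩` on the code, so that `X`, `Y`, `Z` are encoded as their fifth tensor
powers. -/
def encode : Matrix (Fin 5 → Fin 2) (Fin 2) ℂ :=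
  Matrix.of fun s b => 4 * codeProj s (fun _ => b)

/-- The probability that no error is detected when the five-qubit code is decoded on the product
of the states with parameters `f 0, …, f 4`. -/
def acceptProb (f : Fin 5 → ℝ) : ℝ :=
  (codeProj * tensorOp fun i => tState (f i)).trace.re

/-- The decoded qubit, conditioned on no error being detected. -/
def distillOutput (f : Fin 5 → ℝ) : Op1 :=
  ((acceptProb f : ℂ))⁻¹ • (encode.conjTranspose * (tensorOp fun i => tState (f i)) * encode)

/-- The number `f_out` for which the decoded qubit has Bloch coordinate `z = -f_out / √3`. -/
def outFidelity (f : Fin 5 → ℝ) : ℝ :=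
  -√3 * (pauliZ * distillOutput f).trace.re

end MagicDistill

end

open MagicDistill

open MagicDistill

/-! One round of distillation. The code projector is the average of its 16 stabilizers, and the
logical Paulis are fifth tensor powers, so every expectation value on a product input is a
polynomial in the parameters. With `eₖ` the elementary symmetric polynomials in the five `f i`, the
acceptance probability is `(3 + e₄) / 48` and the output parameter is `(e₃ - 2 e₅) / (3 + e₄)`. In
one variable `x` the latter has the form `(A + x B) / (C + x A)`, so its monotonicity is the
inequality `A² ≤ B C` in the other four variables; the difference is a sum of six nonnegative terms,
one for each pair (`derivative_numerator_eq`, `pair_bound`).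

Unequal inputs. By monotonicity, five inputs with parameters at least `F` give an output at least as
good as five copies of `F`, namely `distillMap F`. This map satisfies `distillMap f - f = f (1 - f²)
(7 f² - 3) / (3 + 5 f⁴)`, so above `√(3/7)` it moves towards `1`, where the error is squared up to a
constant. Hence the error after finitely many preliminary rounds decreases doubly exponentially
(`exists_distill_error_le`), while a round multiplies the size bound by the constant `2 ^ 15`: the
cost is polylogarithmic in the inverse error. A failed attempt resets its qubits and is repeated;
`Prepares` records this as an inequality for linear functionals of the final state.

Gates. Two distilled states, a parity check and a Hadamard gate yield an equatorial state whose
teleportation rotates a data qubit by `± π / 6` with a random sign. A wrong sign is repaired by a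
Clifford phase and a further rotation (`rotGate_correct`, `run_rotate_le`). Thus circuits of
Hadamard gates, these rotations and CNOT gates are simulated (`exists_simulation`).

Universality. In the closed monoid generated by these gates and the global phases, the generators of
one-parameter groups form a real vector space, by the Lie product formula, and it is stable under
conjugation by gates. A word in the gates is a rotation with cosine `3/4`, of irrational angle by
Niven's theorem, so its axis is a generator; conjugation by Clifford gates and linear combinations
then give all skew-adjoint matrices, and every unitary is the exponential of one
(`isUniversalGateSet_simGates`). -/

namespace MagicDistill

set_option linter.unusedSectionVars false

open Matrix Function

/-! ### Matrix entries of single-qubit operators and CNOT gates. -/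

section Entries

variable {Q : Type} [Fintype Q] [DecidableEq Q]

/-- A row or column of `onQubit q A` is supported on the two basis states that agree with `s` off
`q`, so every product with such an operator becomes a sum over one bit. -/
lemma sum_agree_off {M : Type*} [AddCommMonoid M] (q : Q) (s : Q → Fin 2)
    (f : (Q → Fin 2) → M) (hf : ∀ t, ¬ (∀ j, j ≠ q → s j = t j) → f t = 0) :
    ∑ t, f t = ∑ b : Fin 2, f (update s q b) := by
  symm
  refine Finset.sum_of_injOn (fun b => update s q b) ?_ (by simp) ?_ (by simp)
  · intro b _ b' _ h
    simpa using congrFun h q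
  · intro t _ ht
    refine hf t fun h => ht ⟨t q, by simp, ?_⟩
    ext1 j
    by_cases hj : j = q
    · subst hj; simp
    · simp [hj, h j hj]

lemma onQubit_apply_of_agree {q : Q} {A : Op1} {s t : Q → Fin 2} (h : ∀ j, j ≠ q → s j = t j) :
    onQubit q A s t = A (s q) (t q) := by
  simp only [onQubit, Matrix.of_apply]; exact if_pos h

lemma onQubit_apply_of_not_agree {q : Q} {A : Op1} {s t : Q → Fin 2}
    (h : ¬ ∀ j, j ≠ q → s j = t j) : onQubit q A s t = 0 := by
  simp only [onQubit, Matrix.of_apply]; exact if_neg h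

lemma onQubit_mul_apply {ι : Type*} (q : Q) (A : Op1) (M : Matrix (Q → Fin 2) ι ℂ)
    (s : Q → Fin 2) (u : ι) :
    (onQubit q A * M) s u = ∑ b : Fin 2, A (s q) b * M (update s q b) u := by
  rw [Matrix.mul_apply, sum_agree_off q s]
  · refine Finset.sum_congr rfl fun b _ => ?_
    have : ∀ j, j ≠ q → s j = update s q b j := fun j hj => by simp [hj]
    rw [onQubit_apply_of_agree this]; simp
  · intro t ht
    rw [onQubit_apply_of_not_agree ht, zero_mul]

lemma mul_onQubit_apply {ι : Type*} (q : Q) (A : Op1) (M : Matrix ι (Q → Fin 2) ℂ)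
    (s : ι) (u : Q → Fin 2) :
    (M * onQubit q A) s u = ∑ b : Fin 2, M s (update u q b) * A b (u q) := by
  rw [Matrix.mul_apply, sum_agree_off q u]
  · refine Finset.sum_congr rfl fun b _ => ?_
    have : ∀ j, j ≠ q → update u q b j = u j := fun j hj => by simp [hj]
    rw [onQubit_apply_of_agree this]; simp
  · intro t ht
    have : ¬ ∀ j, j ≠ q → t j = u j := fun h => ht fun j hj => (h j hj).symm
    rw [onQubit_apply_of_not_agree this, mul_zero]

lemma onQubit_mul_mul_apply (q : Q) (A B : Op1) (σ : Op Q) (s t : Q → Fin 2) :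
    (onQubit q A * σ * onQubit q B) s t =
      ∑ b : Fin 2, ∑ c : Fin 2, A (s q) b * σ (update s q b) (update t q c) * B c (t q) := by
  rw [mul_onQubit_apply, Finset.sum_comm]
  simp only [onQubit_mul_apply, Finset.sum_mul]

lemma onQubit_mul (q : Q) (A B : Op1) : onQubit q A * onQubit q B = onQubit q (A * B) := by
  ext s t
  rw [onQubit_mul_apply]
  by_cases h : ∀ j, j ≠ q → s j = t j
  · have : ∀ b, ∀ j, j ≠ q → update s q b j = t j := fun b j hj => by simp [hj, h j hj]
    simp only [onQubit_apply_of_agree h, onQubit_apply_of_agree (this _), Matrix.mul_apply]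
    simp
  · have : ∀ b, ¬ ∀ j, j ≠ q → update s q b j = t j := fun b h' => h fun j hj => by
      simpa [hj] using h' j hj
    simp [onQubit_apply_of_not_agree h, onQubit_apply_of_not_agree (this _)]

lemma onQubit_conjTranspose (q : Q) (A : Op1) : (onQubit q A)ᴴ = onQubit q Aᴴ := by
  ext s t
  by_cases h : ∀ j, j ≠ q → s j = t j
  · have h' : ∀ j, j ≠ q → t j = s j := fun j hj => (h j hj).symm
    rw [conjTranspose_apply, onQubit_apply_of_agree h, onQubit_apply_of_agree h',
      conjTranspose_apply]
  · have h' : ¬ ∀ j, j ≠ q → t j = s j := fun h' => h fun j hj => (h' j hj).symm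
    rw [conjTranspose_apply, onQubit_apply_of_not_agree h, onQubit_apply_of_not_agree h', star_zero]

lemma onQubit_one (q : Q) : onQubit q 1 = (1 : Op Q) := by
  ext s t
  by_cases h : s = t
  · subst h; simp [onQubit]
  · rw [Matrix.one_apply_ne h]
    by_cases h' : ∀ j, j ≠ q → s j = t j
    · have : s q ≠ t q := fun hq => h (funext fun j => by
        by_cases hj : j = q
        · rw [hj, hq]
        · exact h' j hj)
      rw [onQubit_apply_of_agree h', Matrix.one_apply_ne this]
    · rw [onQubit_apply_of_not_agree h']

lemma onQubit_add (q : Q) (A B : Op1) : onQubit q (A + B) = onQubit q A + onQubit q B := by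
  ext s t
  by_cases h : ∀ j, j ≠ q → s j = t j
  · simp [onQubit_apply_of_agree h]
  · simp [onQubit_apply_of_not_agree h]

lemma onQubit_smul (q : Q) (c : ℂ) (A : Op1) : onQubit q (c • A) = c • onQubit q A := by
  ext s t
  by_cases h : ∀ j, j ≠ q → s j = t j
  · simp [onQubit_apply_of_agree h]
  · simp [onQubit_apply_of_not_agree h]

/-- The action of a CNOT on computational basis states. -/
def flip (c t : Q) (s : Q → Fin 2) : Q → Fin 2 := update s t (s t + s c)

lemma flip_flip {c t : Q} (h : c ≠ t) (s : Q → Fin 2) : flip c t (flip c t s) = s := by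
  have h2 : ∀ x y : Fin 2, x + y + y = x := by decide
  ext1 j
  by_cases hj : j = t
  · subst hj; simp [flip, h, h2]
  · simp [flip, hj]

lemma eq_flip_iff {c t : Q} (h : c ≠ t) (s u : Q → Fin 2) : s = flip c t u ↔ u = flip c t s :=
  ⟨fun e => by rw [e, flip_flip h], fun e => by rw [e, flip_flip h]⟩

lemma cnot_mul_apply {ι : Type*} {c t : Q} (h : c ≠ t) (M : Matrix (Q → Fin 2) ι ℂ)
    (s : Q → Fin 2) (u : ι) : (cnotGate c t * M) s u = M (flip c t s) u := by
  have : ∀ v, cnotGate c t s v = if v = flip c t s then 1 else 0 := fun v => by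
    simp only [cnotGate, Matrix.of_apply]
    exact if_congr (eq_flip_iff h s v) rfl rfl
  simp [Matrix.mul_apply, this]

lemma cnot_conjTranspose {c t : Q} (h : c ≠ t) : (cnotGate c t)ᴴ = cnotGate c t := by
  ext s u
  have : (u = flip c t s) ↔ (s = flip c t u) := (eq_flip_iff h s u).symm
  simp only [flip] at this
  simp [cnotGate, this]

lemma mul_cnot_apply {ι : Type*} (c t : Q) (M : Matrix ι (Q → Fin 2) ℂ)
    (s : ι) (u : Q → Fin 2) : (M * cnotGate c t) s u = M s (flip c t u) := by
  simp [Matrix.mul_apply, cnotGate, flip]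

lemma cnot_conj_apply {c t : Q} (h : c ≠ t) (σ : Op Q) (s u : Q → Fin 2) :
    (cnotGate c t * σ * (cnotGate c t)ᴴ) s u = σ (flip c t s) (flip c t u) := by
  rw [cnot_conjTranspose h, mul_cnot_apply, cnot_mul_apply h]

lemma cnot_mul_cnot {c t : Q} (h : c ≠ t) : cnotGate c t * cnotGate c t = 1 := by
  ext s u
  rw [cnot_mul_apply h]
  simp only [cnotGate, Matrix.of_apply, Matrix.one_apply]
  refine if_congr ⟨fun e => ?_, fun e => e ▸ rfl⟩ rfl rfl
  rw [← flip_flip h s, ← flip_flip h u]; exact congrArg _ e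

end Entries

/-! ### Protocols as linear, positive and trace-preserving maps. -/

section Channels

variable {Q : Type} [Fintype Q] [DecidableEq Q]

lemma replaceQubit_add (q : Q) (τ : Op1) (σ σ' : Op Q) :
    replaceQubit q τ (σ + σ') = replaceQubit q τ σ + replaceQubit q τ σ' := by
  ext s t; simp [replaceQubit]; ring

lemma replaceQubit_smul (q : Q) (τ : Op1) (c : ℂ) (σ : Op Q) :
    replaceQubit q τ (c • σ) = c • replaceQubit q τ σ := by
  ext s t; simp [replaceQubit]; ring

lemma replaceQubit_add_left (q : Q) (τ τ' : Op1) (σ : Op Q) :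
    replaceQubit q (τ + τ') σ = replaceQubit q τ σ + replaceQubit q τ' σ := by
  ext s t; simp [replaceQubit]; ring

lemma replaceQubit_smul_left (q : Q) (τ : Op1) (c : ℂ) (σ : Op Q) :
    replaceQubit q (c • τ) σ = c • replaceQubit q τ σ := by
  ext s t; simp [replaceQubit]; ring

lemma run_add (ρ : ℕ → Op1) (P : Protocol Q) (k : ℕ) (σ σ' : Op Q) :
    P.run ρ k (σ + σ') = P.run ρ k σ + P.run ρ k σ' := by
  induction P generalizing k σ σ' with
  | done => rfl
  | measure q P₀ P₁ h₀ h₁ =>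
    simp only [Protocol.run, mul_add, add_mul, h₀, h₁]; abel
  | _ => simp_all [Protocol.run, mul_add, add_mul, replaceQubit_add]

lemma run_smul (ρ : ℕ → Op1) (P : Protocol Q) (k : ℕ) (c : ℂ) (σ : Op Q) :
    P.run ρ k (c • σ) = c • P.run ρ k σ := by
  induction P generalizing k σ with
  | done => rfl
  | measure q P₀ P₁ h₀ h₁ => simp [Protocol.run, h₀, h₁]
  | _ => simp_all [Protocol.run, replaceQubit_smul]

/-- The replaced state is the entrywise product of `τ`, pulled back along the bit `q`, with a
partial trace of `σ`; positivity is the Schur product theorem. -/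
lemma replaceQubit_posSemidef {q : Q} {τ : Op1} {σ : Op Q} (hτ : τ.PosSemidef)
    (hσ : σ.PosSemidef) : (replaceQubit q τ σ).PosSemidef := by
  have h1 := hτ.submatrix (fun s : Q → Fin 2 => s q)
  have h2 : ∀ b : Fin 2, (σ.submatrix (fun s => update s q b) (fun s => update s q b)).PosSemidef :=
    fun b => hσ.submatrix _
  have h3 : replaceQubit q τ σ = (τ.submatrix (fun s : Q → Fin 2 => s q) (fun s => s q)) ⊙
      (σ.submatrix (fun s => update s q 0) (fun s => update s q 0) +
        σ.submatrix (fun s => update s q 1) (fun s => update s q 1)) := by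
    ext s t
    simp [replaceQubit, Matrix.hadamard]
  rw [h3]
  exact h1.hadamard ((h2 0).add (h2 1))

lemma replaceQubit_trace (q : Q) (τ : Op1) (σ : Op Q) :
    (replaceQubit q τ σ).trace = τ.trace * σ.trace := by
  -- Exchanging the bit at `q` with the summation bit separates the two traces.
  let e : ((Q → Fin 2) × Fin 2) ≃ ((Q → Fin 2) × Fin 2) :=
    { toFun := fun p => (update p.1 q p.2, p.1 q)
      invFun := fun p => (update p.1 q p.2, p.1 q)
      left_inv := fun p => by simp
      right_inv := fun p => by simp }
  simp only [Matrix.trace, Matrix.diag, replaceQubit, Matrix.of_apply, Finset.mul_sum,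
    Finset.sum_mul]
  rw [← Fintype.sum_prod_type', ← Fintype.sum_prod_type'
    (f := fun (s : Q → Fin 2) (b : Fin 2) => τ b b * σ s s)]
  exact Fintype.sum_equiv e _ _ fun p => by simp [e]

lemma basisProj_posSemidef (b : Fin 2) : (basisProj b).PosSemidef := by
  have : basisProj b = (basisProj b)ᴴ * basisProj b := by
    simp [basisProj]
  rw [this]; exact Matrix.posSemidef_conjTranspose_mul_self _

lemma basisProj_conjTranspose (b : Fin 2) : (basisProj b)ᴴ = basisProj b := by simp [basisProj]

lemma basisProj_trace (b : Fin 2) : (basisProj b).trace = 1 := by simp [basisProj]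

lemma basisProj_mul_self (b : Fin 2) : basisProj b * basisProj b = basisProj b := by
  simp [basisProj]

lemma basisProj_add : basisProj 0 + basisProj 1 = 1 := by
  ext i j; fin_cases i <;> fin_cases j <;> simp [basisProj, Matrix.single]

lemma basisProj_apply (b i j : Fin 2) : basisProj b i j = if i = b ∧ j = b then 1 else 0 := by
  simp only [basisProj, Matrix.single, Matrix.of_apply]
  exact if_congr (by tauto) rfl rfl

lemma hadamardGate_apply (i j : Fin 2) :
    hadamardGate i j = ((1 / √2 : ℝ) : ℂ) * (if i = 1 ∧ j = 1 then -1 else 1) := by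
  fin_cases i <;> fin_cases j <;> simp [hadamardGate]

lemma sqrt_two_inv_mul_self : (((1 / √2 : ℝ) : ℂ)) * ((1 / √2 : ℝ) : ℂ) = 1 / 2 := by
  rw [← Complex.ofReal_mul]
  have : (1 / √2) * (1 / √2) = (1 / 2 : ℝ) := by
    rw [div_mul_div_comm, Real.mul_self_sqrt (by norm_num)]; norm_num
  rw [this]; norm_num

lemma hadamardGate_conjTranspose : hadamardGateᴴ = hadamardGate := by
  ext i j; fin_cases i <;> fin_cases j <;> simp [hadamardGate]

lemma hadamardGate_mul_self : hadamardGate * hadamardGate = 1 := by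
  ext i j
  have := sqrt_two_inv_mul_self
  fin_cases i <;> fin_cases j <;>
    simp only [Matrix.mul_apply, hadamardGate_apply, Fin.sum_univ_two] <;> simp <;>
    simp at this <;> linear_combination 2 * this

lemma phaseGate_unitary : phaseGateᴴ * phaseGate = 1 := by
  ext i j
  fin_cases i <;> fin_cases j <;> simp [phaseGate, Matrix.mul_apply]

lemma onQubit_unitary (q : Q) {A : Op1} (h : Aᴴ * A = 1) :
    (onQubit q A)ᴴ * onQubit q A = 1 := by
  rw [onQubit_conjTranspose, onQubit_mul, h, onQubit_one]

lemma trace_unitary_conj {ι : Type*} [Fintype ι] [DecidableEq ι] {U : Matrix ι ι ℂ}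
    (h : Uᴴ * U = 1) (σ : Matrix ι ι ℂ) : (U * σ * Uᴴ).trace = σ.trace := by
  rw [Matrix.trace_mul_comm, ← Matrix.mul_assoc, h, Matrix.one_mul]

lemma cnot_unitary {c t : Q} (h : c ≠ t) : (cnotGate c t)ᴴ * cnotGate c t = 1 := by
  rw [cnot_conjTranspose h, cnot_mul_cnot h]

lemma run_posSemidef {ρ : ℕ → Op1} (hρ : ∀ i, (ρ i).PosSemidef) (P : Protocol Q) (k : ℕ)
    {σ : Op Q} (hσ : σ.PosSemidef) : (P.run ρ k σ).PosSemidef := by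
  induction P generalizing k σ with
  | done => exact hσ
  | hadamard q P h => exact h _ (hσ.mul_mul_conjTranspose_same _)
  | phase q P h => exact h _ (hσ.mul_mul_conjTranspose_same _)
  | cnot c t _ P h => exact h _ (hσ.mul_mul_conjTranspose_same _)
  | prepZero q P h => exact h _ (replaceQubit_posSemidef (basisProj_posSemidef 0) hσ)
  | prepSupplied q P h => exact h _ (replaceQubit_posSemidef (hρ k) hσ)
  | measure q P₀ P₁ h₀ h₁ =>
    have : ∀ b, (onQubit q (basisProj b) * σ * onQubit q (basisProj b)).PosSemidef := fun b => by
      have := hσ.mul_mul_conjTranspose_same (onQubit q (basisProj b))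
      rwa [onQubit_conjTranspose, basisProj_conjTranspose] at this
    exact (h₀ _ (this 0)).add (h₁ _ (this 1))

lemma run_trace {ρ : ℕ → Op1} (hρ : ∀ i, (ρ i).trace = 1) (P : Protocol Q) (k : ℕ) (σ : Op Q) :
    (P.run ρ k σ).trace = σ.trace := by
  induction P generalizing k σ with
  | done => rfl
  | hadamard q P h =>
    rw [Protocol.run, h, trace_unitary_conj (onQubit_unitary q _)]
    rw [hadamardGate_conjTranspose, hadamardGate_mul_self]
  | phase q P h => rw [Protocol.run, h, trace_unitary_conj (onQubit_unitary q phaseGate_unitary)]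
  | cnot c t hct P h => rw [Protocol.run, h, trace_unitary_conj (cnot_unitary hct)]
  | prepZero q P h => rw [Protocol.run, h, replaceQubit_trace, basisProj_trace, one_mul]
  | prepSupplied q P h => rw [Protocol.run, h, replaceQubit_trace, hρ, one_mul]
  | measure q P₀ P₁ h₀ h₁ =>
    have : ∀ b, (onQubit q (basisProj b) * σ * onQubit q (basisProj b)).trace =
        (onQubit q (basisProj b) * σ).trace := fun b => by
      rw [Matrix.trace_mul_comm, ← Matrix.mul_assoc, onQubit_mul, basisProj_mul_self]
    rw [Protocol.run, Matrix.trace_add, h₀, h₁, this, this, ← Matrix.trace_add, ← Matrix.add_mul,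
      ← onQubit_add, basisProj_add, onQubit_one, Matrix.one_mul]

end Channels

/-! ### Computing on a clean block of qubits. -/

section Blocks

variable {Q : Type} [Fintype Q] [DecidableEq Q]

/-- States that vanish unless all qubits in `S` are in the state `|0⟩`. -/
def Clean (S : Set Q) (σ : Op Q) : Prop :=
  ∀ s t, (∃ w ∈ S, s w ≠ 0 ∨ t w ≠ 0) → σ s t = 0

lemma Clean.mono {S T : Set Q} {σ : Op Q} (h : Clean T σ) (hST : S ⊆ T) : Clean S σ :=
  fun s t ⟨w, hw, hst⟩ => h s t ⟨w, hST hw, hst⟩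

variable {B : Type} [Fintype B] [DecidableEq B]

/-- Reset the qubits in the range of `e` to zero. -/
def clear (e : B → Q) (s : Q → Fin 2) : Q → Fin 2 := fun j => if ∃ i, e i = j then 0 else s j

/-- Put the qubits in the range of `e` in the state `τ`, if they were in the state `|0⟩`. -/
def put (e : B → Q) (τ : Op B) (σ : Op Q) : Op Q :=
  Matrix.of fun s t => τ (s ∘ e) (t ∘ e) * σ (clear e s) (clear e t)

@[simp] lemma clear_update (e : B → Q) (i : B) (s : Q → Fin 2) (b : Fin 2) :
    clear e (update s (e i) b) = clear e s := by
  ext1 j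
  by_cases h : ∃ i, e i = j
  · simp [clear, h]
  · have : j ≠ e i := fun hj => h ⟨i, hj.symm⟩
    simp [clear, h, this]

lemma update_comp {e : B → Q} (he : Injective e) (i : B) (s : Q → Fin 2) (b : Fin 2) :
    update s (e i) b ∘ e = update (s ∘ e) i b := update_comp_eq_of_injective s he i b

/-- With its analogues for CNOT and for replacement, this lets a subroutine be computed on its block
alone, whatever the state `σ` of the register. -/
lemma put_onQubit {e : B → Q} (he : Injective e) (i : B) (A A' : Op1) (τ : Op B) (σ : Op Q) :
    onQubit (e i) A * put e τ σ * onQubit (e i) A' =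
      put e (onQubit i A * τ * onQubit i A') σ := by
  ext s t
  simp only [onQubit_mul_mul_apply, put, Matrix.of_apply, update_comp he, clear_update,
    Finset.sum_mul]
  refine Finset.sum_congr rfl fun b _ => Finset.sum_congr rfl fun c _ => ?_
  simp only [Function.comp_apply]; ring

lemma put_cnot {e : B → Q} (he : Injective e) {c t : B} (hct : c ≠ t) (τ : Op B) (σ : Op Q) :
    cnotGate (e c) (e t) * put e τ σ * (cnotGate (e c) (e t))ᴴ =
      put e (cnotGate c t * τ * (cnotGate c t)ᴴ) σ := by
  ext s u
  simp only [cnot_conj_apply (he.ne hct), put, Matrix.of_apply, cnot_conj_apply hct, flip,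
    update_comp he, clear_update, Function.comp_apply]

lemma put_replaceQubit {e : B → Q} (he : Injective e) (i : B) (τ' : Op1) (τ : Op B) (σ : Op Q) :
    replaceQubit (e i) τ' (put e τ σ) = put e (replaceQubit i τ' τ) σ := by
  ext s t
  simp only [replaceQubit, put, Matrix.of_apply, update_comp he, clear_update, Function.comp_apply,
    ← Finset.sum_mul, mul_assoc]

lemma put_smul (e : B → Q) (c : ℂ) (τ : Op B) (σ : Op Q) : put e (c • τ) σ = c • put e τ σ := by
  ext s t; simp [put, mul_assoc]

/-- All qubits in the state `|0⟩`. -/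
def zeroState (B : Type) [Fintype B] [DecidableEq B] : Op B := Matrix.single 0 0 1

/-- Entry to and exit from the block calculus: a clean register already has the form `put e τ σ`. -/
lemma put_zeroState {e : B → Q} {σ : Op Q} (h : Clean (Set.range e) σ) :
    put e (zeroState B) σ = σ := by
  ext s t
  by_cases hs : (∀ i, s (e i) = 0) ∧ ∀ i, t (e i) = 0
  · have h1 : s ∘ e = 0 := funext hs.1
    have h2 : t ∘ e = 0 := funext hs.2
    have h3 : clear e s = s := by
      ext1 j; by_cases hj : ∃ i, e i = j
      · obtain ⟨i, rfl⟩ := hj; simp [clear, hs.1]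
      · simp [clear, hj]
    have h4 : clear e t = t := by
      ext1 j; by_cases hj : ∃ i, e i = j
      · obtain ⟨i, rfl⟩ := hj; simp [clear, hs.2]
      · simp [clear, hj]
    simp [put, zeroState, h1, h2, h3, h4]
  · have h0 : σ s t = 0 := by
      refine h s t ?_
      simp only [not_and_or, not_forall] at hs
      rcases hs with ⟨i, hi⟩ | ⟨i, hi⟩
      · exact ⟨e i, ⟨i, rfl⟩, Or.inl hi⟩
      · exact ⟨e i, ⟨i, rfl⟩, Or.inr hi⟩
    have : zeroState B (s ∘ e) (t ∘ e) = 0 := by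
      simp only [zeroState, Matrix.single, Matrix.of_apply, ite_eq_right_iff]
      rintro ⟨h1, h2⟩
      exact absurd ⟨fun i => (congrFun h1 i).symm, fun i => (congrFun h2 i).symm⟩ hs
    simp [put, this, h0]

/-- After all qubits of a block have been reset, only its trace survives, which is the weight of the
branch. -/
lemma eq_zeroState_of_clean {τ : Op B} (h : Clean Set.univ τ) : τ = τ.trace • zeroState B := by
  have h0 : ∀ s t, (s ≠ 0 ∨ t ≠ 0) → τ s t = 0 := by
    intro s t hst
    refine h s t ?_
    rcases hst with hst | hst <;> obtain ⟨i, hi⟩ := Function.ne_iff.mp hst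
    · exact ⟨i, trivial, Or.inl hi⟩
    · exact ⟨i, trivial, Or.inr hi⟩
  have ht : τ.trace = τ 0 0 := by
    rw [Matrix.trace, Finset.sum_eq_single 0]
    · rfl
    · intro s _ hs; exact h0 s s (Or.inl hs)
    · simp
  ext s t
  by_cases hst : s = 0 ∧ t = 0
  · obtain ⟨rfl, rfl⟩ := hst; simp [ht, zeroState]
  · rw [h0 s t (by tauto)]
    have : ¬ (0 = s ∧ 0 = t) := fun h => hst ⟨h.1.symm, h.2.symm⟩
    simp [zeroState, Matrix.single, this]

lemma clean_replaceQubit_zero {S : Set Q} {σ : Op Q} (h : Clean S σ) (q : Q) :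
    Clean (insert q S) (replaceQubit q (basisProj 0) σ) := by
  rintro s t ⟨w, hw, hst⟩
  by_cases hwq : w = q
  · subst hwq
    have : ¬ (s w = 0 ∧ t w = 0) := by tauto
    simp [replaceQubit, basisProj_apply, this]
  · have hw' : w ∈ S := by simpa [hwq] using hw
    simp only [replaceQubit, Matrix.of_apply]
    rw [Finset.sum_eq_zero, mul_zero]
    exact fun b _ => h _ _ ⟨w, hw', by simpa [hwq] using hst⟩

end Blocks

end MagicDistill

namespace MagicDistill

set_option linter.unusedSectionVars false

open Matrix Function

/-! ### Products and traces of tensor products. -/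

section Tensor

variable {Q : Type} [Fintype Q] [DecidableEq Q]

lemma tensorOp_mul (A B : Q → Op1) : tensorOp A * tensorOp B = tensorOp fun j => A j * B j := by
  ext s t
  simp only [Matrix.mul_apply, tensorOp, Matrix.of_apply, ← Finset.prod_mul_distrib]
  rw [Finset.prod_univ_sum]
  simp

lemma tensorOp_trace (A : Q → Op1) : (tensorOp A).trace = ∏ j, (A j).trace := by
  simp only [Matrix.trace, Matrix.diag, tensorOp, Matrix.of_apply]
  rw [Finset.prod_univ_sum]
  simp

end Tensor

/-! ### The five-qubit code -/

/-- The integer matrices `1`, `X`, `Z` and `ZX = iY`. -/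
def realPauli (a : Fin 4) (i j : Fin 2) : ℤ :=
  if i.val ^^^ j.val = a.val % 2 then (if i.val * (a.val / 2) = 0 then 1 else -1) else 0

/-- An integer matrix as an operator on a qubit. -/
def intOp (A : Fin 2 → Fin 2 → ℤ) : Op1 := Matrix.of fun i j => (A i j : ℂ)

/-- The entry of a tensor product of five of the matrices `realPauli`. -/
def wordEntry (s₀ s₁ s₂ s₃ s₄ t₀ t₁ t₂ t₃ t₄ : Fin 2) (a b c d e : Fin 4) : ℤ :=
  realPauli a s₀ t₀ * (realPauli b s₁ t₁ * (realPauli c s₂ t₂ *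
    (realPauli d s₃ t₃ * realPauli e s₄ t₄)))

/-- The sum over the 16 stabilizers of the five-qubit code. -/
def stabilizerSum {R : Type*} [Ring R] (f : Fin 4 → Fin 4 → Fin 4 → Fin 4 → Fin 4 → R) : R :=
  f 0 0 0 0 0 +
    (f 1 2 2 1 0 +
      f 0 1 2 2 1 +
      f 1 0 1 2 2 +
      f 2 1 0 1 2 +
      f 2 2 1 0 1) -
    (f 3 1 1 3 0 +
      f 0 3 1 1 3 +
      f 3 0 3 1 1 +
      f 1 3 0 3 1 +
      f 1 1 3 0 3) -
    (f 2 3 3 2 0 +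
      f 0 2 3 3 2 +
      f 2 0 2 3 3 +
      f 3 2 0 2 3 +
      f 3 3 2 0 2)

/-- The sign of a computational basis state in the graph state of the five-cycle. -/
def ringSign (s₀ s₁ s₂ s₃ s₄ : Fin 2) : ℤ :=
  if s₀ * s₁ + s₁ * s₂ + s₂ * s₃ + s₃ * s₄ + s₄ * s₀ = 0 then 1 else -1

/-- The entries of the code projector, multiplied by 16. -/
def codeInt (s₀ s₁ s₂ s₃ s₄ t₀ t₁ t₂ t₃ t₄ : Fin 2) : ℤ :=
  if s₀ + s₁ + s₂ + s₃ + s₄ = t₀ + t₁ + t₂ + t₃ + t₄ then ringSign s₀ s₁ s₂ s₃ s₄ * ringSign t₀ t₁ t₂ t₃ t₄ else 0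

/-- A sign attached to a bit. -/
def bitSign (b : Fin 2) : ℤ := if b = 0 then 1 else -1

/-- The entries of the product of the operators `1 + codeStabilizer k`. -/
def prodEntry (s₀ s₁ s₂ s₃ s₄ t₀ t₁ t₂ t₃ t₄ : Fin 2) : ℤ :=
  let p₅ := fun s₀ s₁ s₂ s₃ s₄ : Fin 2 =>
    if s₀ = t₀ ∧ s₁ = t₁ ∧ s₂ = t₂ ∧ s₃ = t₃ ∧ s₄ = t₄ then (1 : ℤ) else 0
  let p₄ := fun s₀ s₁ s₂ s₃ s₄ : Fin 2 =>
    p₅ s₀ s₁ s₂ s₃ s₄ + bitSign (s₀ + s₁) * p₅ s₀ s₁ (s₂ + 1) s₃ (s₄ + 1)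
  let p₃ := fun s₀ s₁ s₂ s₃ s₄ : Fin 2 =>
    p₄ s₀ s₁ s₂ s₃ s₄ + bitSign (s₄ + s₀) * p₄ s₀ (s₁ + 1) s₂ (s₃ + 1) s₄
  let p₂ := fun s₀ s₁ s₂ s₃ s₄ : Fin 2 =>
    p₃ s₀ s₁ s₂ s₃ s₄ + bitSign (s₃ + s₄) * p₃ (s₀ + 1) s₁ (s₂ + 1) s₃ s₄
  let p₁ := fun s₀ s₁ s₂ s₃ s₄ : Fin 2 =>
    p₂ s₀ s₁ s₂ s₃ s₄ + bitSign (s₂ + s₃) * p₂ s₀ (s₁ + 1) s₂ s₃ (s₄ + 1)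
  p₁ s₀ s₁ s₂ s₃ s₄ + bitSign (s₁ + s₂) * p₁ (s₀ + 1) s₁ s₂ (s₃ + 1) s₄

/-- The factor `2` appears because the five cyclic shifts multiply to the identity: on the image of
the other four projectors the fifth stabilizer acts trivially, so its factor `1 + S` doubles. -/
lemma prodEntry_eq : ∀ s₀ s₁ s₂ s₃ s₄ t₀ t₁ t₂ t₃ t₄,
    prodEntry s₀ s₁ s₂ s₃ s₄ t₀ t₁ t₂ t₃ t₄ = 2 * codeInt s₀ s₁ s₂ s₃ s₄ t₀ t₁ t₂ t₃ t₄ := by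
  decide +kernel

/-- The same projector as a sum over the stabilizer group. Writing `ZX = iY` for the third Pauli
keeps all entries integral, so that finitely many cases can be checked; two such factors contribute
`(iY) ⊗ (iY) = -Y ⊗ Y`, whence the minus signs in `stabilizerSum`. -/
lemma stabilizerSum_wordEntry : ∀ s₀ s₁ s₂ s₃ s₄ t₀ t₁ t₂ t₃ t₄,
    stabilizerSum (wordEntry s₀ s₁ s₂ s₃ s₄ t₀ t₁ t₂ t₃ t₄) = codeInt s₀ s₁ s₂ s₃ s₄ t₀ t₁ t₂ t₃ t₄ := by
  decide +kernel

end MagicDistill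

namespace MagicDistill

open Matrix Function

lemma codeStabilizer_mul_apply (k : Fin 5) (M : Op (Fin 5)) (s t : Fin 5 → Fin 2) :
    (codeStabilizer k * M) s t = (bitSign (s (k + 1) + s (k + 2)) : ℂ) *
      M (fun j => if j = k ∨ j = k + 3 then s j + 1 else s j) t := by
  have hfac : ∀ (d : Fin 5) (a b : Fin 2), (![pauliX, pauliZ, pauliZ, pauliX, 1] d : Op1) a b =
      if b = (if d = 0 ∨ d = 3 then a + 1 else a) then
        (if d = 1 ∨ d = 2 then (bitSign a : ℂ) else 1) else 0 := by
    intro d a b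
    have hb : ∀ a b : Fin 2, (1 : Op1) a b = if b = a then 1 else 0 := fun a b => by
      rw [Matrix.one_apply]; exact if_congr eq_comm rfl rfl
    have hX : ∀ a b : Fin 2, pauliX a b = if b = a + 1 then 1 else 0 := by
      intro a b; fin_cases a <;> fin_cases b <;> simp [pauliX]
    have hZ : ∀ a b : Fin 2, pauliZ a b = if b = a then (bitSign a : ℂ) else 0 := by
      intro a b; fin_cases a <;> fin_cases b <;> simp [pauliZ, bitSign]
    match d with
    | 0 => exact hX a b
    | 1 => exact hZ a b
    | 2 => exact hZ a b
    | 3 => exact hX a b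
    | 4 => exact hb a b
  have hs : ∀ a b : Fin 2, bitSign (a + b) = bitSign a * bitSign b := by decide
  have h0 : ∀ j k : Fin 5, j - k = 0 ∨ j - k = 3 ↔ j = k ∨ j = k + 3 := by decide
  have key : ∀ u, codeStabilizer k s u =
      if u = (fun j => if j = k ∨ j = k + 3 then s j + 1 else s j) then
        (bitSign (s (k + 1) + s (k + 2)) : ℂ) else 0 := by
    intro u
    simp only [codeStabilizer, tensorOp, Matrix.of_apply, hfac, h0]
    split_ifs with hu
    · subst hu
      simp only [if_true]
      rw [← Equiv.prod_comp (Equiv.addRight k)]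
      simp only [Equiv.coe_addRight, add_sub_cancel_right, Fin.prod_univ_five, hs]
      change (1 : ℂ) * bitSign (s (1 + k)) * bitSign (s (2 + k)) * 1 * 1 = _
      rw [add_comm 1 k, add_comm 2 k]; push_cast; ring
    · obtain ⟨j, hj⟩ := Function.ne_iff.mp hu
      exact Finset.prod_eq_zero (Finset.mem_univ j) (if_neg hj)
  simp [Matrix.mul_apply, key]

/-- Applies one factor of `codeProj` to a column of integers, collecting the halves in the scalar
`c`. -/
lemma halfSum_mul_apply {k : Fin 5} {M : Op (Fin 5)} {t : Fin 5 → Fin 2} {c : ℂ}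
    {F G : (Fin 5 → Fin 2) → ℤ} (h : ∀ s, M s t = c * F s)
    (hG : ∀ s, G s = F s + bitSign (s (k + 1) + s (k + 2)) *
      F (fun j => if j = k ∨ j = k + 3 then s j + 1 else s j)) (s : Fin 5 → Fin 2) :
    ((1 / 2 : ℂ) • (1 + codeStabilizer k) * M) s t = (c / 2) * G s := by
  rw [Matrix.smul_mul, Matrix.add_mul, Matrix.one_mul, Matrix.smul_apply, Matrix.add_apply,
    codeStabilizer_mul_apply, smul_eq_mul, h, h, hG]
  push_cast; ring

lemma codeProj_apply (s t : Fin 5 → Fin 2) :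
    codeProj s t = (1 / 16 : ℂ) *
      codeInt (s 0) (s 1) (s 2) (s 3) (s 4) (t 0) (t 1) (t 2) (t 3) (t 4) := by
  have h := prodEntry_eq (s 0) (s 1) (s 2) (s 3) (s 4) (t 0) (t 1) (t 2) (t 3) (t 4)
  -- Five halvings give `1 / 32`, and the doubling in `prodEntry_eq` brings this to `1 / 16`.
  have h' : (1 / 16 : ℂ) * codeInt (s 0) (s 1) (s 2) (s 3) (s 4) (t 0) (t 1) (t 2) (t 3) (t 4) =
      (1 / 2 / 2 / 2 / 2 / 2 : ℂ) *
        prodEntry (s 0) (s 1) (s 2) (s 3) (s 4) (t 0) (t 1) (t 2) (t 3) (t 4) := by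
    rw [h]; push_cast; ring
  rw [h', codeProj, List.ofFn_succ, List.ofFn_succ, List.ofFn_succ, List.ofFn_succ, List.ofFn_succ,
    List.ofFn_zero]
  simp only [List.prod_cons, List.prod_nil]
  set F : Fin 2 → Fin 2 → Fin 2 → Fin 2 → Fin 2 → ℤ := fun a b c d e =>
    if a = t 0 ∧ b = t 1 ∧ c = t 2 ∧ d = t 3 ∧ e = t 4 then (1 : ℤ) else 0 with hF
  have hp : ∀ u : Fin 5 → Fin 2, (1 : Op (Fin 5)) u t = 1 * F (u 0) (u 1) (u 2) (u 3) (u 4) := by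
    intro u
    rw [Matrix.one_apply, hF, one_mul]
    push_cast
    refine if_congr ?_ rfl rfl
    simp [funext_iff, Fin.forall_fin_succ]
  -- The layers are those of `prodEntry`, starting from the rightmost factor `k = 4`, so that each
  -- application of `halfSum_mul_apply` closes definitionally.
  let p₄ := fun s₀ s₁ s₂ s₃ s₄ : Fin 2 =>
    F s₀ s₁ s₂ s₃ s₄ + bitSign (s₀ + s₁) * F s₀ s₁ (s₂ + 1) s₃ (s₄ + 1)
  let p₃ := fun s₀ s₁ s₂ s₃ s₄ : Fin 2 =>
    p₄ s₀ s₁ s₂ s₃ s₄ + bitSign (s₄ + s₀) * p₄ s₀ (s₁ + 1) s₂ (s₃ + 1) s₄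
  let p₂ := fun s₀ s₁ s₂ s₃ s₄ : Fin 2 =>
    p₃ s₀ s₁ s₂ s₃ s₄ + bitSign (s₃ + s₄) * p₃ (s₀ + 1) s₁ (s₂ + 1) s₃ s₄
  let p₁ := fun s₀ s₁ s₂ s₃ s₄ : Fin 2 =>
    p₂ s₀ s₁ s₂ s₃ s₄ + bitSign (s₂ + s₃) * p₂ s₀ (s₁ + 1) s₂ s₃ (s₄ + 1)
  have h4 := halfSum_mul_apply (k := 4) hp
    (G := fun u => p₄ (u 0) (u 1) (u 2) (u 3) (u 4)) fun _ => rfl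
  have h3 := halfSum_mul_apply (k := 3) h4
    (G := fun u => p₃ (u 0) (u 1) (u 2) (u 3) (u 4)) fun _ => rfl
  have h2 := halfSum_mul_apply (k := 2) h3
    (G := fun u => p₂ (u 0) (u 1) (u 2) (u 3) (u 4)) fun _ => rfl
  have h1 := halfSum_mul_apply (k := 1) h2
    (G := fun u => p₁ (u 0) (u 1) (u 2) (u 3) (u 4)) fun _ => rfl
  exact halfSum_mul_apply (k := 0) h1
    (G := fun u => prodEntry (u 0) (u 1) (u 2) (u 3) (u 4) (t 0) (t 1) (t 2) (t 3) (t 4))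
    (fun _ => rfl) s

end MagicDistill

namespace MagicDistill

open Matrix Function

/-- The operators `1`, `X`, `Z` and `ZX = iY`. -/
def realPauliOp (a : Fin 4) : Op1 := intOp (realPauli a)

lemma realPauliOp_apply (a : Fin 4) (i j : Fin 2) : realPauliOp a i j = realPauli a i j := rfl

lemma realPauliOp_eq (a : Fin 4) (A : Fin 2 → Fin 2 → ℤ) (h : realPauli a = A) :
    realPauliOp a = !![(A 0 0 : ℂ), A 0 1; A 1 0, A 1 1] := by
  subst h
  ext i j; fin_cases i <;> fin_cases j <;> rfl

lemma realPauliOp_zero : realPauliOp 0 = 1 := by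
  rw [realPauliOp_eq 0 ![![1, 0], ![0, 1]] (by decide)]
  ext i j; fin_cases i <;> fin_cases j <;> simp

lemma realPauliOp_one : realPauliOp 1 = pauliX := by
  rw [realPauliOp_eq 1 ![![0, 1], ![1, 0]] (by decide)]
  ext i j; fin_cases i <;> fin_cases j <;> simp [pauliX]

lemma realPauliOp_two : realPauliOp 2 = pauliZ := by
  rw [realPauliOp_eq 2 ![![1, 0], ![0, -1]] (by decide)]
  ext i j; fin_cases i <;> fin_cases j <;> simp [pauliZ]

lemma realPauliOp_three : realPauliOp 3 = Complex.I • pauliY := by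
  rw [realPauliOp_eq 3 ![![0, 1], ![-1, 0]] (by decide)]
  ext i j; fin_cases i <;> fin_cases j <;> simp [pauliY]

/-- The tensor product of five of the operators `1`, `X`, `Z` and `ZX`. -/
def word (a b c d e : Fin 4) : Op (Fin 5) :=
  tensorOp ![realPauliOp a, realPauliOp b, realPauliOp c, realPauliOp d, realPauliOp e]

lemma word_apply (a b c d e : Fin 4) (s t : Fin 5 → Fin 2) : word a b c d e s t =
    wordEntry (s 0) (s 1) (s 2) (s 3) (s 4) (t 0) (t 1) (t 2) (t 3) (t 4) a b c d e := by
  rw [word, tensorOp, Matrix.of_apply, Fin.prod_univ_five]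
  change (realPauli a (s 0) (t 0) : ℂ) * realPauli b (s 1) (t 1) * realPauli c (s 2) (t 2) *
    realPauli d (s 3) (t 3) * realPauli e (s 4) (t 4) = _
  simp only [wordEntry, Int.cast_mul, mul_assoc]

lemma map_stabilizerSum {R S : Type*} [Ring R] [Ring S] (φ : R →+ S)
    (f : Fin 4 → Fin 4 → Fin 4 → Fin 4 → Fin 4 → R) :
    φ (stabilizerSum f) = stabilizerSum fun a b c d e => φ (f a b c d e) := by
  simp only [stabilizerSum, map_add, map_sub]

lemma codeProj_eq : codeProj = (1 / 16 : ℂ) • stabilizerSum word := by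
  ext s t
  rw [codeProj_apply, ← stabilizerSum_wordEntry, Matrix.smul_apply, smul_eq_mul]
  congr 1
  have h1 := map_stabilizerSum (Int.castAddHom ℂ)
    (wordEntry (s 0) (s 1) (s 2) (s 3) (s 4) (t 0) (t 1) (t 2) (t 3) (t 4))
  have h2 := map_stabilizerSum (Matrix.entryAddMonoidHom ℂ s t) word
  simp only [Matrix.entryAddMonoidHom_apply, word_apply, Int.coe_castAddHom] at h1 h2
  rw [h1, h2]

lemma encode_apply (s : Fin 5 → Fin 2) (b : Fin 2) :
    encode s b = (1 / 4 : ℂ) * codeInt (s 0) (s 1) (s 2) (s 3) (s 4) b b b b b := by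
  simp only [encode, Matrix.of_apply, codeProj_apply]; ring

lemma logical_codeInt : ∀ m : Fin 4, ∀ s₀ s₁ s₂ s₃ s₄ t₀ t₁ t₂ t₃ t₄ : Fin 2,
    (codeInt s₀ s₁ s₂ s₃ s₄ 0 0 0 0 0 * realPauli m 0 0 +
      codeInt s₀ s₁ s₂ s₃ s₄ 1 1 1 1 1 * realPauli m 1 0) * codeInt t₀ t₁ t₂ t₃ t₄ 0 0 0 0 0 +
    (codeInt s₀ s₁ s₂ s₃ s₄ 0 0 0 0 0 * realPauli m 0 1 +
      codeInt s₀ s₁ s₂ s₃ s₄ 1 1 1 1 1 * realPauli m 1 1) * codeInt t₀ t₁ t₂ t₃ t₄ 1 1 1 1 1 =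
    (let x : Fin 2 := if m = 0 ∨ m = 2 then 0 else 1
     codeInt s₀ s₁ s₂ s₃ s₄ (t₀ + x) (t₁ + x) (t₂ + x) (t₃ + x) (t₄ + x) *
      (realPauli m (t₀ + x) t₀ * realPauli m (t₁ + x) t₁ * realPauli m (t₂ + x) t₂ *
        realPauli m (t₃ + x) t₃ * realPauli m (t₄ + x) t₄)) := by
  decide +kernel

/-- The logical Paulis are transversal; for `ZX = iY` this is consistent because `i ^ 5 = i`.
Expectation values of the decoded qubit thereby become traces against `codeProj`. -/
lemma encode_mul_realPauliOp_mul (m : Fin 4) :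
    encode * realPauliOp m * encodeᴴ = codeProj * tensorOp fun _ => realPauliOp m := by
  -- `x` tells whether the Pauli flips the bit: column `t` of its tensor power has its only nonzero
  -- entry in row `t + x`.
  set x : Fin 2 := if m = 0 ∨ m = 2 then 0 else 1 with hx
  have hm : ∀ a b : Fin 2, a ≠ b + x → realPauli m a b = 0 := by
    rw [hx]; revert m; decide
  ext s t
  rw [Matrix.mul_apply, Matrix.mul_apply, Finset.sum_eq_single (fun j => t j + x)]
  · have h := congrArg (Int.cast : ℤ → ℂ) (logical_codeInt m (s 0) (s 1) (s 2) (s 3) (s 4)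
      (t 0) (t 1) (t 2) (t 3) (t 4))
    simp only [← hx] at h
    push_cast at h
    simp only [Fin.sum_univ_two, Matrix.mul_apply, Matrix.conjTranspose_apply, encode_apply,
      codeProj_apply, tensorOp, Matrix.of_apply, Fin.prod_univ_five, realPauliOp_apply]
    simp only [star_mul', star_intCast, star_div₀, star_one, star_ofNat]
    linear_combination (1 / 16 : ℂ) * h
  · intro u _ hu
    obtain ⟨j, hj⟩ := Function.ne_iff.mp hu
    rw [tensorOp, Matrix.of_apply, Finset.prod_eq_zero (Finset.mem_univ j), mul_zero]
    rw [realPauliOp_apply, hm _ _ hj, Int.cast_zero]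
  · simp

/-- The expectation values of `1`, `X`, `Z` and `ZX` on the left multiplied by one of these
operators in a state with equal Bloch coordinates `g`. -/
def pauliValue (g : ℂ) : Fin 4 → Fin 4 → ℂ :=
  ![![1, g, g, Complex.I * g], ![g, 1, -(Complex.I * g), -g],
    ![g, Complex.I * g, 1, g], ![Complex.I * g, g, -g, -1]]

lemma tState_apply (f : ℝ) (i j : Fin 2) : tState f i j =
    !![(1 + ((f / √3 : ℝ) : ℂ)) / 2, ((f / √3 : ℝ) : ℂ) * (1 - Complex.I) / 2;
      ((f / √3 : ℝ) : ℂ) * (1 + Complex.I) / 2, (1 - ((f / √3 : ℝ) : ℂ)) / 2] i j := by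
  rw [tState]
  generalize ((f / √3 : ℝ) : ℂ) = g
  fin_cases i <;> fin_cases j <;> simp [pauliX, pauliY, pauliZ] <;> ring

lemma trace_realPauliOp_tState (a m : Fin 4) (f : ℝ) :
    (realPauliOp a * (realPauliOp m * tState f)).trace = pauliValue (f / √3 : ℝ) a m := by
  have h : ∀ a m : Fin 4,
      (![1, pauliX, pauliZ, Complex.I • pauliY] a *
        (![1, pauliX, pauliZ, Complex.I • pauliY] m * tState f)).trace =
      pauliValue (f / √3 : ℝ) a m := by
    intro a m
    simp only [Matrix.trace, Matrix.diag, Matrix.mul_apply, Fin.sum_univ_two, tState_apply]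
    generalize ((f / √3 : ℝ) : ℂ) = g
    fin_cases a <;> fin_cases m <;> simp [pauliX, pauliY, pauliZ, pauliValue] <;> ring1
  have h' : ∀ a : Fin 4, realPauliOp a = ![1, pauliX, pauliZ, Complex.I • pauliY] a := fun a =>
    match a with
    | 0 => realPauliOp_zero
    | 1 => realPauliOp_one
    | 2 => realPauliOp_two
    | 3 => realPauliOp_three
  rw [h', h', h]

/-- The trace of a Pauli word against a product operator factors over the qubits, so the stabilizer
sum becomes a polynomial in the five parameters. -/
lemma trace_codeProj_mul (m : Fin 4) (f : Fin 5 → ℝ) :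
    (codeProj * tensorOp fun i => realPauliOp m * tState (f i)).trace =
      (1 / 16 : ℂ) * stabilizerSum fun a b c d e =>
        pauliValue (f 0 / √3 : ℝ) a m * pauliValue (f 1 / √3 : ℝ) b m *
        pauliValue (f 2 / √3 : ℝ) c m * pauliValue (f 3 / √3 : ℝ) d m *
        pauliValue (f 4 / √3 : ℝ) e m := by
  have h : ∀ a b c d e, (word a b c d e * tensorOp fun i => realPauliOp m * tState (f i)).trace =
      pauliValue (f 0 / √3 : ℝ) a m * pauliValue (f 1 / √3 : ℝ) b m *
        pauliValue (f 2 / √3 : ℝ) c m * pauliValue (f 3 / √3 : ℝ) d m *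
        pauliValue (f 4 / √3 : ℝ) e m := by
    intro a b c d e
    rw [word, tensorOp_mul, tensorOp_trace, Fin.prod_univ_five]
    simp only [← trace_realPauliOp_tState]
    rfl
  rw [codeProj_eq, Matrix.smul_mul, Matrix.trace_smul, smul_eq_mul]
  congr 1
  have h2 := map_stabilizerSum ((Matrix.traceAddMonoidHom _ ℂ).comp
    (AddMonoidHom.mulRight (tensorOp fun i => realPauliOp m * tState (f i)))) word
  simp only [AddMonoidHom.comp_apply, AddMonoidHom.mulRight_apply, Matrix.traceAddMonoidHom_apply,
    h] at h2
  exact h2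

end MagicDistill

/-! ### Acceptance probability and output of one round. -/

namespace MagicDistill

open Matrix Function

lemma ofReal_sqrt_three_sq : ((√3 : ℝ) : ℂ) ^ 2 = 3 := by
  rw [← Complex.ofReal_pow, Real.sq_sqrt (by norm_num)]; norm_num

/-- The fourth elementary symmetric polynomial in five variables. -/
def esymmFour {R : Type*} [CommRing R] (f : Fin 5 → R) : R :=
  f 1 * f 2 * f 3 * f 4 + f 0 * f 2 * f 3 * f 4 + f 0 * f 1 * f 3 * f 4 + f 0 * f 1 * f 2 * f 4 +
    f 0 * f 1 * f 2 * f 3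

/-- The third elementary symmetric polynomial in five variables. -/
def esymmThree {R : Type*} [CommRing R] (f : Fin 5 → R) : R :=
  f 0 * f 1 * f 2 + f 0 * f 1 * f 3 + f 0 * f 1 * f 4 + f 0 * f 2 * f 3 + f 0 * f 2 * f 4 +
    f 0 * f 3 * f 4 + f 1 * f 2 * f 3 + f 1 * f 2 * f 4 + f 1 * f 3 * f 4 + f 2 * f 3 * f 4

/-- The fifth elementary symmetric polynomial in five variables. -/
def esymmFive {R : Type*} [CommRing R] (f : Fin 5 → R) : R := f 0 * f 1 * f 2 * f 3 * f 4

/-- The 15 nontrivial stabilizers all have weight four, and each set of four qubits supports three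
of them. -/
lemma stabilizerSum_pauliValue_zero (g : Fin 5 → ℂ) :
    (stabilizerSum fun a b c d e => pauliValue (g 0) a 0 * pauliValue (g 1) b 0 *
      pauliValue (g 2) c 0 * pauliValue (g 3) d 0 * pauliValue (g 4) e 0) =
      1 + 3 * esymmFour g := by
  simp only [stabilizerSum, pauliValue, esymmFour, Matrix.cons_val_zero, Matrix.cons_val_one,
    Matrix.cons_val]
  ring_nf
  simp only [Complex.I_sq]
  ring

/-- Of the 16 representatives of the logical Pauli, six have weight five and contribute with sign
`+`; ten have weight three, one for each triple of qubits, and contribute with sign `-`. -/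
lemma stabilizerSum_pauliValue_one (g : Fin 5 → ℂ) :
    (stabilizerSum fun a b c d e => pauliValue (g 0) a 1 * pauliValue (g 1) b 1 *
      pauliValue (g 2) c 1 * pauliValue (g 3) d 1 * pauliValue (g 4) e 1) =
      6 * esymmFive g - esymmThree g := by
  simp only [stabilizerSum, pauliValue, esymmThree, esymmFive, Matrix.cons_val_zero,
    Matrix.cons_val_one, Matrix.cons_val]
  ring_nf
  simp only [Complex.I_sq]
  ring

lemma stabilizerSum_pauliValue_two (g : Fin 5 → ℂ) :
    (stabilizerSum fun a b c d e => pauliValue (g 0) a 2 * pauliValue (g 1) b 2 *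
      pauliValue (g 2) c 2 * pauliValue (g 3) d 2 * pauliValue (g 4) e 2) =
      6 * esymmFive g - esymmThree g := by
  simp only [stabilizerSum, pauliValue, esymmThree, esymmFive, Matrix.cons_val_zero,
    Matrix.cons_val_one, Matrix.cons_val]
  ring_nf
  simp only [Complex.I_sq]
  ring

lemma stabilizerSum_pauliValue_three (g : Fin 5 → ℂ) :
    (stabilizerSum fun a b c d e => pauliValue (g 0) a 3 * pauliValue (g 1) b 3 *
      pauliValue (g 2) c 3 * pauliValue (g 3) d 3 * pauliValue (g 4) e 3) =
      Complex.I * (6 * esymmFive g - esymmThree g) := by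
  have h5 : Complex.I ^ 5 = Complex.I := by
    rw [pow_succ, Complex.I_pow_four, one_mul]
  simp only [stabilizerSum, pauliValue, esymmThree, esymmFive, Matrix.cons_val_zero,
    Matrix.cons_val_one, Matrix.cons_val]
  ring_nf
  simp only [h5]
  ring

lemma trace_codeProj_tState (f : Fin 5 → ℝ) :
    (codeProj * tensorOp fun i => tState (f i)).trace = (((3 + esymmFour f) / 48 : ℝ) : ℂ) := by
  have h := trace_codeProj_mul 0 f
  simp only [realPauliOp_zero, Matrix.one_mul] at h
  rw [h, stabilizerSum_pauliValue_zero fun i => ((f i / √3 : ℝ) : ℂ)]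
  have h4 : ((√3 : ℝ) : ℂ) ^ 4 = 9 := by
    rw [show ((√3 : ℝ) : ℂ) ^ 4 = (((√3 : ℝ) : ℂ) ^ 2) ^ 2 by ring, ofReal_sqrt_three_sq]; norm_num
  have : esymmFour (fun i => ((f i / √3 : ℝ) : ℂ)) = (esymmFour f : ℝ) / ((√3 : ℝ) : ℂ) ^ 4 := by
    simp only [esymmFour]; push_cast; ring
  rw [this, h4]; push_cast; ring

lemma acceptProb_eq (f : Fin 5 → ℝ) : acceptProb f = (3 + esymmFour f) / 48 := by
  rw [acceptProb, trace_codeProj_tState, Complex.ofReal_re]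

/-- The unnormalized decoded state. -/
noncomputable def decoded (f : Fin 5 → ℝ) : Op1 := encodeᴴ * (tensorOp fun i => tState (f i)) * encode

lemma trace_realPauliOp_decoded (m : Fin 4) (f : Fin 5 → ℝ) :
    (realPauliOp m * decoded f).trace =
      (codeProj * tensorOp fun i => realPauliOp m * tState (f i)).trace := by
  rw [← tensorOp_mul, ← Matrix.mul_assoc, ← encode_mul_realPauliOp_mul, decoded, ← Matrix.mul_assoc,
    Matrix.trace_mul_comm]
  simp only [Matrix.mul_assoc]

/-- The product of the acceptance probability and the output fidelity parameter. -/
lemma poly_sqrt_three (f : Fin 5 → ℝ) :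
    (1 / 16 : ℂ) * (6 * esymmFive (fun i => ((f i / √3 : ℝ) : ℂ)) -
      esymmThree (fun i => ((f i / √3 : ℝ) : ℂ))) =
    ((-((esymmThree f - 2 * esymmFive f) / 48) / √3 : ℝ) : ℂ) := by
  have h5 : esymmFive (fun i => ((f i / √3 : ℝ) : ℂ)) =
      (esymmFive f : ℝ) / (((√3 : ℝ) : ℂ) ^ 2) ^ 2 / ((√3 : ℝ) : ℂ) := by
    simp only [esymmFive]; push_cast; field_simp
  have h3 : esymmThree (fun i => ((f i / √3 : ℝ) : ℂ)) =
      (esymmThree f : ℝ) / ((√3 : ℝ) : ℂ) ^ 2 / ((√3 : ℝ) : ℂ) := by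
    simp only [esymmThree]; push_cast; field_simp
  rw [h5, h3, ofReal_sqrt_three_sq]; push_cast; ring

lemma op1_eq_of_traces {A B : Op1} (h1 : A.trace = B.trace)
    (hX : (pauliX * A).trace = (pauliX * B).trace) (hY : (pauliY * A).trace = (pauliY * B).trace)
    (hZ : (pauliZ * A).trace = (pauliZ * B).trace) : A = B := by
  simp only [Matrix.trace, Matrix.diag, Matrix.mul_apply, Fin.sum_univ_two] at h1 hX hY hZ
  simp [pauliX, pauliY, pauliZ] at hX hY hZ
  have hI := Complex.I_mul_I
  ext i j
  fin_cases i <;> fin_cases j <;> simp only [Fin.zero_eta, Fin.mk_one]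
  · linear_combination (h1 + hZ) / 2
  · linear_combination (hX - Complex.I * hY) / 2 + (A 0 1 / 2 - A 1 0 / 2 + B 1 0 / 2 - B 0 1 / 2) * hI
  · linear_combination (hX + Complex.I * hY) / 2 - (A 0 1 / 2 - A 1 0 / 2 + B 1 0 / 2 - B 0 1 / 2) * hI
  · linear_combination (h1 - hZ) / 2

lemma tState_traces (f : ℝ) : (tState f).trace = 1 ∧ (pauliX * tState f).trace = (f / √3 : ℝ) ∧
    (pauliY * tState f).trace = (f / √3 : ℝ) ∧ (pauliZ * tState f).trace = (f / √3 : ℝ) := by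
  simp only [Matrix.trace, Matrix.diag, Matrix.mul_apply, Fin.sum_univ_two, tState_apply]
  generalize ((f / √3 : ℝ) : ℂ) = g
  have hI := Complex.I_mul_I
  refine ⟨?_, ?_, ?_, ?_⟩ <;> simp [pauliX, pauliY, pauliZ]
  · ring
  · ring
  · linear_combination -g * hI
  · ring

/-- The uniform bound, and not only positivity, is needed to fix the number of repetitions of a
round in advance. -/
lemma acceptProb_pos {f : Fin 5 → ℝ} (hf : f ∈ Set.Icc (0 : Fin 5 → ℝ) 1) :
    1 / 16 ≤ acceptProb f := by
  have h := hf.1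
  have h0 := h 0; have h1 := h 1; have h2 := h 2; have h3 := h 3; have h4 := h 4
  simp only [Pi.zero_apply] at h0 h1 h2 h3 h4
  have : 0 ≤ esymmFour f := by unfold esymmFour; positivity
  rw [acceptProb_eq]; linarith

/-- The normalized output parameter as a rational function of the input parameters. -/
noncomputable def outRatio (f : Fin 5 → ℝ) : ℝ := (esymmThree f - 2 * esymmFive f) / (3 + esymmFour f)

/-- A qubit operator is determined by its trace and its three Pauli expectation values, which the
logical operators turn into the stabilizer sums computed above. -/
lemma decoded_eq {f : Fin 5 → ℝ} (hf : acceptProb f ≠ 0) :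
    decoded f = (acceptProb f : ℂ) • tState (-outRatio f) := by
  have hg : ((acceptProb f * (-outRatio f / √3) : ℝ) : ℂ) =
      ((-((esymmThree f - 2 * esymmFive f) / 48) / √3 : ℝ) : ℂ) := by
    congr 1
    have : 3 + esymmFour f ≠ 0 := by
      intro h; apply hf; rw [acceptProb_eq, h]; simp
    rw [acceptProb_eq, outRatio]; field_simp
  obtain ⟨t1, tX, tY, tZ⟩ := tState_traces (-outRatio f)
  apply op1_eq_of_traces
  · have h := trace_realPauliOp_decoded 0 f
    simp only [realPauliOp_zero, Matrix.one_mul] at h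
    rw [h, trace_codeProj_tState, Matrix.trace_smul, t1, acceptProb_eq]; simp
  · have h := trace_realPauliOp_decoded 1 f
    rw [trace_codeProj_mul, stabilizerSum_pauliValue_one fun i => ((f i / √3 : ℝ) : ℂ),
      realPauliOp_one, poly_sqrt_three] at h
    rw [h, Matrix.mul_smul, Matrix.trace_smul, tX, smul_eq_mul, ← hg, Complex.ofReal_mul]
  -- Index `3` stands for `iY`; both sides carry a factor `i`, which is cancelled.
  · have h := trace_realPauliOp_decoded 3 f
    rw [trace_codeProj_mul, stabilizerSum_pauliValue_three fun i => ((f i / √3 : ℝ) : ℂ),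
      realPauliOp_three, mul_left_comm, poly_sqrt_three, Matrix.smul_mul, Matrix.trace_smul,
      smul_eq_mul] at h
    have h := mul_left_cancel₀ Complex.I_ne_zero h
    rw [h, Matrix.mul_smul, Matrix.trace_smul, tY, smul_eq_mul, ← hg, Complex.ofReal_mul]
  · have h := trace_realPauliOp_decoded 2 f
    rw [trace_codeProj_mul, stabilizerSum_pauliValue_two fun i => ((f i / √3 : ℝ) : ℂ),
      realPauliOp_two, poly_sqrt_three] at h
    rw [h, Matrix.mul_smul, Matrix.trace_smul, tZ, smul_eq_mul, ← hg, Complex.ofReal_mul]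

lemma distillOutput_eq {f : Fin 5 → ℝ} (hf : acceptProb f ≠ 0) :
    distillOutput f = tState (-outRatio f) := by
  have : distillOutput f = (acceptProb f : ℂ)⁻¹ • decoded f := rfl
  rw [this, decoded_eq hf, smul_smul, inv_mul_cancel₀ (by exact_mod_cast hf), one_smul]

lemma outFidelity_eq {f : Fin 5 → ℝ} (hf : acceptProb f ≠ 0) : outFidelity f = outRatio f := by
  rw [outFidelity, distillOutput_eq hf, (tState_traces _).2.2.2, Complex.ofReal_re]
  field_simp

end MagicDistill

/-! ### Monotonicity in the input parameters. -/

namespace MagicDistill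

/-- A function of five variables that does not change when the first variable is exchanged with
another one. -/
structure IsSymmFive (R : ℝ → ℝ → ℝ → ℝ → ℝ → ℝ) : Prop where
  swap₁ : ∀ x a b c d, R x a b c d = R a x b c d
  swap₂ : ∀ x a b c d, R x a b c d = R b a x c d
  swap₃ : ∀ x a b c d, R x a b c d = R c a b x d
  swap₄ : ∀ x a b c d, R x a b c d = R d a b c x

/-- The coordinates are raised from `f` to `g` one at a time; the symmetry moves the current
coordinate to the first place and back. -/
lemma IsSymmFive.mono {R : ℝ → ℝ → ℝ → ℝ → ℝ → ℝ} (hR : IsSymmFive R) {S : Set ℝ}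
    (h : ∀ x ∈ S, ∀ y ∈ S, ∀ a ∈ S, ∀ b ∈ S, ∀ c ∈ S, ∀ d ∈ S, x ≤ y → R x a b c d ≤ R y a b c d)
    {f g : Fin 5 → ℝ} (hf : ∀ i, f i ∈ S) (hg : ∀ i, g i ∈ S) (hfg : f ≤ g) :
    R (f 0) (f 1) (f 2) (f 3) (f 4) ≤ R (g 0) (g 1) (g 2) (g 3) (g 4) := by
  have s0 := h _ (hf 0) _ (hg 0) _ (hf 1) _ (hf 2) _ (hf 3) _ (hf 4) (hfg 0)
  have s1 := h _ (hf 1) _ (hg 1) _ (hg 0) _ (hf 2) _ (hf 3) _ (hf 4) (hfg 1)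
  have s2 := h _ (hf 2) _ (hg 2) _ (hg 1) _ (hg 0) _ (hf 3) _ (hf 4) (hfg 2)
  have s3 := h _ (hf 3) _ (hg 3) _ (hg 1) _ (hg 2) _ (hg 0) _ (hf 4) (hfg 3)
  have s4 := h _ (hf 4) _ (hg 4) _ (hg 1) _ (hg 2) _ (hg 3) _ (hg 0) (hfg 4)
  have l1 := hR.swap₁ (f 1) (g 0) (f 2) (f 3) (f 4)
  have l2 := (hR.swap₂ (f 2) (g 1) (g 0) (f 3) (f 4)).trans (hR.swap₁ _ _ _ _ _)
  have l3 := (hR.swap₃ (f 3) (g 1) (g 2) (g 0) (f 4)).trans (hR.swap₂ _ _ _ _ _)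
  have l4 := (hR.swap₄ (f 4) (g 1) (g 2) (g 3) (g 0)).trans (hR.swap₃ _ _ _ _ _)
  have l5 := hR.swap₄ (g 4) (g 1) (g 2) (g 3) (g 0)
  linarith

/-- In the product order `f < g` only means `f ≤ g` and `f ≠ g`. If the values agreed, each of the
five steps from `f` to `g` would be an equality, and injectivity in one variable would give `f = g`.
-/
lemma IsSymmFive.strictMono {R : ℝ → ℝ → ℝ → ℝ → ℝ → ℝ} (hR : IsSymmFive R) {S : Set ℝ}
    (h : ∀ x ∈ S, ∀ y ∈ S, ∀ a ∈ S, ∀ b ∈ S, ∀ c ∈ S, ∀ d ∈ S, x < y → R x a b c d < R y a b c d)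
    {f g : Fin 5 → ℝ} (hf : ∀ i, f i ∈ S) (hg : ∀ i, g i ∈ S) (hfg : f < g) :
    R (f 0) (f 1) (f 2) (f 3) (f 4) < R (g 0) (g 1) (g 2) (g 3) (g 4) := by
  have h' : ∀ x ∈ S, ∀ y ∈ S, ∀ a ∈ S, ∀ b ∈ S, ∀ c ∈ S, ∀ d ∈ S, x ≤ y →
      R x a b c d ≤ R y a b c d := by
    intro x hx y hy a ha b hb c hc d hd hxy
    rcases hxy.lt_or_eq with hlt | rfl
    · exact (h x hx y hy a ha b hb c hc d hd hlt).le
    · exact le_rfl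
  have inj : ∀ x ∈ S, ∀ y ∈ S, ∀ a ∈ S, ∀ b ∈ S, ∀ c ∈ S, ∀ d ∈ S, x ≤ y →
      R y a b c d ≤ R x a b c d → x = y := by
    intro x hx y hy a ha b hb c hc d hd hxy hle
    exact hxy.lt_or_eq.resolve_left fun hlt =>
      absurd (h x hx y hy a ha b hb c hc d hd hlt) hle.not_gt
  have hle := hfg.le
  refine (hR.mono h' hf hg hle).lt_of_ne fun he => hfg.ne ?_
  have s0 := h' _ (hf 0) _ (hg 0) _ (hf 1) _ (hf 2) _ (hf 3) _ (hf 4) (hle 0)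
  have s1 := h' _ (hf 1) _ (hg 1) _ (hg 0) _ (hf 2) _ (hf 3) _ (hf 4) (hle 1)
  have s2 := h' _ (hf 2) _ (hg 2) _ (hg 1) _ (hg 0) _ (hf 3) _ (hf 4) (hle 2)
  have s3 := h' _ (hf 3) _ (hg 3) _ (hg 1) _ (hg 2) _ (hg 0) _ (hf 4) (hle 3)
  have s4 := h' _ (hf 4) _ (hg 4) _ (hg 1) _ (hg 2) _ (hg 3) _ (hg 0) (hle 4)
  have e0 := inj _ (hf 0) _ (hg 0) _ (hf 1) _ (hf 2) _ (hf 3) _ (hf 4) (hle 0)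
  have e1 := inj _ (hf 1) _ (hg 1) _ (hg 0) _ (hf 2) _ (hf 3) _ (hf 4) (hle 1)
  have e2 := inj _ (hf 2) _ (hg 2) _ (hg 1) _ (hg 0) _ (hf 3) _ (hf 4) (hle 2)
  have e3 := inj _ (hf 3) _ (hg 3) _ (hg 1) _ (hg 2) _ (hg 0) _ (hf 4) (hle 3)
  have e4 := inj _ (hf 4) _ (hg 4) _ (hg 1) _ (hg 2) _ (hg 3) _ (hg 0) (hle 4)
  have l1 := hR.swap₁ (f 1) (g 0) (f 2) (f 3) (f 4)
  have l2 := (hR.swap₂ (f 2) (g 1) (g 0) (f 3) (f 4)).trans (hR.swap₁ _ _ _ _ _)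
  have l3 := (hR.swap₃ (f 3) (g 1) (g 2) (g 0) (f 4)).trans (hR.swap₂ _ _ _ _ _)
  have l4 := (hR.swap₄ (f 4) (g 1) (g 2) (g 3) (g 0)).trans (hR.swap₃ _ _ _ _ _)
  have l5 := hR.swap₄ (g 4) (g 1) (g 2) (g 3) (g 0)
  ext1 j
  match j with
  | 0 => exact e0 (by linarith)
  | 1 => exact e1 (by linarith)
  | 2 => exact e2 (by linarith)
  | 3 => exact e3 (by linarith)
  | 4 => exact e4 (by linarith)

/-- The output parameter as a function of five real variables. -/
noncomputable def ratioFive (x a b c d : ℝ) : ℝ :=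
  (a * b * c + a * b * d + a * c * d + b * c * d +
    x * (a * b + a * c + a * d + b * c + b * d + c * d - 2 * (a * b * c * d))) /
  (3 + a * b * c * d + x * (a * b * c + a * b * d + a * c * d + b * c * d))

lemma outRatio_eq (f : Fin 5 → ℝ) : outRatio f = ratioFive (f 0) (f 1) (f 2) (f 3) (f 4) := by
  rw [outRatio, ratioFive, esymmThree, esymmFour, esymmFive]
  congr 1 <;> ring

lemma ratioFive_isSymm : IsSymmFive ratioFive := by
  constructor <;> intros <;> simp only [ratioFive] <;> congr 1 <;> ring

/-- The acceptance probability as a function of five real variables. -/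
noncomputable def acceptFive (x a b c d : ℝ) : ℝ :=
  (3 + a * b * c * d + x * (a * b * c + a * b * d + a * c * d + b * c * d)) / 48

lemma acceptProb_eq_acceptFive (f : Fin 5 → ℝ) :
    acceptProb f = acceptFive (f 0) (f 1) (f 2) (f 3) (f 4) := by
  rw [acceptProb_eq, acceptFive, esymmFour]; congr 1; ring

lemma acceptFive_isSymm : IsSymmFive acceptFive := by
  constructor <;> intros <;> simp only [acceptFive] <;> congr 1 <;> ring

/-- The four subtracted terms are at most `1`, `1`, `1/3` and `2/3`, which add up to `3`; the bound
is attained when all variables are `1`. -/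
lemma pair_bound {a b c d : ℝ} (ha : 0 ≤ a) (hb : 0 ≤ b) (hc : 0 ≤ c) (hd : 0 ≤ d)
    (ha' : a ≤ 1) (hb' : b ≤ 1) (hc' : c ≤ 1) (hd' : d ≤ 1) :
    0 ≤ 3 - a * b * c * d - c * d - a * b * (c * d) ^ 2 / 3 - a * b * (c ^ 2 + d ^ 2) / 3 := by
  have hab : a * b ≤ 1 := mul_le_one₀ ha' hb hb'
  have hcd : c * d ≤ 1 := mul_le_one₀ hc' hd hd'
  have hab0 : 0 ≤ a * b := mul_nonneg ha hb
  have hcd0 : 0 ≤ c * d := mul_nonneg hc hd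
  have h1 : a * b * (c * d) ≤ 1 := mul_le_one₀ hab hcd0 hcd
  have h2 : a * b * (c * d) ^ 2 ≤ 1 := mul_le_one₀ hab (sq_nonneg _) (pow_le_one₀ hcd0 hcd)
  have h3 : a * b * c ^ 2 ≤ 1 := mul_le_one₀ hab (sq_nonneg _) (pow_le_one₀ hc hc')
  have h4 : a * b * d ^ 2 ≤ 1 := mul_le_one₀ hab (sq_nonneg _) (pow_le_one₀ hd hd')
  nlinarith

/-- One variable below `1` suffices: it forces `c * d < 1`. -/
lemma pair_bound_strict {a b c d : ℝ} (ha : 0 ≤ a) (hb : 0 ≤ b) (hc : 0 ≤ c) (hd : 0 ≤ d)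
    (ha' : a ≤ 1) (hb' : b ≤ 1) (hc' : c ≤ 1) (hd' : d < 1) :
    0 < 3 - a * b * c * d - c * d - a * b * (c * d) ^ 2 / 3 - a * b * (c ^ 2 + d ^ 2) / 3 := by
  have hab : a * b ≤ 1 := mul_le_one₀ ha' hb hb'
  have hcd : c * d < 1 := by nlinarith
  have hab0 : 0 ≤ a * b := mul_nonneg ha hb
  have hcd0 : 0 ≤ c * d := mul_nonneg hc hd
  have h1 : a * b * (c * d) ≤ 1 := mul_le_one₀ hab hcd0 hcd.le
  have h2 : a * b * (c * d) ^ 2 ≤ 1 := mul_le_one₀ hab (sq_nonneg _) (pow_le_one₀ hcd0 hcd.le)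
  have h3 : a * b * c ^ 2 ≤ 1 := mul_le_one₀ hab (sq_nonneg _) (pow_le_one₀ hc hc')
  have h4 : a * b * d ^ 2 ≤ 1 := mul_le_one₀ hab (sq_nonneg _) (pow_le_one₀ hd hd'.le)
  nlinarith

/-- The numerator of the derivative of `ratioFive`, up to a positive factor. -/
lemma derivative_numerator_eq (a b c d : ℝ) :
    (a * b + a * c + a * d + b * c + b * d + c * d - 2 * (a * b * c * d)) * (3 + a * b * c * d) -
      (a * b * c + a * b * d + a * c * d + b * c * d) ^ 2 =
    a * b * (3 - a * b * c * d - c * d - a * b * (c * d) ^ 2 / 3 - a * b * (c ^ 2 + d ^ 2) / 3) +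
    a * c * (3 - a * c * b * d - b * d - a * c * (b * d) ^ 2 / 3 - a * c * (b ^ 2 + d ^ 2) / 3) +
    a * d * (3 - a * d * b * c - b * c - a * d * (b * c) ^ 2 / 3 - a * d * (b ^ 2 + c ^ 2) / 3) +
    b * c * (3 - b * c * a * d - a * d - b * c * (a * d) ^ 2 / 3 - b * c * (a ^ 2 + d ^ 2) / 3) +
    b * d * (3 - b * d * a * c - a * c - b * d * (a * c) ^ 2 / 3 - b * d * (a ^ 2 + c ^ 2) / 3) +
    c * d * (3 - c * d * a * b - a * b - c * d * (a * b) ^ 2 / 3 - c * d * (a ^ 2 + b ^ 2) / 3) := by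
  ring

lemma ratioFive_mono : ∀ x ∈ Set.Icc (0 : ℝ) 1, ∀ y ∈ Set.Icc (0 : ℝ) 1, ∀ a ∈ Set.Icc (0 : ℝ) 1,
    ∀ b ∈ Set.Icc (0 : ℝ) 1, ∀ c ∈ Set.Icc (0 : ℝ) 1, ∀ d ∈ Set.Icc (0 : ℝ) 1, x ≤ y →
    ratioFive x a b c d ≤ ratioFive y a b c d := by
  rintro x ⟨hx, _⟩ y ⟨hy, _⟩ a ⟨ha, ha'⟩ b ⟨hb, hb'⟩ c ⟨hc, hc'⟩ d ⟨hd, hd'⟩ hxy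
  have key := derivative_numerator_eq a b c d
  have h1 := mul_nonneg (mul_nonneg ha hb) (pair_bound ha hb hc hd ha' hb' hc' hd')
  have h2 := mul_nonneg (mul_nonneg ha hc) (pair_bound ha hc hb hd ha' hc' hb' hd')
  have h3 := mul_nonneg (mul_nonneg ha hd) (pair_bound ha hd hb hc ha' hd' hb' hc')
  have h4 := mul_nonneg (mul_nonneg hb hc) (pair_bound hb hc ha hd hb' hc' ha' hd')
  have h5 := mul_nonneg (mul_nonneg hb hd) (pair_bound hb hd ha hc hb' hd' ha' hc')
  have h6 := mul_nonneg (mul_nonneg hc hd) (pair_bound hc hd ha hb hc' hd' ha' hb')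
  have hk : 0 ≤ (a * b + a * c + a * d + b * c + b * d + c * d - 2 * (a * b * c * d)) *
      (3 + a * b * c * d) - (a * b * c + a * b * d + a * c * d + b * c * d) ^ 2 := by
    rw [key]; linarith
  -- After cross-multiplication the two sides differ by `y - x` times the expression in `hk`.
  rw [ratioFive, ratioFive, div_le_div_iff₀ (by positivity) (by positivity)]
  have := mul_nonneg (sub_nonneg.mpr hxy) hk
  linarith

lemma ratioFive_strictMono : ∀ x ∈ Set.Ioo (0 : ℝ) 1, ∀ y ∈ Set.Ioo (0 : ℝ) 1,
    ∀ a ∈ Set.Ioo (0 : ℝ) 1, ∀ b ∈ Set.Ioo (0 : ℝ) 1, ∀ c ∈ Set.Ioo (0 : ℝ) 1,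
    ∀ d ∈ Set.Ioo (0 : ℝ) 1, x < y → ratioFive x a b c d < ratioFive y a b c d := by
  rintro x ⟨hx, _⟩ y ⟨hy, _⟩ a ⟨ha0, ha1⟩ b ⟨hb0, hb1⟩ c ⟨hc0, hc1⟩ d ⟨hd0, hd'⟩ hxy
  have ha := ha0.le; have hb := hb0.le; have hc := hc0.le; have hd := hd0.le
  have ha' := ha1.le; have hb' := hb1.le; have hc' := hc1.le
  have key := derivative_numerator_eq a b c d
  -- One strict summand is enough. Positivity of `a` and `b` matters here, since a strict bracket
  -- alone would not survive a vanishing factor.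
  have h1 := mul_pos (mul_pos ha0 hb0) (pair_bound_strict ha hb hc hd ha' hb' hc' hd')
  have h2 := mul_nonneg (mul_nonneg ha hc) (pair_bound ha hc hb hd ha' hc' hb' hd'.le)
  have h3 := mul_nonneg (mul_nonneg ha hd) (pair_bound ha hd hb hc ha' hd'.le hb' hc')
  have h4 := mul_nonneg (mul_nonneg hb hc) (pair_bound hb hc ha hd hb' hc' ha' hd'.le)
  have h5 := mul_nonneg (mul_nonneg hb hd) (pair_bound hb hd ha hc hb' hd'.le ha' hc')
  have h6 := mul_nonneg (mul_nonneg hc hd) (pair_bound hc hd ha hb hc' hd'.le ha' hb')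
  have hk : 0 < (a * b + a * c + a * d + b * c + b * d + c * d - 2 * (a * b * c * d)) *
      (3 + a * b * c * d) - (a * b * c + a * b * d + a * c * d + b * c * d) ^ 2 := by
    rw [key]; linarith
  rw [ratioFive, ratioFive, div_lt_div_iff₀ (by positivity) (by positivity)]
  have := mul_pos (sub_pos.mpr hxy) hk
  linarith

lemma coord_mem {f : Fin 5 → ℝ} (hf : f ∈ Set.Icc (0 : Fin 5 → ℝ) 1) (i : Fin 5) :
    f i ∈ Set.Icc (0 : ℝ) 1 := ⟨hf.1 i, hf.2 i⟩

lemma acceptProb_ne_zero {f : Fin 5 → ℝ} (hf : f ∈ Set.Icc (0 : Fin 5 → ℝ) 1) :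
    acceptProb f ≠ 0 := by
  have := acceptProb_pos hf
  linarith

lemma outFidelity_monotoneOn : MonotoneOn outFidelity (Set.Icc 0 1) := by
  intro f hf g hg hfg
  rw [outFidelity_eq (acceptProb_ne_zero hf), outFidelity_eq (acceptProb_ne_zero hg), outRatio_eq,
    outRatio_eq]
  exact ratioFive_isSymm.mono ratioFive_mono (coord_mem hf) (coord_mem hg) hfg

lemma acceptProb_monotoneOn : MonotoneOn acceptProb (Set.Icc 0 1) := by
  intro f hf g hg hfg
  rw [acceptProb_eq_acceptFive, acceptProb_eq_acceptFive]
  refine acceptFive_isSymm.mono (S := Set.Icc 0 1) ?_ (coord_mem hf) (coord_mem hg) hfg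
  rintro x _ y _ a ⟨ha, _⟩ b ⟨hb, _⟩ c ⟨hc, _⟩ d ⟨hd, _⟩ hxy
  unfold acceptFive
  gcongr

lemma box_mem {f : Fin 5 → ℝ} (hf : ∀ i, f i ∈ Set.Ioo (0 : ℝ) 1) :
    f ∈ Set.Icc (0 : Fin 5 → ℝ) 1 := ⟨fun i => (hf i).1.le, fun i => (hf i).2.le⟩

lemma outFidelity_strictMonoOn : StrictMonoOn outFidelity {f | ∀ i, f i ∈ Set.Ioo (0 : ℝ) 1} := by
  intro f hf g hg hfg
  rw [outFidelity_eq (acceptProb_ne_zero (box_mem hf)),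
    outFidelity_eq (acceptProb_ne_zero (box_mem hg)), outRatio_eq, outRatio_eq]
  exact ratioFive_isSymm.strictMono ratioFive_strictMono hf hg hfg

lemma acceptProb_strictMonoOn : StrictMonoOn acceptProb {f | ∀ i, f i ∈ Set.Ioo (0 : ℝ) 1} := by
  intro f hf g hg hfg
  rw [acceptProb_eq_acceptFive, acceptProb_eq_acceptFive]
  refine acceptFive_isSymm.strictMono (S := Set.Ioo 0 1) ?_ hf hg hfg
  rintro x _ y _ a ⟨ha, _⟩ b ⟨hb, _⟩ c ⟨hc, _⟩ d ⟨hd, _⟩ hxy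
  unfold acceptFive
  gcongr

end MagicDistill

namespace MagicDistill

set_option linter.unusedSectionVars false

open Matrix Function

/-! ### Clifford circuits as protocols. -/

section General

variable {Q : Type} [Fintype Q] [DecidableEq Q]

lemma onQubit_mul_tensorOp (q : Q) (A : Op1) (T : Q → Op1) :
    onQubit q A * tensorOp T = tensorOp (update T q (A * T q)) := by
  ext s t
  rw [onQubit_mul_apply]
  simp only [tensorOp, Matrix.of_apply]
  have h1 : ∀ b : Fin 2, ∏ j, T j (update s q b j) (t j) =
      T q b (t q) * ∏ j ∈ Finset.univ.erase q, T j (s j) (t j) := by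
    intro b
    rw [← Finset.mul_prod_erase _ _ (Finset.mem_univ q), update_self]
    congr 1
    exact Finset.prod_congr rfl fun j hj => by rw [update_of_ne (Finset.ne_of_mem_erase hj)]
  have h2 : ∏ j, (update T q (A * T q)) j (s j) (t j) =
      (A * T q) (s q) (t q) * ∏ j ∈ Finset.univ.erase q, T j (s j) (t j) := by
    rw [← Finset.mul_prod_erase _ _ (Finset.mem_univ q), update_self]
    congr 1
    exact Finset.prod_congr rfl fun j hj => by rw [update_of_ne (Finset.ne_of_mem_erase hj)]
  rw [h2, Matrix.mul_apply, Finset.sum_mul]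
  exact Finset.sum_congr rfl fun b _ => by rw [h1, mul_assoc]

lemma tensorOp_one : tensorOp (fun _ : Q => (1 : Op1)) = 1 := by
  ext s t
  simp only [tensorOp, Matrix.of_apply, Matrix.one_apply, Finset.prod_ite_zero,
    Finset.prod_const_one]
  exact if_congr (by simp [funext_iff]) rfl rfl

/-- The controlled-Z gate as a Clifford circuit. -/
noncomputable def czOp (c t : Q) : Op Q := onQubit t hadamardGate * cnotGate c t * onQubit t hadamardGate

lemma czOp_eq {c t : Q} (h : c ≠ t) :
    czOp c t = Matrix.diagonal fun s => (bitSign (s c * s t) : ℂ) := by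
  have hh := sqrt_two_inv_mul_self
  ext s u
  rw [czOp, Matrix.mul_assoc, onQubit_mul_apply]
  simp only [cnot_mul_apply h, Fin.sum_univ_two]
  have hf : ∀ b, flip c t (update s t b) = update s t (b + s c) := fun b => by
    simp [flip, h]
  simp only [hf]
  by_cases hsu : ∀ j, j ≠ t → s j = u j
  · have h1 : ∀ b, ∀ j, j ≠ t → update s t b j = u j := fun b j hj => by simp [hj, hsu j hj]
    have h2 : s = u ↔ s t = u t := by
      refine ⟨fun e => e ▸ rfl, fun e => funext fun j => ?_⟩
      by_cases hj : j = t
      · rw [hj, e]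
      · exact hsu j hj
    simp only [onQubit_apply_of_agree (h1 _), Matrix.diagonal_apply, h2, update_self,
      hadamardGate_apply]
    generalize ((1 / √2 : ℝ) : ℂ) = r at hh
    generalize s t = a, s c = b, u t = d
    revert a b d
    have : ∀ a b d : Fin 2, r * (if a = 1 ∧ (0 : Fin 2) = 1 then -1 else 1) *
        (r * (if 0 + b = 1 ∧ d = 1 then -1 else 1)) + r * (if a = 1 ∧ True then -1 else 1) *
        (r * (if 1 + b = 1 ∧ d = 1 then -1 else 1)) =
        r * r * (((if a = 1 ∧ (0 : Fin 2) = 1 then -1 else 1) *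
        (if 0 + b = 1 ∧ d = 1 then -1 else 1) + (if a = 1 ∧ True then -1 else 1) *
        (if 1 + b = 1 ∧ d = 1 then -1 else 1) : ℤ) : ℂ) := by
      intro a b d; push_cast; ring
    have h3 : ∀ a b d : Fin 2, ((if a = 1 ∧ (0 : Fin 2) = 1 then -1 else 1) *
        (if 0 + b = 1 ∧ d = 1 then -1 else 1) + (if a = 1 ∧ True then -1 else 1) *
        (if 1 + b = 1 ∧ d = 1 then -1 else 1) : ℤ) = 2 * if a = d then bitSign (b * a) else 0 := by
      decide
    intro a b d
    refine (this a b d).trans ?_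
    rw [hh, h3]
    split_ifs <;> simp
  · have h1 : ∀ b, ¬ ∀ j, j ≠ t → update s t b j = u j := fun b h' => hsu fun j hj => by
      simpa [hj] using h' j hj
    have h2 : s ≠ u := fun e => hsu fun j _ => by rw [e]
    simp [onQubit_apply_of_not_agree (h1 _), h2]

/-- A CNOT in a protocol, omitted if control and target coincide. -/
def cnotStep (c t : Q) (P : Protocol Q) : Protocol Q :=
  if h : c ≠ t then .cnot c t h P else P

lemma cnotStep_of_ne {c t : Q} (h : c ≠ t) (P : Protocol Q) :
    cnotStep c t P = .cnot c t h P := dif_pos h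

lemma numOps_cnotStep (c t : Q) (P : Protocol Q) : (cnotStep c t P).numOps ≤ P.numOps + 1 := by
  unfold cnotStep; split_ifs
  · rfl
  · omega

/-- A controlled-Z gate in a protocol. -/
def czStep (c t : Q) (P : Protocol Q) : Protocol Q :=
  .hadamard t (cnotStep c t (.hadamard t P))

lemma numOps_czStep (c t : Q) (P : Protocol Q) : (czStep c t P).numOps ≤ P.numOps + 3 := by
  have := numOps_cnotStep c t (.hadamard t P)
  simp only [czStep, Protocol.numOps] at *; omega

lemma run_czStep {c t : Q} (h : c ≠ t) (ρ : ℕ → Op1) (P : Protocol Q) (k : ℕ) (σ : Op Q) :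
    (czStep c t P).run ρ k σ = P.run ρ k (czOp c t * σ * (czOp c t)ᴴ) := by
  rw [czStep, cnotStep_of_ne h]
  simp only [Protocol.run, czOp, conjTranspose_mul, Matrix.mul_assoc]

variable {B : Type} [Fintype B] [DecidableEq B]

lemma put_conj_hadamard {e : B → Q} (he : Injective e) (i : B) (τ : Op B) (σ : Op Q) :
    onQubit (e i) hadamardGate * put e τ σ * (onQubit (e i) hadamardGate)ᴴ =
      put e (onQubit i hadamardGate * τ * (onQubit i hadamardGate)ᴴ) σ := by
  simp only [onQubit_conjTranspose, put_onQubit he]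

lemma put_conj_phase {e : B → Q} (he : Injective e) (i : B) (τ : Op B) (σ : Op Q) :
    onQubit (e i) phaseGate * put e τ σ * (onQubit (e i) phaseGate)ᴴ =
      put e (onQubit i phaseGate * τ * (onQubit i phaseGate)ᴴ) σ := by
  simp only [onQubit_conjTranspose, put_onQubit he]

lemma put_czOp {e : B → Q} (he : Injective e) {c t : B} (hct : c ≠ t) (τ : Op B) (σ : Op Q) :
    czOp (e c) (e t) * put e τ σ * (czOp (e c) (e t))ᴴ =
      put e (czOp c t * τ * (czOp c t)ᴴ) σ := by
  have h1 := put_conj_hadamard he t τ σ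
  have h2 := put_cnot he hct (onQubit t hadamardGate * τ * (onQubit t hadamardGate)ᴴ) σ
  have h3 := put_conj_hadamard he t (cnotGate c t * (onQubit t hadamardGate * τ *
    (onQubit t hadamardGate)ᴴ) * (cnotGate c t)ᴴ) σ
  rw [← h2, ← h1] at h3
  simpa only [czOp, conjTranspose_mul, Matrix.mul_assoc] using h3

lemma trace_measure (q : B) (τ : Op B) :
    (onQubit q (basisProj 0) * τ * onQubit q (basisProj 0)).trace +
      (onQubit q (basisProj 1) * τ * onQubit q (basisProj 1)).trace = τ.trace := by
  have : ∀ b, (onQubit q (basisProj b) * τ * onQubit q (basisProj b)).trace =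
      (onQubit q (basisProj b) * τ).trace := fun b => by
    rw [Matrix.trace_mul_comm, ← Matrix.mul_assoc, onQubit_mul, basisProj_mul_self]
  rw [this, this, ← Matrix.trace_add, ← Matrix.add_mul, ← onQubit_add, basisProj_add, onQubit_one,
    Matrix.one_mul]

/-- Reset a list of qubits. -/
def resetList (l : List Q) (P : Protocol Q) : Protocol Q := l.foldr Protocol.prepZero P

lemma numOps_resetList (l : List Q) (P : Protocol Q) :
    (resetList l P).numOps = P.numOps + l.length := by
  induction l with
  | nil => rfl
  | cons q l h =>
    change (resetList l P).numOps + 1 = _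
    rw [h, List.length_cons]; omega

/-- This makes failure harmless: whatever the block contained, resetting returns exactly `σ`,
weighted by the probability of the branch. -/
lemma run_resetList_put {e : B → Q} (he : Injective e) {l : List B} (hl : ∀ i, i ∈ l)
    (ρ : ℕ → Op1) (P : Protocol Q) (k : ℕ) (τ : Op B) {σ : Op Q} (hσ : Clean (Set.range e) σ) :
    (resetList (l.map e) P).run ρ k (put e τ σ) = τ.trace • P.run ρ k σ := by
  -- The induction enlarges the set `S` of qubits that are already reset.
  have key : ∀ (l : List B) (S : Set B) (τ : Op B), Clean S τ → (∀ i, i ∈ l ∨ i ∈ S) →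
      (resetList (l.map e) P).run ρ k (put e τ σ) = τ.trace • P.run ρ k σ := by
    intro l
    induction l with
    | nil =>
      intro S τ hτ hS
      have h1 := eq_zeroState_of_clean (hτ.mono fun i _ => by simpa using hS i)
      conv_lhs => rw [h1]
      rw [put_smul, put_zeroState hσ, run_smul]
      rfl
    | cons q l ih =>
      intro S τ hτ hS
      change (resetList (l.map e) P).run ρ k (replaceQubit (e q) (basisProj 0) (put e τ σ)) = _
      rw [put_replaceQubit he, ih (insert q S) _ (clean_replaceQubit_zero hτ q),
        replaceQubit_trace, basisProj_trace, one_mul]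
      intro i
      rcases hS i with h | h
      · rcases List.mem_cons.mp h with rfl | h
        · exact Or.inr (Set.mem_insert _ _)
        · exact Or.inl h
      · exact Or.inr (Set.mem_insert_of_mem _ h)
  exact key l ∅ τ (by rintro s t ⟨w, hw, _⟩; exact hw.elim) fun i => Or.inl (hl i)

end General

end MagicDistill

namespace MagicDistill

set_option linter.unusedSectionVars false

open Matrix Function

/-! ### The decoding circuit -/

/-- The controlled-Z gates along the five-cycle. -/
noncomputable def ringOp : Op (Fin 5) := czOp 4 0 * (czOp 3 4 * (czOp 2 3 * (czOp 1 2 * czOp 0 1)))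

/-- Hadamard gates on five qubits. -/
noncomputable def hadamardAll : Op (Fin 5) :=
  onQubit 4 hadamardGate * (onQubit 3 hadamardGate * (onQubit 2 hadamardGate *
    (onQubit 1 hadamardGate * onQubit 0 hadamardGate)))

/-- CNOT gates from the first of five qubits to the other ones. -/
def fanOut : Op (Fin 5) := cnotGate 0 4 * (cnotGate 0 3 * (cnotGate 0 2 * cnotGate 0 1))

/-- The decoding circuit of the five-qubit code. -/
noncomputable def decoder : Op (Fin 5) := fanOut * (hadamardAll * ringOp)

/-- The projector on `|0⟩` of the last four qubits. -/
def syndromeProj : Op (Fin 5) :=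
  onQubit 4 (basisProj 0) * (onQubit 3 (basisProj 0) * (onQubit 2 (basisProj 0) *
    onQubit 1 (basisProj 0)))

/-- The isometry that adds four qubits in the state `|0⟩`. -/
def embedFirst : Matrix (Fin 5 → Fin 2) (Fin 2) ℂ :=
  Matrix.of fun s b => if s = ![b, 0, 0, 0, 0] then 1 else 0

lemma ringOp_eq : ringOp =
    Matrix.diagonal fun s => (ringSign (s 0) (s 1) (s 2) (s 3) (s 4) : ℂ) := by
  have h : ∀ a b c d e : Fin 2, bitSign (e * a) * (bitSign (d * e) * (bitSign (c * d) *
      (bitSign (b * c) * bitSign (a * b)))) = ringSign a b c d e := by decide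
  rw [ringOp, czOp_eq (by decide), czOp_eq (by decide), czOp_eq (by decide), czOp_eq (by decide),
    czOp_eq (by decide)]
  simp only [Matrix.diagonal_mul_diagonal, ← h]
  push_cast; rfl

lemma hadamardAll_eq : hadamardAll = tensorOp fun _ => hadamardGate := by
  rw [hadamardAll, ← Matrix.mul_one (onQubit 0 hadamardGate), ← tensorOp_one]
  simp only [onQubit_mul_tensorOp]
  congr 1
  ext1 j
  match j with
  | 0 | 1 | 2 | 3 | 4 => simp [update]

lemma fanOut_mul_apply {ι : Type*} (M : Matrix (Fin 5 → Fin 2) ι ℂ) (b : Fin 2) (u : ι) :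
    (fanOut * M) ![b, 0, 0, 0, 0] u = M (fun _ => b) u := by
  simp only [fanOut, Matrix.mul_assoc]
  rw [cnot_mul_apply (by decide), cnot_mul_apply (by decide), cnot_mul_apply (by decide),
    cnot_mul_apply (by decide)]
  congr 1
  revert b
  decide

lemma syndromeProj_mul_apply {ι : Type*} (M : Matrix (Fin 5 → Fin 2) ι ℂ) (s : Fin 5 → Fin 2)
    (u : ι) : (syndromeProj * M) s u = if s = ![s 0, 0, 0, 0, 0] then M s u else 0 := by
  have h : ∀ (q : Fin 5) (M : Matrix (Fin 5 → Fin 2) ι ℂ) (s : Fin 5 → Fin 2),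
      (onQubit q (basisProj 0) * M) s u = if s q = 0 then M s u else 0 := by
    intro q M s
    rw [onQubit_mul_apply]
    simp only [basisProj_apply, Fin.sum_univ_two]
    by_cases hs : s q = 0
    · have : update s q 0 = s := by rw [← hs, update_eq_self]
      simp [hs, this]
    · simp [hs]
  simp only [syndromeProj, Matrix.mul_assoc, h, ← ite_and]
  refine if_congr ?_ rfl rfl
  constructor
  · rintro ⟨h4, h3, h2, h1⟩
    ext1 j
    match j with
    | 0 => rfl
    | 1 => exact h1
    | 2 => exact h2
    | 3 => exact h3
    | 4 => exact h4
  · intro h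
    exact ⟨congrFun h 4, congrFun h 3, congrFun h 2, congrFun h 1⟩

lemma hadamard_codeInt : ∀ b t₀ t₁ t₂ t₃ t₄ : Fin 2,
    bitSign (b * t₀) * bitSign (b * t₁) * bitSign (b * t₂) * bitSign (b * t₃) * bitSign (b * t₄) *
      ringSign t₀ t₁ t₂ t₃ t₄ =
    bitSign (b * 0) * codeInt t₀ t₁ t₂ t₃ t₄ 0 0 0 0 0 -
      bitSign (b * 1) * codeInt t₀ t₁ t₂ t₃ t₄ 1 1 1 1 1 := by
  decide +kernel

lemma hadamardGate_eq (i j : Fin 2) :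
    hadamardGate i j = ((1 / √2 : ℝ) : ℂ) * (bitSign (i * j) : ℂ) := by
  rw [hadamardGate_apply]
  congr 1
  fin_cases i <;> fin_cases j <;> simp [bitSign]

/-- Encoded basis states are signed superpositions of the strings of even or odd parity. The
controlled-Z ring removes the signs `ringSign`, the Hadamard gates produce `|00000⟩ ± |11111⟩`, and
the fan-out leaves `|±⟩` on the first qubit: this is the `hadamardGate`. The `pauliZ` compensates
for the value `-1` of `ringSign` at `11111`, by which the encoded `|1⟩` is minus the odd vector. -/
lemma syndromeProj_mul_decoder :
    syndromeProj * decoder = embedFirst * (hadamardGate * pauliZ * encodeᴴ) := by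
  ext s t
  rw [syndromeProj_mul_apply]
  by_cases hs : s = ![s 0, 0, 0, 0, 0]
  · rw [if_pos hs]
    have hJ : (embedFirst * (hadamardGate * pauliZ * encodeᴴ)) s t =
        (hadamardGate * pauliZ * encodeᴴ) (s 0) t := by
      have : ∀ b, embedFirst s b = if b = s 0 then 1 else 0 := fun b => by
        simp only [embedFirst, Matrix.of_apply]
        refine if_congr ⟨fun h => (congrFun h 0).symm, fun h => ?_⟩ rfl rfl
        rw [h]; exact hs
      rw [Matrix.mul_apply]; simp [this]
    rw [hJ, hs, decoder, fanOut_mul_apply, ringOp_eq, Matrix.mul_diagonal, hadamardAll_eq]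
    have h := congrArg (Int.cast : ℤ → ℂ) (hadamard_codeInt (s 0) (t 0) (t 1) (t 2) (t 3) (t 4))
    push_cast at h
    have hr := sqrt_two_inv_mul_self
    have hZ : pauliZ 0 0 = 1 ∧ pauliZ 0 1 = 0 ∧ pauliZ 1 0 = 0 ∧ pauliZ 1 1 = -1 := by
      simp [pauliZ]
    obtain ⟨z1, z2, z3, z4⟩ := hZ
    simp only [tensorOp, Matrix.of_apply, Fin.prod_univ_five, Matrix.mul_apply, Fin.sum_univ_two,
      Matrix.conjTranspose_apply, encode_apply, hadamardGate_eq, z1, z2, z3, z4]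
    simp only [star_mul', star_intCast, star_div₀, star_one, star_ofNat, Matrix.cons_val_zero]
    generalize ((1 / √2 : ℝ) : ℂ) = r at *
    linear_combination (r * (r * r) * (r * r)) * h + r * (r * r + 1 / 2) *
      ((bitSign (s 0 * 0) : ℂ) * codeInt (t 0) (t 1) (t 2) (t 3) (t 4) 0 0 0 0 0 -
        bitSign (s 0 * 1) * codeInt (t 0) (t 1) (t 2) (t 3) (t 4) 1 1 1 1 1) * hr
  · rw [if_neg hs]
    have : ∀ b, embedFirst s b = 0 := fun b => by
      simp only [embedFirst, Matrix.of_apply, ite_eq_right_iff]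
      intro h
      exact absurd (by rw [h]; rfl) hs
    rw [Matrix.mul_apply]; simp [this]

lemma onQubit_mul_embedFirst (A : Op1) :
    onQubit (0 : Fin 5) A * embedFirst = embedFirst * A := by
  ext s b
  have h0 : ∀ c d : Fin 2, (update s 0 c = ![d, 0, 0, 0, 0]) ↔ s = ![s 0, 0, 0, 0, 0] ∧ c = d := by
    intro c d
    constructor
    · intro h
      refine ⟨?_, by simpa using congrFun h 0⟩
      ext1 j
      match j with
      | 0 => rfl
      | 1 => simpa using congrFun h 1
      | 2 => simpa using congrFun h 2
      | 3 => simpa using congrFun h 3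
      | 4 => simpa using congrFun h 4
    · rintro ⟨h, rfl⟩
      rw [h]
      ext1 j
      match j with
      | 0 | 1 | 2 | 3 | 4 => simp [update]
  have h1 : ∀ d : Fin 2, (s = ![d, 0, 0, 0, 0]) ↔ s = ![s 0, 0, 0, 0, 0] ∧ s 0 = d := by
    intro d
    have := h0 (s 0) d
    rwa [update_eq_self] at this
  rw [onQubit_mul_apply, Matrix.mul_apply]
  classical
  obtain ⟨p, hp⟩ : ∃ p : Prop, p = (s = ![s 0, 0, 0, 0, 0]) := ⟨_, rfl⟩
  simp only [← hp] at h0 h1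
  simp only [embedFirst, Matrix.of_apply, h0, h1]
  by_cases hs : p <;> simp [hs]

lemma embedFirst_conj (A : Op1) :
    embedFirst * A * embedFirstᴴ = replaceQubit 0 A (zeroState (Fin 5)) := by
  have h : ∀ (s : Fin 5 → Fin 2) b, s = ![b, 0, 0, 0, 0] ↔ s = ![s 0, 0, 0, 0, 0] ∧ b = s 0 := by
    intro s b
    refine ⟨fun h => ⟨by rw [h]; rfl, by rw [h]; rfl⟩, fun h => ?_⟩
    rw [h.2]; exact h.1
  have hu : ∀ (s : Fin 5 → Fin 2) (b : Fin 2),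
      0 = update s 0 b ↔ s = ![s 0, 0, 0, 0, 0] ∧ b = 0 := by
    intro s b
    constructor
    · intro h
      refine ⟨?_, by simpa using (congrFun h 0).symm⟩
      ext1 j
      match j with
      | 0 => rfl
      | 1 => simpa using (congrFun h 1).symm
      | 2 => simpa using (congrFun h 2).symm
      | 3 => simpa using (congrFun h 3).symm
      | 4 => simpa using (congrFun h 4).symm
    · rintro ⟨h, rfl⟩
      rw [h]
      ext1 j
      match j with
      | 0 | 1 | 2 | 3 | 4 => simp [update]
  ext s t
  have hs := h s
  have ht := h t
  have hus := hu s
  have hut := hu t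
  classical
  obtain ⟨p, hp⟩ : ∃ p : Prop, p = (s = ![s 0, 0, 0, 0, 0]) := ⟨_, rfl⟩
  obtain ⟨q, hq⟩ : ∃ q : Prop, q = (t = ![t 0, 0, 0, 0, 0]) := ⟨_, rfl⟩
  simp only [← hp] at hs hus
  simp only [← hq] at ht hut
  rw [Matrix.mul_apply]
  simp only [Matrix.mul_apply, Matrix.conjTranspose_apply, embedFirst, hs, ht, replaceQubit,
    Matrix.of_apply, zeroState, Matrix.single, hus, hut]
  by_cases h1 : p <;> by_cases h2 : q <;> simp [h1, h2]

end MagicDistill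

/-! ### The decoder as a protocol. -/

namespace MagicDistill

set_option linter.unusedSectionVars false

open Matrix Function

variable {Q : Type} [Fintype Q] [DecidableEq Q]

/-- The decoding circuit as a protocol. -/
def decodeGates (e : Fin 5 → Q) (P : Protocol Q) : Protocol Q :=
  czStep (e 0) (e 1) <| czStep (e 1) (e 2) <| czStep (e 2) (e 3) <| czStep (e 3) (e 4) <|
  czStep (e 4) (e 0) <| .hadamard (e 0) <| .hadamard (e 1) <| .hadamard (e 2) <|
  .hadamard (e 3) <| .hadamard (e 4) <| cnotStep (e 0) (e 1) <| cnotStep (e 0) (e 2) <|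
  cnotStep (e 0) (e 3) <| cnotStep (e 0) (e 4) P

/-- Measure the syndrome. If it is trivial, continue with `S`, else reset and continue with `R`. -/
def checkSyndrome (e : Fin 5 → Q) (S R : Protocol Q) : Protocol Q :=
  let F := resetList ([0, 1, 2, 3, 4].map e) R
  .measure (e 1) (.measure (e 2) (.measure (e 3) (.measure (e 4)
    -- Two phase gates make the `Z` that, by `conj_tState`, turns the decoded qubit back to the
    -- direction of the inputs.
    (.phase (e 0) (.phase (e 0) S)) F) F) F) F

/-- Decode the five-qubit code. -/
def decode (e : Fin 5 → Q) (S R : Protocol Q) : Protocol Q :=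
  decodeGates e (checkSyndrome e S R)

lemma numOps_decode (e : Fin 5 → Q) (S R : Protocol Q) :
    (decode e S R).numOps ≤ 40 + max S.numOps R.numOps := by
  have hc : (checkSyndrome e S R).numOps ≤ 10 + max S.numOps R.numOps := by
    have := numOps_resetList ([0, 1, 2, 3, 4].map e) R
    simp only [List.length_map, List.length_cons, List.length_nil] at this
    simp only [checkSyndrome, Protocol.numOps, this]
    omega
  set P := checkSyndrome e S R
  have h1 := numOps_cnotStep (e 0) (e 4) P
  have h2 := numOps_cnotStep (e 0) (e 3) (cnotStep (e 0) (e 4) P)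
  have h3 := numOps_cnotStep (e 0) (e 2) (cnotStep (e 0) (e 3) (cnotStep (e 0) (e 4) P))
  have h4 := numOps_cnotStep (e 0) (e 1)
    (cnotStep (e 0) (e 2) (cnotStep (e 0) (e 3) (cnotStep (e 0) (e 4) P)))
  have hz : ∀ c t : Q, ∀ n (P : Protocol Q), P.numOps ≤ n → (czStep c t P).numOps ≤ n + 3 :=
    fun c t n P h => (numOps_czStep c t P).trans (by omega)
  have h5 : (decodeGates e P).numOps ≤ P.numOps + 9 + 3 + 3 + 3 + 3 + 3 := by
    refine hz _ _ _ _ (hz _ _ _ _ (hz _ _ _ _ (hz _ _ _ _ (hz _ _ _ _ ?_))))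
    simp only [Protocol.numOps]
    omega
  exact h5.trans (by omega)

section

variable {B : Type} [Fintype B] [DecidableEq B]

lemma run_hadamard_put {e : B → Q} (he : Injective e) (i : B) (ρ : ℕ → Op1) (P : Protocol Q)
    (k : ℕ) (τ : Op B) (σ : Op Q) :
    (Protocol.hadamard (e i) P).run ρ k (put e τ σ) =
      P.run ρ k (put e (onQubit i hadamardGate * τ * (onQubit i hadamardGate)ᴴ) σ) := by
  rw [← put_conj_hadamard he]; rfl

lemma run_phase_put {e : B → Q} (he : Injective e) (i : B) (ρ : ℕ → Op1) (P : Protocol Q)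
    (k : ℕ) (τ : Op B) (σ : Op Q) :
    (Protocol.phase (e i) P).run ρ k (put e τ σ) =
      P.run ρ k (put e (onQubit i phaseGate * τ * (onQubit i phaseGate)ᴴ) σ) := by
  rw [← put_conj_phase he]; rfl

lemma run_cnotStep_put {e : B → Q} (he : Injective e) {c t : B} (h : c ≠ t) (ρ : ℕ → Op1)
    (P : Protocol Q) (k : ℕ) (τ : Op B) (σ : Op Q) :
    (cnotStep (e c) (e t) P).run ρ k (put e τ σ) =
      P.run ρ k (put e (cnotGate c t * τ * (cnotGate c t)ᴴ) σ) := by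
  rw [← put_cnot he h, cnotStep_of_ne (he.ne h)]; rfl

lemma run_czStep_put {e : B → Q} (he : Injective e) {c t : B} (h : c ≠ t) (ρ : ℕ → Op1)
    (P : Protocol Q) (k : ℕ) (τ : Op B) (σ : Op Q) :
    (czStep (e c) (e t) P).run ρ k (put e τ σ) =
      P.run ρ k (put e (czOp c t * τ * (czOp c t)ᴴ) σ) := by
  rw [← put_czOp he h, run_czStep (he.ne h)]

lemma run_measure_put {e : B → Q} (he : Injective e) (i : B) (ρ : ℕ → Op1) (P₀ P₁ : Protocol Q)
    (k : ℕ) (τ : Op B) (σ : Op Q) :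
    (Protocol.measure (e i) P₀ P₁).run ρ k (put e τ σ) =
      P₀.run ρ k (put e (onQubit i (basisProj 0) * τ * onQubit i (basisProj 0)) σ) +
        P₁.run ρ k (put e (onQubit i (basisProj 1) * τ * onQubit i (basisProj 1)) σ) := by
  rw [← put_onQubit he, ← put_onQubit he]; rfl

end

lemma decoder_conj (τ : Op (Fin 5)) : decoder * τ * decoderᴴ =
    fanOut * (hadamardAll * (ringOp * τ * ringOpᴴ) * hadamardAllᴴ) * fanOutᴴ := by
  simp only [decoder, conjTranspose_mul, Matrix.mul_assoc]

lemma run_decodeGates {e : Fin 5 → Q} (he : Injective e) (ρ : ℕ → Op1) (P : Protocol Q) (k : ℕ)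
    (τ : Op (Fin 5)) (σ : Op Q) :
    (decodeGates e P).run ρ k (put e τ σ) =
      P.run ρ k (put e (decoder * τ * decoderᴴ) σ) := by
  have n1 : (0 : Fin 5) ≠ 1 := by decide
  have n2 : (0 : Fin 5) ≠ 2 := by decide
  have n3 : (0 : Fin 5) ≠ 3 := by decide
  have n4 : (0 : Fin 5) ≠ 4 := by decide
  have n5 : (1 : Fin 5) ≠ 2 := by decide
  have n6 : (2 : Fin 5) ≠ 3 := by decide
  have n7 : (3 : Fin 5) ≠ 4 := by decide
  have h1 : ∀ τ : Op (Fin 5), ringOp * τ * ringOpᴴ = czOp 4 0 * (czOp 3 4 * (czOp 2 3 *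
      (czOp 1 2 * (czOp 0 1 * τ * (czOp 0 1)ᴴ) * (czOp 1 2)ᴴ) * (czOp 2 3)ᴴ) * (czOp 3 4)ᴴ) *
      (czOp 4 0)ᴴ := fun τ => by
    simp only [ringOp, conjTranspose_mul, Matrix.mul_assoc]
  have h2 : ∀ τ : Op (Fin 5), hadamardAll * τ * hadamardAllᴴ = onQubit 4 hadamardGate *
      (onQubit 3 hadamardGate * (onQubit 2 hadamardGate * (onQubit 1 hadamardGate *
      (onQubit 0 hadamardGate * τ * (onQubit 0 hadamardGate)ᴴ) * (onQubit 1 hadamardGate)ᴴ) *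
      (onQubit 2 hadamardGate)ᴴ) * (onQubit 3 hadamardGate)ᴴ) * (onQubit 4 hadamardGate)ᴴ :=
    fun τ => by simp only [hadamardAll, conjTranspose_mul, Matrix.mul_assoc]
  have h3 : ∀ τ : Op (Fin 5), fanOut * τ * fanOutᴴ = cnotGate 0 4 * (cnotGate 0 3 * (cnotGate 0 2 *
      (cnotGate 0 1 * τ * (cnotGate 0 1)ᴴ) * (cnotGate 0 2)ᴴ) * (cnotGate 0 3)ᴴ) *
      (cnotGate 0 4)ᴴ := fun τ => by
    simp only [fanOut, conjTranspose_mul, Matrix.mul_assoc]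
  rw [decodeGates, run_czStep_put he n1, run_czStep_put he n5, run_czStep_put he n6,
    run_czStep_put he n7, run_czStep_put he n4.symm, ← h1, run_hadamard_put he,
    run_hadamard_put he, run_hadamard_put he, run_hadamard_put he, run_hadamard_put he, ← h2,
    run_cnotStep_put he n1, run_cnotStep_put he n2, run_cnotStep_put he n3,
    run_cnotStep_put he n4, ← h3, ← decoder_conj]

lemma phaseGate_mul_self : phaseGate * phaseGate = pauliZ := by
  ext i j
  fin_cases i <;> fin_cases j <;> simp [phaseGate, pauliZ, Matrix.mul_apply]

lemma pauliZ_conjTranspose : pauliZᴴ = pauliZ := by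
  ext i j
  fin_cases i <;> fin_cases j <;> simp [pauliZ]

lemma pauliZ_mul_self : pauliZ * pauliZ = 1 := by
  ext i j
  fin_cases i <;> fin_cases j <;> simp [pauliZ]

lemma syndromeProj_conj (τ : Op (Fin 5)) : syndromeProj * τ * syndromeProjᴴ =
    onQubit 4 (basisProj 0) * (onQubit 3 (basisProj 0) *
      (onQubit 2 (basisProj 0) * (onQubit 1 (basisProj 0) * τ * onQubit 1 (basisProj 0)) *
        onQubit 2 (basisProj 0)) * onQubit 3 (basisProj 0)) * onQubit 4 (basisProj 0) := by
  simp only [syndromeProj, conjTranspose_mul, onQubit_conjTranspose, basisProj_conjTranspose,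
    Matrix.mul_assoc]

lemma phase_phase_conj {B : Type} [Fintype B] [DecidableEq B] (q : B) (τ : Op B) :
    onQubit q phaseGate * (onQubit q phaseGate * τ * (onQubit q phaseGate)ᴴ) *
      (onQubit q phaseGate)ᴴ = onQubit q pauliZ * τ * onQubit q pauliZ := by
  have h : onQubit q phaseGate * (onQubit q phaseGate * τ * (onQubit q phaseGate)ᴴ) *
      (onQubit q phaseGate)ᴴ = (onQubit q phaseGate * onQubit q phaseGate) * τ *
        (onQubit q phaseGate * onQubit q phaseGate)ᴴ := by
    simp only [conjTranspose_mul, Matrix.mul_assoc]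
  rw [h, onQubit_mul, phaseGate_mul_self, onQubit_conjTranspose, pauliZ_conjTranspose]

/-- Each of the four failing branches ends in the same state `σ`, up to its weight; the weights
telescope to the total trace minus the accepted one. -/
lemma run_checkSyndrome {e : Fin 5 → Q} (he : Injective e) (ρ : ℕ → Op1) (S R : Protocol Q) (k : ℕ)
    (τ : Op (Fin 5)) {σ : Op Q} (hσ : Clean (Set.range e) σ) :
    (checkSyndrome e S R).run ρ k (put e τ σ) =
      S.run ρ k (put e (onQubit 0 pauliZ * (syndromeProj * τ * syndromeProjᴴ) * onQubit 0 pauliZ) σ) +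
        (τ.trace - (syndromeProj * τ * syndromeProjᴴ).trace) • R.run ρ k σ := by
  have hF := fun τ => run_resetList_put he (l := [0, 1, 2, 3, 4]) (by decide) ρ R k τ hσ
  rw [syndromeProj_conj, checkSyndrome]
  have t1 := trace_measure 1 τ
  generalize h₁ : onQubit 1 (basisProj 0) * τ * onQubit 1 (basisProj 0) = τ₁ at *
  have t2 := trace_measure 2 τ₁
  generalize h₂ : onQubit 2 (basisProj 0) * τ₁ * onQubit 2 (basisProj 0) = τ₂ at *
  have t3 := trace_measure 3 τ₂
  generalize h₃ : onQubit 3 (basisProj 0) * τ₂ * onQubit 3 (basisProj 0) = τ₃ at *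
  have t4 := trace_measure 4 τ₃
  generalize h₄ : onQubit 4 (basisProj 0) * τ₃ * onQubit 4 (basisProj 0) = τ₄ at *
  rw [run_measure_put he, hF, h₁, run_measure_put he, hF, h₂, run_measure_put he, hF, h₃,
    run_measure_put he, hF, h₄, run_phase_put he, run_phase_put he, phase_phase_conj]
  rw [add_assoc, add_assoc, add_assoc, ← add_smul, ← add_smul, ← add_smul]
  congr 2
  linear_combination t1 + t2 + t3 + t4

/-- On Bloch vectors `Z` is `(x, y, z) ↦ (-x, -y, z)` and `H` is `(x, y, z) ↦ (z, -y, x)`, so `Z H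
Z` sends `-(1, 1, 1)` to `(1, 1, 1)`. This undoes both the basis change left by the decoder and the
sign reversal of the code, so that rounds can be concatenated. -/
lemma conj_tState (f : ℝ) :
    pauliZ * (hadamardGate * pauliZ * tState (-f) * (hadamardGate * pauliZ)ᴴ) * pauliZ =
      tState f := by
  have hr := sqrt_two_inv_mul_self
  have hH : hadamardGate = ((1 / √2 : ℝ) : ℂ) • !![1, 1; 1, -1] := rfl
  have hs : star (((1 / √2 : ℝ) : ℂ)) = ((1 / √2 : ℝ) : ℂ) := Complex.conj_ofReal _
  have hg : (((-f) / √3 : ℝ) : ℂ) = -((f / √3 : ℝ) : ℂ) := by push_cast; ring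
  have key : pauliZ * (!![1, 1; 1, -1] * pauliZ * tState (-f) *
      (!![1, 1; 1, -1] * pauliZ)ᴴ) * pauliZ = (2 : ℂ) • tState f := by
    ext i j
    rw [Matrix.smul_apply]
    simp only [Matrix.mul_apply, Fin.sum_univ_two, tState_apply, hg, Matrix.conjTranspose_apply]
    generalize ((f / √3 : ℝ) : ℂ) = g
    fin_cases i <;> fin_cases j <;> simp [pauliZ] <;> ring
  have : hadamardGate * pauliZ = ((1 / √2 : ℝ) : ℂ) • (!![1, 1; 1, -1] * pauliZ : Op1) := by
    rw [hH, Matrix.smul_mul]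
  rw [this, conjTranspose_smul, hs]
  simp only [Matrix.smul_mul, Matrix.mul_smul, smul_smul, hr]
  rw [key, smul_smul]; norm_num

lemma run_decode {e : Fin 5 → Q} (he : Injective e) (ρ : ℕ → Op1) (S R : Protocol Q) (k : ℕ)
    {σ : Op Q} (hσ : Clean (Set.range e) σ) {f : Fin 5 → ℝ} (hf : f ∈ Set.Icc (0 : Fin 5 → ℝ) 1) :
    (decode e S R).run ρ k (put e (tensorOp fun i => tState (f i)) σ) =
      (acceptProb f : ℂ) • S.run ρ k (replaceQubit (e 0) (tState (outFidelity f)) σ) +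
        ((1 - acceptProb f : ℝ) : ℂ) • R.run ρ k σ := by
  set τ : Op (Fin 5) := tensorOp fun i => tState (f i) with hτ
  have hp := acceptProb_ne_zero hf
  have h1 : syndromeProj * (decoder * τ * decoderᴴ) * syndromeProjᴴ =
      (acceptProb f : ℂ) • (embedFirst * (hadamardGate * pauliZ * tState (-outFidelity f) *
        (hadamardGate * pauliZ)ᴴ) * embedFirstᴴ) := by
    have : syndromeProj * (decoder * τ * decoderᴴ) * syndromeProjᴴ =
        (syndromeProj * decoder) * τ * (syndromeProj * decoder)ᴴ := by
      simp only [conjTranspose_mul, Matrix.mul_assoc]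
    have hd : encodeᴴ * (τ * encode) = (acceptProb f : ℂ) • tState (-outFidelity f) := by
      rw [← Matrix.mul_assoc, outFidelity_eq hp, ← decoded_eq hp, decoded]
    rw [this, syndromeProj_mul_decoder]
    simp only [conjTranspose_mul, conjTranspose_conjTranspose, Matrix.mul_assoc]
    simp only [← Matrix.mul_assoc encode, ← Matrix.mul_assoc τ, ← Matrix.mul_assoc encodeᴴ]
    rw [Matrix.mul_assoc encodeᴴ, hd]
    simp only [Matrix.smul_mul, Matrix.mul_smul, Matrix.mul_assoc]
  -- Unitarity is only needed for the total probability, which fixes the weight `1 - acceptProb f`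
  -- of the failing branch.
  have hD : decoderᴴ * decoder = 1 := by
    have hc : ∀ {c t : Fin 5}, c ≠ t → (czOp c t)ᴴ * czOp c t = 1 := by
      intro c t hct
      have hb : ∀ a : Fin 2, ((bitSign a : ℤ) : ℂ) * (bitSign a : ℂ) = 1 := by
        intro a
        have : ∀ a, bitSign a * bitSign a = 1 := by decide
        rw [← Int.cast_mul, this, Int.cast_one]
      rw [czOp_eq hct, Matrix.diagonal_conjTranspose, Matrix.diagonal_mul_diagonal,
        ← Matrix.diagonal_one]
      congr 1; ext1 s
      simp [hb]
    have hh : ∀ q : Fin 5, (onQubit q hadamardGate)ᴴ * onQubit q hadamardGate = 1 := fun q =>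
      onQubit_unitary q (by rw [hadamardGate_conjTranspose, hadamardGate_mul_self])
    have hm : ∀ {U V : Op (Fin 5)}, Uᴴ * U = 1 → Vᴴ * V = 1 → (U * V)ᴴ * (U * V) = 1 := by
      intro U V hU hV
      rw [conjTranspose_mul, Matrix.mul_assoc, ← Matrix.mul_assoc Uᴴ, hU, Matrix.one_mul, hV]
    refine hm (hm (cnot_unitary (by decide)) (hm (cnot_unitary (by decide))
      (hm (cnot_unitary (by decide)) (cnot_unitary (by decide))))) (hm ?_ ?_)
    · exact hm (hh 4) (hm (hh 3) (hm (hh 2) (hm (hh 1) (hh 0))))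
    · exact hm (hc (by decide)) (hm (hc (by decide)) (hm (hc (by decide))
        (hm (hc (by decide)) (hc (by decide)))))
  have h2 : onQubit 0 pauliZ * (syndromeProj * (decoder * τ * decoderᴴ) * syndromeProjᴴ) *
      onQubit 0 pauliZ = (acceptProb f : ℂ) • replaceQubit 0 (tState (outFidelity f))
        (zeroState (Fin 5)) := by
    have hJ : embedFirstᴴ * onQubit (0 : Fin 5) pauliZ = pauliZ * embedFirstᴴ := by
      have := congrArg conjTranspose (onQubit_mul_embedFirst pauliZ)
      rwa [conjTranspose_mul, conjTranspose_mul, onQubit_conjTranspose, pauliZ_conjTranspose] at this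
    rw [h1, Matrix.mul_smul, Matrix.smul_mul]
    congr 1
    rw [← embedFirst_conj, ← conj_tState (outFidelity f)]
    simp only [Matrix.mul_assoc, hJ]
    rw [← Matrix.mul_assoc (onQubit (0 : Fin 5) pauliZ), onQubit_mul_embedFirst]
    simp only [Matrix.mul_assoc]
  have h3 : (syndromeProj * (decoder * τ * decoderᴴ) * syndromeProjᴴ).trace = acceptProb f := by
    have h := congrArg Matrix.trace h2
    rw [Matrix.trace_mul_comm, ← Matrix.mul_assoc, onQubit_mul, pauliZ_mul_self, onQubit_one, Matrix.one_mul,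
      Matrix.trace_smul, replaceQubit_trace, (tState_traces _).1] at h
    rw [h]; simp [zeroState]
  have h4 : (decoder * τ * decoderᴴ).trace = 1 := by
    rw [trace_unitary_conj hD, hτ, tensorOp_trace]
    simp [(tState_traces _).1]
  rw [decode, run_decodeGates he, run_checkSyndrome he _ _ _ _ _ hσ, h2, h3, h4, put_smul,
    ← put_replaceQubit he, put_zeroState hσ, run_smul]
  push_cast; rfl

end MagicDistill

/-! ### Concatenated distillation with repetition until success. -/

namespace MagicDistill

set_option linter.unusedSectionVars false

open Matrix Function

section TensorPut

variable {Q B : Type} [Fintype Q] [DecidableEq Q] [Fintype B] [DecidableEq B]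

lemma replaceQubit_tensorOp (A : B → Op1) (i : B) (τ : Op1) (h : (A i).trace = 1) :
    replaceQubit i τ (tensorOp A) = tensorOp (update A i τ) := by
  ext s t
  simp only [replaceQubit, tensorOp, Matrix.of_apply]
  rw [← Finset.mul_prod_erase _ _ (Finset.mem_univ i), update_self]
  congr 1
  have h1 : ∀ b : Fin 2, ∏ j, A j (update s i b j) (update t i b j) =
      A i b b * ∏ j ∈ Finset.univ.erase i, A j (s j) (t j) := fun b => by
    rw [← Finset.mul_prod_erase _ _ (Finset.mem_univ i), update_self, update_self]
    congr 1
    refine Finset.prod_congr rfl fun j hj => ?_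
    rw [update_of_ne (Finset.ne_of_mem_erase hj), update_of_ne (Finset.ne_of_mem_erase hj)]
  simp only [h1]
  rw [← Finset.sum_mul]
  have h2 : ∑ b, A i b b = 1 := h
  rw [h2, one_mul]
  refine Finset.prod_congr rfl fun j hj => ?_
  rw [update_of_ne (Finset.ne_of_mem_erase hj)]

lemma zeroState_eq_tensorOp : zeroState B = tensorOp fun _ => basisProj 0 := by
  ext s t
  simp only [zeroState, Matrix.single, tensorOp, Matrix.of_apply, basisProj]
  rw [Fintype.prod_boole]
  refine if_congr ?_ rfl rfl
  simp only [funext_iff, Pi.zero_apply, forall_and]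

lemma clean_put_tensorOp {e : B → Q} {W : Set Q} (hW : Disjoint W (Set.range e)) {σ : Op Q}
    (hσ : Clean W σ) {A : B → Op1} {i : B} (hA : A i = basisProj 0) :
    Clean (insert (e i) W) (put e (tensorOp A) σ) := by
  rintro s t ⟨w, hw, hst⟩
  simp only [put, Matrix.of_apply]
  rcases hw with rfl | hw
  · have : tensorOp A (s ∘ e) (t ∘ e) = 0 := by
      refine Finset.prod_eq_zero (Finset.mem_univ i) ?_
      have : ¬ (s (e i) = 0 ∧ t (e i) = 0) := by tauto
      simp [hA, basisProj_apply, this]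
    rw [this, zero_mul]
  · have h : ¬ ∃ i, e i = w := fun h => Set.disjoint_left.1 hW hw h
    rw [hσ (clear e s) (clear e t) ⟨w, hw, ?_⟩, mul_zero]
    simpa [clear, h] using hst

end TensorPut

section Prepare

variable {Q : Type} [Fintype Q] [DecidableEq Q]

/-- The subroutine `T` prepares on the clean qubit `q` a state with parameter at least `F`, using
the clean work qubits `W`. It either succeeds, and continues with its first argument, or restores
the clean state, and continues with its second argument; it succeeds with probability at least
one half. -/
def Prepares (ρ : ℕ → Op1) (T : Protocol Q → Protocol Q → Protocol Q) (q : Q) (W : Set Q)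
    (F : ℝ) : Prop :=
  -- Success probabilities are encoded by bounding a functional of the final state for all
  -- continuations; the parameter `f` may then differ between branches without an explicit mixture.
  -- The bounds on `S` and `R` are uniform in `k` because branches use up different numbers of
  -- supplied states.
  ∀ (φ : Op Q →ₗ[ℝ] ℝ) (k : ℕ) (σ : Op Q), Clean (insert q W) σ →
    ∀ (S R : Protocol Q) (a b : ℝ), a ≤ b →
      (∀ k f, F ≤ f → f ≤ 1 → φ (S.run ρ k (replaceQubit q (tState f) σ)) ≤ a) →
      (∀ k, φ (R.run ρ k σ) ≤ b) → φ ((T S R).run ρ k σ) ≤ (a + b) / 2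

lemma Prepares.mono {ρ : ℕ → Op1} {T : Protocol Q → Protocol Q → Protocol Q} {q : Q} {W : Set Q}
    {F F' : ℝ} (h : Prepares ρ T q W F) (hF : F' ≤ F) : Prepares ρ T q W F' :=
  fun φ k σ hσ S R a b hab hS hR =>
    h φ k σ hσ S R a b hab (fun k f hf => hS k f (hF.trans hf)) hR

/-- A supply of states `tState f` with `F ≤ f ≤ 1`. -/
def SuppliesAbove (F : ℝ) (ρ : ℕ → Op1) : Prop := ∀ i, ∃ f, F ≤ f ∧ f ≤ 1 ∧ ρ i = tState f

lemma prepares_prepSupplied {F : ℝ} {ρ : ℕ → Op1} (hρ : SuppliesAbove F ρ) (q : Q) (W : Set Q) :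
    Prepares ρ (fun S _ => .prepSupplied q S) q W F := by
  intro φ k σ _ S R a b hab hS _
  obtain ⟨f, h1, h2, h3⟩ := hρ k
  have h := hS (k + 1) f h1 h2
  rw [← h3] at h
  change φ (S.run ρ (k + 1) (replaceQubit q (ρ k) σ)) ≤ _
  linarith

variable {B : Type} [Fintype B] [DecidableEq B]

/-- Run the subroutines `T (e i)` for all `i` in a list, and continue with `R` when one fails. -/
def prepareList (T : Q → Protocol Q → Protocol Q → Protocol Q) (e : B → Q) (S R : Protocol Q)
    (l : List B) : Protocol Q :=
  l.foldr (fun i P => T (e i) P R) S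

lemma numOps_prepareList {T : Q → Protocol Q → Protocol Q → Protocol Q} {N : ℕ}
    (hT : ∀ q S R, (T q S R).numOps ≤ N + max S.numOps R.numOps) (e : B → Q) (S R : Protocol Q)
    (l : List B) :
    (prepareList T e S R l).numOps ≤ N * l.length + max S.numOps R.numOps := by
  induction l with
  | nil =>
    change S.numOps ≤ _
    simp
  | cons i l h =>
    refine (hT (e i) (prepareList T e S R l) R).trans ?_
    rw [List.length_cons, Nat.mul_succ]
    have := le_max_right S.numOps R.numOps
    have : max (prepareList T e S R l).numOps R.numOps ≤ N * l.length + max S.numOps R.numOps :=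
      max_le h (by omega)
    omega

/-- All subroutines succeed with probability at least `(1/2) ^ l.length`. A late failure finds
earlier qubits of the block already prepared, so the continuation `R` has to cope with every block
state `τ` of trace one. -/
lemma run_prepareList_le {ρ : ℕ → Op1} {T : Q → Protocol Q → Protocol Q → Protocol Q} {e : B → Q}
    (he : Injective e) {W : Set Q} {F : ℝ} (hT : ∀ i, Prepares ρ (T (e i)) (e i) W F)
    (hW : Disjoint W (Set.range e)) {l : List B} (hl : l.Nodup) (hl' : ∀ i, i ∈ l) {σ : Op Q}
    (hσ : Clean (Set.range e ∪ W) σ) (φ : Op Q →ₗ[ℝ] ℝ) {S R : Protocol Q} {a b : ℝ} (hab : a ≤ b)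
    (hS : ∀ k (f : B → ℝ), (∀ i, F ≤ f i ∧ f i ≤ 1) →
      φ (S.run ρ k (put e (tensorOp fun i => tState (f i)) σ)) ≤ a)
    (hR : ∀ k τ, τ.trace = 1 → φ (R.run ρ k (put e τ σ)) ≤ b) (k : ℕ) :
    φ ((prepareList T e S R l).run ρ k σ) ≤
      (1 / 2) ^ l.length * a + (1 - (1 / 2) ^ l.length) * b := by
  -- Generalized to the middle of the run: qubits still in `l` are in the state `|0⟩`, the others
  -- already carry prepared states.
  have key : ∀ l : List B, l.Nodup → ∀ k (A : B → Op1), (∀ i ∈ l, A i = basisProj 0) →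
      (∀ i, i ∉ l → ∃ f, F ≤ f ∧ f ≤ 1 ∧ A i = tState f) →
      φ ((prepareList T e S R l).run ρ k (put e (tensorOp A) σ)) ≤
        (1 / 2) ^ l.length * a + (1 - (1 / 2) ^ l.length) * b := by
    intro l
    induction l with
    | nil =>
      intro _ k A _ hA
      choose f h1 h2 h3 using fun i => hA i (by simp)
      obtain rfl : A = fun i => tState (f i) := funext h3
      simpa [prepareList] using hS k f fun i => ⟨h1 i, h2 i⟩
    | cons i l ih =>
      intro hl k A h0 hA
      have h0i := h0 i (by simp)
      rw [List.nodup_cons] at hl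
      have hp : (0 : ℝ) ≤ (1 / 2) ^ l.length := by positivity
      have hp' : ((1 : ℝ) / 2) ^ l.length ≤ 1 := pow_le_one₀ (by norm_num) (by norm_num)
      have := hT i φ k _ (clean_put_tensorOp hW (hσ.mono Set.subset_union_right) h0i)
        (prepareList T e S R l) R ((1 / 2) ^ l.length * a + (1 - (1 / 2) ^ l.length) * b) b
        (by nlinarith) ?_ ?_
      · refine this.trans (le_of_eq ?_)
        rw [List.length_cons, pow_succ]; ring
      · intro k f hf hf'
        rw [put_replaceQubit he, replaceQubit_tensorOp _ _ _ (by rw [h0i, basisProj_trace])]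
        refine ih hl.2 _ _ ?_ ?_
        · intro j hj
          have hji : j ≠ i := by rintro rfl; exact hl.1 hj
          rw [update_of_ne hji]
          exact h0 j (by simp [hj])
        · intro j hj
          by_cases hji : j = i
          · subst hji
            exact ⟨f, hf, hf', by simp⟩
          · rw [update_of_ne hji]
            exact hA j (by simp [hj, hji])
      · intro k
        refine hR k _ ?_
        rw [tensorOp_trace]
        refine Finset.prod_eq_one fun j _ => ?_
        by_cases hj : j ∈ i :: l
        · rw [h0 j hj, basisProj_trace]
        · obtain ⟨f, _, _, h⟩ := hA j hj
          rw [h, (tState_traces f).1]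
  have := key l hl k (fun _ => basisProj 0) (fun _ _ => rfl) (fun i hi => (hi (hl' i)).elim)
  rwa [← zeroState_eq_tensorOp, put_zeroState (hσ.mono Set.subset_union_left)] at this

/-- Retry a subroutine until it succeeds, but at most `n` times. -/
def retry (A : Protocol Q → Protocol Q) : ℕ → Protocol Q → Protocol Q
  | 0, R => R
  | n + 1, R => A (retry A n R)

lemma run_retry_le {ρ : ℕ → Op1} {A : Protocol Q → Protocol Q} (φ : Op Q →ₗ[ℝ] ℝ) {σ : Op Q}
    {a b p : ℝ} (hp : 0 ≤ p) (hab : a ≤ b) {R : Protocol Q}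
    (hA : ∀ R v, a ≤ v → (∀ k, φ (R.run ρ k σ) ≤ v) →
      ∀ k, φ ((A R).run ρ k σ) ≤ (1 - p) * a + p * v)
    (hR : ∀ k, φ (R.run ρ k σ) ≤ b) (n k : ℕ) :
    φ ((retry A n R).run ρ k σ) ≤ a + p ^ n * (b - a) := by
  induction n generalizing k with
  | zero => simpa [retry] using hR k
  | succ n ih =>
    have h : 0 ≤ p ^ n * (b - a) := mul_nonneg (pow_nonneg hp n) (by linarith)
    refine (hA _ _ (by linarith) ih k).trans (le_of_eq ?_)
    rw [pow_succ]; ring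

lemma numOps_retry {A : Protocol Q → Protocol Q} {N M : ℕ}
    (hA : ∀ R, (A R).numOps ≤ N + max M R.numOps) (n : ℕ) (R : Protocol Q) :
    (retry A n R).numOps ≤ N * n + max M R.numOps := by
  induction n with
  | zero => simp [retry]
  | succ n ih =>
    refine (hA _).trans ?_
    rw [Nat.mul_succ]
    have := le_max_left M R.numOps
    have : max M (retry A n R).numOps ≤ N * n + max M R.numOps := max_le (by omega) ih
    omega

end Prepare

section Distill

variable {Q : Type} [Fintype Q] [DecidableEq Q]

/-- One attempt to distill a state: prepare the qubits `e 0, …, e 4` and decode. -/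
def attempt (T : Q → Protocol Q → Protocol Q → Protocol Q) (e : Fin 5 → Q) (S R : Protocol Q) :
    Protocol Q :=
  prepareList T e (decode e S R) (resetList ([0, 1, 2, 3, 4].map e) R) [0, 1, 2, 3, 4]

/-- The parameter of the distilled state, when the five input states have parameter `f`. -/
noncomputable def distillMap (f : ℝ) : ℝ := ratioFive f f f f f

lemma distillMap_eq (f : ℝ) : distillMap f = (10 * f ^ 3 - 2 * f ^ 5) / (3 + 5 * f ^ 4) := by
  rw [distillMap, ratioFive]; congr 1 <;> ring

lemma outFidelity_const (f : ℝ) (h : f ∈ Set.Icc (0 : ℝ) 1) :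
    outFidelity (fun _ => f) = distillMap f := by
  rw [outFidelity_eq (acceptProb_ne_zero ⟨fun _ => h.1, fun _ => h.2⟩), outRatio_eq, distillMap]

lemma distillMap_one : distillMap 1 = 1 := by rw [distillMap_eq]; norm_num

/-- The success probability `1/512` is `(1/2) ^ 5` for the five preparations times the bound `1/16`
for acceptance. -/
lemma run_attempt_le {ρ : ℕ → Op1} {T : Q → Protocol Q → Protocol Q → Protocol Q} {e : Fin 5 → Q}
    (he : Injective e) {W : Set Q} {F : ℝ} (hF : 0 ≤ F) (hF' : F ≤ 1)
    (hT : ∀ i, Prepares ρ (T (e i)) (e i) W F)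
    (hW : Disjoint W (Set.range e)) {σ : Op Q} (hσ : Clean (Set.range e ∪ W) σ)
    (φ : Op Q →ₗ[ℝ] ℝ) {S R : Protocol Q} {a b : ℝ} (hab : a ≤ b)
    (hS : ∀ k f, distillMap F ≤ f → f ≤ 1 →
      φ (S.run ρ k (replaceQubit (e 0) (tState f) σ)) ≤ a)
    (hR : ∀ k, φ (R.run ρ k σ) ≤ b) (k : ℕ) :
    φ ((attempt T e S R).run ρ k σ) ≤ (1 - 511 / 512) * a + 511 / 512 * b := by
  have hσ' := hσ.mono Set.subset_union_left
  have h := run_prepareList_le he hT hW (l := [0, 1, 2, 3, 4]) (by decide) (by decide) hσ φ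
    (S := decode e S R) (R := resetList ([0, 1, 2, 3, 4].map e) R)
    (a := 1 / 16 * a + 15 / 16 * b) (b := b) (by linarith) ?_ ?_ k
  · refine h.trans (le_of_eq ?_)
    simp only [List.length_cons, List.length_nil]
    ring
  · intro k f hf
    have hf' : f ∈ Set.Icc (0 : Fin 5 → ℝ) 1 := ⟨fun i => hF.trans (hf i).1, fun i => (hf i).2⟩
    have hp := acceptProb_pos hf'
    rw [run_decode he ρ S R k hσ' hf', map_add, Complex.coe_smul, Complex.coe_smul, map_smul,
      map_smul, smul_eq_mul, smul_eq_mul]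
    -- Here monotonicity enters: the worst case for unequal inputs is five copies of the lower bound
    -- `F`.
    have hlo : distillMap F ≤ outFidelity f := by
      rw [← outFidelity_const F ⟨hF, hF'⟩]
      exact outFidelity_monotoneOn ⟨fun _ => hF, fun _ => hF'⟩ hf' fun i => (hf i).1
    have hhi : outFidelity f ≤ 1 := by
      rw [← distillMap_one, ← outFidelity_const 1 ⟨by norm_num, le_rfl⟩]
      exact outFidelity_monotoneOn hf' ⟨fun _ => by norm_num, fun _ => le_rfl⟩ fun i => (hf i).2
    have hp1 : acceptProb f ≤ 1 := by
      have h1 : (1 : Fin 5 → ℝ) ∈ Set.Icc (0 : Fin 5 → ℝ) 1 :=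
        ⟨fun _ => zero_le_one, fun _ => le_rfl⟩
      refine (acceptProb_monotoneOn hf' h1 fun i => (hf i).2).trans ?_
      rw [acceptProb_eq_acceptFive, acceptFive]
      simp only [Pi.one_apply]
      norm_num
    have h1 := hS k _ hlo hhi
    have h2 := hR k
    nlinarith [mul_le_mul_of_nonneg_left h1 (by linarith : 0 ≤ acceptProb f),
      mul_le_mul_of_nonneg_left h2 (by linarith : 0 ≤ 1 - acceptProb f)]
  · intro k τ hτ
    rw [run_resetList_put he (by decide) ρ R k τ hσ', hτ, one_smul]
    exact hR k

/-- Distill a state on qubit `q` in `j` rounds, with work qubits `w i x` for `i < j`. -/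
def distill (w : ℕ → Fin 4 → Q) : ℕ → Q → Protocol Q → Protocol Q → Protocol Q
  | 0, q, S, _ => .prepSupplied q S
  | j + 1, q, S, R =>
      -- By `two_mul_pow_le`, 512 attempts restore success probability one half. The five
      -- preparations can share the work qubits of the lower rounds, since each of them leaves these
      -- clean.
      retry (attempt (distill w j) (Fin.cons q (w j)) S) 512 R

/-- With `N ≥ 1` operations for one input, a round takes at most `512 * (5 * N + 45) ≤ 2 ^ 15 * N`
operations besides its continuations. -/
lemma numOps_distill (w : ℕ → Fin 4 → Q) (j : ℕ) (q : Q) (S R : Protocol Q) :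
    (distill w j q S R).numOps ≤ 2 ^ (15 * j) + max S.numOps R.numOps := by
  induction j generalizing q S R with
  | zero =>
    simp only [distill, Protocol.numOps]
    omega
  | succ j ih =>
    have hA : ∀ R, (attempt (distill w j) (Fin.cons q (w j)) S R).numOps ≤
        (2 ^ (15 * j) * 5 + 45) + max S.numOps R.numOps := fun R => by
      refine (numOps_prepareList ih _ _ _ _).trans ?_
      have h1 := numOps_decode (Fin.cons q (w j)) S R
      have h2 := numOps_resetList ([0, 1, 2, 3, 4].map (Fin.cons q (w j) : Fin 5 → Q)) R
      simp only [List.length_map, List.length_cons, List.length_nil] at h2 ⊢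
      omega
    refine (numOps_retry hA 512 R).trans ?_
    have : 1 ≤ 2 ^ (15 * j) := Nat.one_le_two_pow
    rw [Nat.mul_succ 15, pow_add]
    omega

/-- Bernoulli's inequality for the inverse `512/511 = 1 + 1/511`. -/
lemma two_mul_pow_le : 2 * (511 / 512 : ℝ) ^ 512 ≤ 1 := by
  have h : 1 + (512 : ℕ) * (1 / 511 : ℝ) ≤ (1 + 1 / 511) ^ 512 :=
    one_add_mul_le_pow (by norm_num) 512
  have h2 : (511 / 512 : ℝ) ^ 512 * (1 + 1 / 511) ^ 512 = 1 := by
    rw [← mul_pow]; norm_num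
  have h3 : (0 : ℝ) < (511 / 512) ^ 512 := by positivity
  generalize (511 / 512 : ℝ) ^ 512 = x at *
  generalize (1 + 1 / 511 : ℝ) ^ 512 = y at *
  have : (2 : ℝ) ≤ y := by norm_num at h; linarith
  nlinarith

lemma distillMap_mem {f : ℝ} (h : f ∈ Set.Icc (0 : ℝ) 1) : distillMap f ∈ Set.Icc (0 : ℝ) 1 := by
  have h4 := pow_nonneg h.1 4
  have h3 := pow_nonneg h.1 3
  have h2 : 0 ≤ 1 - f ^ 2 := by nlinarith [h.1, h.2]
  rw [distillMap_eq]
  constructor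
  · refine div_nonneg ?_ (by linarith)
    nlinarith [mul_nonneg h3 h2]
  · rw [div_le_one (by linarith)]
    -- Denominator minus numerator of `distillMap f` equals `(1 - f)² (2 f³ + 9 f² + 6 f + 3)`.
    have := mul_nonneg (sq_nonneg (1 - f))
      (by nlinarith [h.1, pow_nonneg h.1 2] : 0 ≤ 2 * f ^ 3 + 9 * f ^ 2 + 6 * f + 3)
    nlinarith

lemma iterate_distillMap_mem {f : ℝ} (h : f ∈ Set.Icc (0 : ℝ) 1) (j : ℕ) :
    distillMap^[j] f ∈ Set.Icc (0 : ℝ) 1 := by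
  induction j with
  | zero => exact h
  | succ j ih => rw [iterate_succ_apply']; exact distillMap_mem ih

/-- Induction on the number of rounds: the block of the last round consists of `q` and the four
qubits `w j`, disjoint from the work qubits below. The bound `(511/512) ^ 512 ≤ 1/2` turns the
estimate for `retry` into the average of `a` and `b`. -/
lemma prepares_distill {ρ : ℕ → Op1} {F : ℝ} (hρ : SuppliesAbove F ρ) (hF : F ∈ Set.Icc (0 : ℝ) 1)
    {w : ℕ → Fin 4 → Q} {J : ℕ}
    (hw : ∀ i < J, ∀ i' < J, ∀ x x', w i x = w i' x' → i = i' ∧ x = x') (j : ℕ) (hj : j ≤ J)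
    (q : Q) (hq : ∀ i < j, ∀ x, w i x ≠ q) :
    Prepares ρ (distill w j q) q {r | ∃ i < j, ∃ x, w i x = r} (distillMap^[j] F) := by
  induction j generalizing q with
  | zero => exact prepares_prepSupplied hρ q _
  | succ j ih =>
    intro φ k σ hσ S R a b hab hS hR
    have he : Injective (Fin.cons q (w j) : Fin 5 → Q) := by
      rw [Fin.cons_injective_iff]
      refine ⟨?_, fun x x' h => (hw j hj j hj x x' h).2⟩
      rintro ⟨x, hx⟩
      exact hq j (Nat.lt_succ_self j) x hx
    have hmem : ∀ i, ∀ i' < j, ∀ x, w i' x ≠ (Fin.cons q (w j) : Fin 5 → Q) i := by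
      intro i
      refine Fin.cases ?_ (fun y => ?_) i
      · intro i' hi' x
        exact hq i' (by omega) x
      · intro i' hi' x h
        rw [Fin.cons_succ] at h
        have := (hw i' (by omega) j hj _ _ h).1
        omega
    have hT := fun i => ih (by omega) ((Fin.cons q (w j) : Fin 5 → Q) i) (hmem i)
    have hdis : Disjoint {r | ∃ i < j, ∃ x, w i x = r}
        (Set.range (Fin.cons q (w j) : Fin 5 → Q)) := by
      rw [Set.disjoint_left]
      rintro r ⟨i, hi, x, hx⟩ ⟨y, hy⟩
      exact hmem y i hi x (hx.trans hy.symm)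
    have hcl : Clean (Set.range (Fin.cons q (w j) : Fin 5 → Q) ∪ {r | ∃ i < j, ∃ x, w i x = r})
        σ := by
      refine hσ.mono ?_
      rintro r (⟨y, rfl⟩ | ⟨i, hi, x, hx⟩)
      · refine Fin.cases (Or.inl rfl) (fun y => Or.inr ⟨j, Nat.lt_succ_self j, y, rfl⟩) y
      · exact Or.inr ⟨i, by omega, x, hx⟩
    have hit := iterate_distillMap_mem hF j
    have := run_retry_le (ρ := ρ) (A := attempt (distill w j) (Fin.cons q (w j)) S) φ (σ := σ)
      (p := 511 / 512) (by norm_num) hab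
      (fun R v hv hR k => run_attempt_le he hit.1 hit.2 hT hdis hcl φ hv
        (fun k f hf => hS k f (by rwa [iterate_succ_apply'])) hR k) hR 512 k
    refine this.trans ?_
    have h512 := two_mul_pow_le
    generalize (511 / 512 : ℝ) ^ 512 = x at *
    nlinarith

end Distill

end MagicDistill

/-! ### Convergence of the distillation map. -/

namespace MagicDistill

open Matrix Function

lemma det_tState (f : ℝ) : (tState f).det = (((1 - f ^ 2) / 4 : ℝ) : ℂ) := by
  rw [Matrix.det_fin_two]
  simp only [tState_apply]
  have hg : ((f / √3 : ℝ) : ℂ) ^ 2 = ((f ^ 2 / 3 : ℝ) : ℂ) := by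
    rw [← Complex.ofReal_pow, div_pow, Real.sq_sqrt (by norm_num)]
  generalize ((f / √3 : ℝ) : ℂ) = g at hg
  simp only [Matrix.of_apply, Matrix.cons_val', Matrix.cons_val_zero, Matrix.cons_val_one,
    Matrix.cons_val_fin_one]
  push_cast at hg ⊢
  linear_combination (-3 / 4 : ℂ) * hg + g ^ 2 / 4 * Complex.I_sq

/-- A density matrix has nonnegative determinant, here `(1 - f²) / 4`, so `f ≤ 1`. The minimum keeps
the bound inside `[0, 1]`; when `√(3/7) + ε > 1` there is no supply at all. -/
lemma suppliesAbove_of_isSupply {ε : ℝ} {ρ : ℕ → Op1} (h : IsSupply ε ρ) :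
    SuppliesAbove (min 1 (√(3 / 7) + ε)) ρ := by
  obtain ⟨f, hf⟩ := h
  intro i
  obtain ⟨h1, h2, hX, hY, hZ⟩ := hf i
  obtain ⟨t1, tX, tY, tZ⟩ := tState_traces (f i)
  have he : ρ i = tState (f i) :=
    op1_eq_of_traces (h2.2.trans t1.symm) (hX.trans tX.symm) (hY.trans tY.symm) (hZ.trans tZ.symm)
  have hd := h2.1.det_nonneg
  rw [he, det_tState] at hd
  have hd' : 0 ≤ (1 - f i ^ 2) / 4 := by exact_mod_cast hd
  have : f i ≤ 1 := by nlinarith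
  exact ⟨f i, (min_le_right _ _).trans h1, this, he⟩

/-- The error has a double zero at `f = 1`; its cofactor is at most `20` on `[0, 1]` and the
denominator at least `3`. -/
lemma one_sub_distillMap_le {f : ℝ} (h : f ∈ Set.Icc (0 : ℝ) 1) :
    1 - distillMap f ≤ 20 / 3 * (1 - f) ^ 2 := by
  have h4 := pow_nonneg h.1 4
  have h3 := pow_le_one₀ h.1 h.2 (n := 3)
  have h2 := pow_le_one₀ h.1 h.2 (n := 2)
  have h1 := h.2
  have : 1 - distillMap f = (1 - f) ^ 2 * (2 * f ^ 3 + 9 * f ^ 2 + 6 * f + 3) / (3 + 5 * f ^ 4) := by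
    rw [distillMap_eq]
    field_simp
    ring
  rw [this, div_le_iff₀ (by linarith)]
  nlinarith [mul_nonneg (sq_nonneg (1 - f))
    (by linarith : 0 ≤ 20 - (2 * f ^ 3 + 9 * f ^ 2 + 6 * f + 3)), mul_nonneg (sq_nonneg (1 - f)) h4]

/-- The factor `7 f² - 3` shows why `√(3/7)` is the threshold. The bound drops the factor `1 + f ≥
1`, replaces `f` by `F` elsewhere, except in `1 - f`, and bounds the denominator by `8`. -/
lemma distillMap_sub_ge {f F : ℝ} (hF : 0 ≤ F) (hF' : 3 ≤ 7 * F ^ 2) (hFf : F ≤ f) (hf : f ≤ 1) :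
    F * (1 - f) * (7 * F ^ 2 - 3) / 8 ≤ distillMap f - f := by
  have hf0 := hF.trans hFf
  have h4 := pow_nonneg hf0 4
  have h4' := pow_le_one₀ hf0 hf (n := 4)
  have : distillMap f - f = f * ((1 + f) * (1 - f)) * (7 * f ^ 2 - 3) / (3 + 5 * f ^ 4) := by
    rw [distillMap_eq]
    field_simp
    ring
  rw [this]
  have h1 : 0 ≤ 1 - f := by linarith
  have h7 : 7 * F ^ 2 ≤ 7 * f ^ 2 := by nlinarith
  have h2 : 1 * (1 - f) ≤ (1 + f) * (1 - f) := mul_le_mul_of_nonneg_right (by linarith) h1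
  rw [one_mul] at h2
  have hb : F * (1 - f) ≤ f * ((1 + f) * (1 - f)) :=
    mul_le_mul hFf h2 h1 hf0
  have hc := mul_le_mul hb (by linarith : 7 * F ^ 2 - 3 ≤ 7 * f ^ 2 - 3) (by linarith)
    ((mul_nonneg hF h1).trans hb)
  exact div_le_div₀ ((mul_nonneg (mul_nonneg hF h1) (by linarith)).trans hc) hc (by linarith)
    (by linarith)

/-- As long as the error exceeds `1/20`, each round gains a fixed amount; this cannot continue,
since the parameter stays at most `1`. -/
lemma exists_iterate_distillMap {F : ℝ} (hF : 0 ≤ F) (hF' : 3 < 7 * F ^ 2) (hF1 : F ≤ 1) :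
    ∃ j, 1 - distillMap^[j] F ≤ 1 / 20 := by
  by_contra! h
  have hd : 0 < F * (1 / 20) * (7 * F ^ 2 - 3) / 8 := by
    have : 0 < F := lt_of_le_of_ne hF (by rintro rfl; norm_num at hF')
    have : 0 < 7 * F ^ 2 - 3 := by linarith
    positivity
  have key : ∀ j : ℕ, F + j * (F * (1 / 20) * (7 * F ^ 2 - 3) / 8) ≤ distillMap^[j] F := by
    intro j
    induction j with
    | zero => simp
    | succ j ih =>
      have h1 : F ≤ distillMap^[j] F := by
        have : 0 ≤ j * (F * (1 / 20) * (7 * F ^ 2 - 3) / 8) := by positivity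
        linarith
      have h2 := distillMap_sub_ge hF hF'.le h1 (iterate_distillMap_mem ⟨hF, hF1⟩ j).2
      rw [iterate_succ_apply']
      have h3 : F * (1 / 20) * (7 * F ^ 2 - 3) / 8 ≤
          F * (1 - distillMap^[j] F) * (7 * F ^ 2 - 3) / 8 := by
        have := mul_le_mul_of_nonneg_left (h j).le hF
        have := mul_le_mul_of_nonneg_right this (by linarith : 0 ≤ 7 * F ^ 2 - 3)
        linarith
      push_cast
      linarith
  obtain ⟨n, hn⟩ := exists_nat_gt (1 / (F * (1 / 20) * (7 * F ^ 2 - 3) / 8))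
  rw [div_lt_iff₀ hd] at hn
  have := key n
  have := (iterate_distillMap_mem ⟨hF, hF1⟩ n).2
  linarith

/-- The constant `3/20` reproduces itself, as `20/3 * (3/20)² = 3/20`, and the initial error `1/20`
is `3/20 * 1/3`. -/
lemma iterate_distillMap_quadratic {F : ℝ} (hF : F ∈ Set.Icc (0 : ℝ) 1) (h : 1 - F ≤ 1 / 20)
    (i : ℕ) : 1 - distillMap^[i] F ≤ 3 / 20 * (1 / 3) ^ 2 ^ i := by
  induction i with
  | zero => norm_num; linarith
  | succ i ih =>
    have hm := iterate_distillMap_mem hF i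
    rw [iterate_succ_apply', pow_succ 2 i, pow_mul]
    have := one_sub_distillMap_le hm
    have h0 : 0 ≤ 1 - distillMap^[i] F := by linarith [hm.2]
    have := mul_self_le_mul_self h0 ih
    nlinarith

/-- After finitely many rounds that depend on the initial parameter, distillation converges
doubly exponentially. -/
lemma exists_distill_error_le {ε : ℝ} (hε : 0 < ε) :
    ∃ j₀, ∀ i, 1 - distillMap^[j₀ + i] (min 1 (√(3 / 7) + ε)) ≤ Real.exp (-2 ^ i) := by
  set F := min 1 (√(3 / 7) + ε) with hFdef
  have hs := Real.sqrt_nonneg (3 / 7)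
  have hs2 : √(3 / 7) ^ 2 = (3 / 7 : ℝ) := Real.sq_sqrt (by norm_num)
  have hF : 0 ≤ F := le_min zero_le_one (by linarith)
  have hF1 : F ≤ 1 := min_le_left _ _
  have hF' : 3 < 7 * F ^ 2 := by
    rcases min_choice 1 (√(3 / 7) + ε) with h | h
    · rw [hFdef, h]; norm_num
    · rw [hFdef, h]; nlinarith
  obtain ⟨j, hj⟩ := exists_iterate_distillMap hF hF' hF1
  refine ⟨j, fun i => ?_⟩
  rw [add_comm, iterate_add_apply]
  refine (iterate_distillMap_quadratic (iterate_distillMap_mem ⟨hF, hF1⟩ j) hj i).trans ?_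
  have h3 : (1 / 3 : ℝ) ≤ Real.exp (-1) := by
    rw [Real.exp_neg, one_div]
    exact inv_anti₀ (Real.exp_pos 1) (Real.exp_one_lt_d9.le.trans (by norm_num))
  have h4 : Real.exp (-2 ^ i) = Real.exp (-1) ^ 2 ^ i := by
    rw [← Real.exp_nat_mul]; congr 1; push_cast; ring
  rw [h4]
  have := pow_le_pow_left₀ (by norm_num) h3 (2 ^ i)
  have h0 : (0 : ℝ) ≤ (1 / 3) ^ 2 ^ i := by positivity
  linarith

end MagicDistill

/-! ### Rotations by `± π / 6` from two perfect states. -/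

namespace MagicDistill

set_option linter.unusedSectionVars false

open Matrix Function ComplexConjugate

/-- The twelfth root of unity `exp (i π / 6)`. -/
noncomputable def zeta12 : ℂ := (√3 + Complex.I) / 2

lemma sqrt_three_sq : ((√3 : ℝ) : ℂ) ^ 2 = 3 := by
  rw [← Complex.ofReal_pow, Real.sq_sqrt (by norm_num)]; norm_num

lemma conj_zeta12 : conj zeta12 = (√3 - Complex.I) / 2 := by
  rw [zeta12, map_div₀, map_add, Complex.conj_ofReal, Complex.conj_I, Complex.conj_ofNat]
  ring

lemma zeta12_mul_conj : zeta12 * conj zeta12 = 1 := by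
  rw [conj_zeta12, zeta12]
  linear_combination sqrt_three_sq / 4 - Complex.I_sq / 4

lemma zeta12_pow_three : zeta12 ^ 3 = Complex.I := by
  rw [zeta12]
  linear_combination (√3 + 3 * Complex.I) / 8 * sqrt_three_sq +
    (3 * √3 + Complex.I) / 8 * Complex.I_sq

/-- The rotation `diag (1, exp (± i π / 6))`. -/
noncomputable def rotGate (s : Bool) : Op1 := !![1, 0; 0, bif s then zeta12 else conj zeta12]

lemma rotGate_eq_diagonal (s : Bool) :
    rotGate s = diagonal ![1, bif s then zeta12 else conj zeta12] := by
  ext i j; fin_cases i <;> fin_cases j <;> simp [rotGate]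

lemma rotGate_unitary (s : Bool) : (rotGate s)ᴴ * rotGate s = 1 := by
  have h := zeta12_mul_conj
  ext i j
  cases s <;> fin_cases i <;> fin_cases j <;>
    (simp [rotGate, Matrix.mul_apply, h]; try rw [mul_comm, h])

/-- The Clifford gate `diag (1, ± i)`. -/
noncomputable def phaseCorrection (s : Bool) : Op1 :=
  bif s then phaseGate else phaseGate * (phaseGate * phaseGate)

lemma phaseCorrection_eq_diagonal (s : Bool) :
    phaseCorrection s = diagonal ![1, bif s then Complex.I else -Complex.I] := by
  cases s
  · rw [phaseCorrection, cond_false, phaseGate_mul_self]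
    ext i j; fin_cases i <;> fin_cases j <;> simp [phaseGate, pauliZ, Matrix.mul_apply]
  · ext i j; fin_cases i <;> fin_cases j <;> simp [phaseCorrection, phaseGate]

/-- In degrees, `-30 + 90 - 30 = 30`. After a rotation with the wrong sign and a Clifford phase,
what is missing is again a rotation by 30 degrees, of the opposite sign. -/
lemma rotGate_correct (s : Bool) : rotGate (!s) * phaseCorrection s * rotGate (!s) = rotGate s := by
  have h := zeta12_mul_conj
  have h3 := zeta12_pow_three
  have h3' : conj zeta12 ^ 3 = -Complex.I := by rw [← map_pow, h3, Complex.conj_I]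
  rw [phaseCorrection_eq_diagonal, rotGate_eq_diagonal, rotGate_eq_diagonal, diagonal_mul_diagonal,
    diagonal_mul_diagonal]
  congr 1
  ext i
  cases s <;> fin_cases i <;> simp
  · linear_combination (-zeta12 ^ 2) * h3' + (conj zeta12 * (zeta12 * conj zeta12 + 1)) * h
  · linear_combination (-conj zeta12 ^ 2) * h3 + (zeta12 * (zeta12 * conj zeta12 + 1)) * h

lemma phaseCorrection_unitary (s : Bool) : (phaseCorrection s)ᴴ * phaseCorrection s = 1 := by
  rw [phaseCorrection_eq_diagonal, diagonal_conjTranspose, diagonal_mul_diagonal, ← diagonal_one]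
  congr 1
  ext i
  cases s <;> fin_cases i <;> simp

lemma sqrt_three_inv : ((1 / √3 : ℝ) : ℂ) = √3 / 3 := by
  rw [← Complex.ofReal_ofNat, ← Complex.ofReal_div]
  congr 1
  rw [div_eq_div_iff (by positivity) (by norm_num), Real.mul_self_sqrt (by norm_num)]; norm_num

section Teleport

variable {Q : Type} [Fintype Q] [DecidableEq Q]

/-- Gate teleportation: after a CNOT with a qubit in a pure state, measuring that qubit acts on the
control as a diagonal operator. -/
lemma teleport {d m : Q} (h : d ≠ m) (χ : Fin 2 → ℂ) {σ : Op Q} (hσ : Clean {m} σ) (o : Fin 2) :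
    replaceQubit m (basisProj 0) (onQubit m (basisProj o) *
      (cnotGate d m * replaceQubit m (vecMulVec χ (star χ)) σ * (cnotGate d m)ᴴ) *
        onQubit m (basisProj o)) =
      onQubit d (diagonal fun x => χ (o + x)) * σ * (onQubit d (diagonal fun x => χ (o + x)))ᴴ := by
  ext s t
  have h1 : ∀ M : Op Q, ∀ s t : Q → Fin 2,
      ∑ b, (onQubit m (basisProj o) * M * onQubit m (basisProj o)) (update s m b) (update t m b) =
        M (update s m o) (update t m o) := by
    intro M s t
    rw [Finset.sum_eq_single o]
    · rw [onQubit_mul_mul_apply, Finset.sum_eq_single o, Finset.sum_eq_single o]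
      · simp [basisProj_apply]
      · intro b _ hb; simp [basisProj_apply, hb]
      · simp
      · intro b _ hb; simp [basisProj_apply, hb]
      · simp
    · intro b _ hb
      rw [onQubit_mul_mul_apply]
      simp [basisProj_apply, hb]
    · simp
  have h2 : ∀ s : Q → Fin 2, flip d m (update s m o) = update s m (o + s d) := by
    intro s
    simp [flip, h]
  have h3 : ∀ s t : Q → Fin 2, ∑ c, σ (update s m c) (update t m c) =
      σ (update s m 0) (update t m 0) := by
    intro s t
    rw [Fin.sum_univ_two, hσ (update s m 1) (update t m 1) ⟨m, rfl, by simp⟩, add_zero]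
  rw [onQubit_conjTranspose, diagonal_conjTranspose, onQubit_mul_mul_apply, Finset.sum_eq_single (s d),
    Finset.sum_eq_single (t d)]
  · rw [replaceQubit, Matrix.of_apply, h1, cnot_conj_apply h, h2, h2, replaceQubit, Matrix.of_apply]
    simp only [update_idem, h3, update_self, vecMulVec_apply, Pi.star_apply, diagonal_apply_eq,
      update_eq_self]
    by_cases hst : s m = 0 ∧ t m = 0
    · rw [basisProj_apply, if_pos hst, one_mul]
      have hs : update s m 0 = s := by rw [← hst.1, update_eq_self]
      have ht : update t m 0 = t := by rw [← hst.2, update_eq_self]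
      rw [hs, ht]
      ring
    · rw [basisProj_apply, if_neg hst, hσ s t ⟨m, rfl, by tauto⟩]
      ring
  · intro b _ hb; simp [diagonal_apply_ne, hb]
  · simp
  · intro b _ hb; simp [diagonal_apply_ne, hb.symm]
  · simp

end Teleport

section Resource

/-- The pure state that teleports the rotations by `± π / 6`. -/
noncomputable def rotAmplitude : Fin 2 → ℂ := ![1 / √2, conj zeta12 / √2]

/-- Even parity keeps the entries with equal bits on both qubits, that is, the entrywise product. -/
lemma parity_tensorOp (A : Fin 2 → Op1) :
    onQubit 1 (basisProj 0) * (cnotGate 0 1 * tensorOp A * (cnotGate 0 1)ᴴ) *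
      onQubit 1 (basisProj 0) =
    tensorOp (update (fun _ => basisProj 0) 0 (A 0 ⊙ A 1) : Fin 2 → Op1) := by
  have h01 : (0 : Fin 2) ≠ 1 := by decide
  ext s t
  simp only [onQubit_mul_mul_apply, cnot_conj_apply h01, tensorOp, Matrix.of_apply, flip,
    Fin.sum_univ_two, Fin.prod_univ_two, basisProj_apply]
  by_cases hs : s 1 = 0 <;> by_cases ht : t 1 = 0 <;> simp [hs, ht, hadamard_apply, basisProj_apply]

/-- The factor `2/3` is the probability of even parity; the resulting pure state lies on the equator
with phase `-π / 6`, the form that teleports a diagonal gate. -/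
lemma hadamard_tState_one : hadamardGate * (tState 1 ⊙ tState 1) * hadamardGateᴴ =
    (2 / 3 : ℂ) • vecMulVec rotAmplitude (star rotAmplitude) := by
  have h3 := sqrt_three_sq
  have hI := Complex.I_sq
  have hz := zeta12_mul_conj
  rw [hadamardGate_conjTranspose]
  ext i j
  simp only [Matrix.mul_apply, hadamardGate_apply, Fin.sum_univ_two, hadamard_apply, tState_apply,
    sqrt_three_inv, Matrix.smul_apply, vecMulVec_apply, rotAmplitude, Pi.star_apply, smul_eq_mul]
  fin_cases i <;> fin_cases j <;> simp
  · linear_combination (√2 : ℂ)⁻¹ ^ 2 / 18 * h3 + (√2 : ℂ)⁻¹ ^ 2 * √3 ^ 2 / 18 * hI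
  · rw [zeta12]
    linear_combination (√2 : ℂ)⁻¹ ^ 2 * Complex.I / 9 * h3
  · rw [conj_zeta12]
    linear_combination -(√2 : ℂ)⁻¹ ^ 2 * Complex.I / 9 * h3
  · linear_combination (√2 : ℂ)⁻¹ ^ 2 / 18 * h3 - (√2 : ℂ)⁻¹ ^ 2 * √3 ^ 2 / 18 * hI -
      2 / 3 * (√2 : ℂ)⁻¹ ^ 2 * hz

end Resource

end MagicDistill

namespace MagicDistill

set_option linter.unusedSectionVars false

open Matrix Function ComplexConjugate

section Consume

variable {Q : Type} [Fintype Q] [DecidableEq Q]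

lemma onQubit_conj_replaceQubit (q : Q) (U V τ : Op1) (σ : Op Q) :
    onQubit q U * replaceQubit q τ σ * onQubit q V = replaceQubit q (U * τ * V) σ := by
  ext s t
  rw [onQubit_mul_mul_apply]
  simp only [replaceQubit, Matrix.of_apply, update_idem, update_self,
    Matrix.mul_apply, Fin.sum_univ_two]
  ring

lemma Clean.onQubit_conj {S : Set Q} {σ : Op Q} (h : Clean S σ) {q : Q} (hq : q ∉ S) (U V : Op1) :
    Clean S (onQubit q U * σ * onQubit q V) := by
  rintro s t ⟨w, hw, hst⟩
  have hwq : w ≠ q := fun e => hq (e ▸ hw)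
  rw [onQubit_mul_mul_apply]
  refine Finset.sum_eq_zero fun b _ => Finset.sum_eq_zero fun c _ => ?_
  rw [h (update s q b) (update t q c) ⟨w, hw, by simpa [hwq] using hst⟩, mul_zero, zero_mul]

lemma put_pair {m : Fin 2 → Q} (hm : Injective m) (A : Fin 2 → Op1) {σ : Op Q}
    (hσ : Clean (Set.range m) σ) :
    put m (tensorOp A) σ =
      replaceQubit (m 0) (A 0) (replaceQubit (m 1) (A 1) σ) := by
  conv_rhs => rw [← put_zeroState hσ, put_replaceQubit hm, put_replaceQubit hm,
    zeroState_eq_tensorOp, replaceQubit_tensorOp (fun _ => basisProj 0) _ _ (basisProj_trace 0),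
    replaceQubit_tensorOp _ _ _ (by rw [update_of_ne (by decide), basisProj_trace])]
  congr 2
  ext1 i
  match i with
  | 0 => simp
  | 1 => simp

/-- Use two prepared qubits to rotate the qubit `d` by a random sign of the angle. Continue with
`X₀` or `X₁` according to the sign, and with `R` if the qubit was not rotated. -/
def consumePair (m : Fin 2 → Q) (d : Q) (X₀ X₁ R : Protocol Q) : Protocol Q :=
  cnotStep (m 0) (m 1) <| .measure (m 1)
    (.hadamard (m 0) <| cnotStep d (m 0) <|
      .measure (m 0) (.prepZero (m 0) X₀) (.prepZero (m 0) X₁))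
    (resetList ([0, 1].map m) R)

lemma numOps_consumePair (m : Fin 2 → Q) (d : Q) (X₀ X₁ R : Protocol Q) :
    (consumePair m d X₀ X₁ R).numOps ≤ 6 + max (max X₀.numOps X₁.numOps) R.numOps := by
  refine (numOps_cnotStep _ _ _).trans ?_
  have h1 := numOps_cnotStep d (m 0) (.measure (m 0) (.prepZero (m 0) X₀) (.prepZero (m 0) X₁))
  have h2 := numOps_resetList ([0, 1].map m) R
  simp only [List.length_map, List.length_cons, List.length_nil] at h2
  simp only [Protocol.numOps] at h1 ⊢
  omega

/-- The outcome `0` rotates with sign `-` and the outcome `1` with sign `+`; both scalars have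
modulus `1 / √2`, so the signs are equally likely. -/
lemma rotAmplitude_zero : (diagonal fun x => rotAmplitude (0 + x)) =
    (1 / √2 : ℂ) • rotGate false := by
  rw [rotGate_eq_diagonal, ← diagonal_smul]
  congr 1
  ext i
  fin_cases i <;> (simp [rotAmplitude]; try ring)

lemma rotAmplitude_one : (diagonal fun x => rotAmplitude (1 + x)) =
    (conj zeta12 / √2 : ℂ) • rotGate true := by
  have h := zeta12_mul_conj
  rw [rotGate_eq_diagonal, ← diagonal_smul]
  congr 1
  ext i
  fin_cases i
  · simp [rotAmplitude]
  · have : (1 + 1 : Fin 2) = 0 := rfl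
    simp [rotAmplitude, this]
    linear_combination (-(√2 : ℂ)⁻¹) * h

lemma onQubit_smul_conj (q : Q) (c : ℂ) (A : Op1) (σ : Op Q) :
    onQubit q (c • A) * σ * (onQubit q (c • A))ᴴ =
      (c * conj c) • (onQubit q A * σ * (onQubit q A)ᴴ) := by
  rw [onQubit_smul, conjTranspose_smul, Matrix.smul_mul, Matrix.smul_mul, Matrix.mul_smul, smul_smul]
  rfl

lemma run_teleport {d m : Q} (h : d ≠ m) {σ : Op Q} (hσ : Clean {m} σ) (ρ : ℕ → Op1)
    (X₀ X₁ : Protocol Q) (k : ℕ) :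
    (cnotStep d m (.measure m (.prepZero m X₀) (.prepZero m X₁))).run ρ k
      (replaceQubit m (vecMulVec rotAmplitude (star rotAmplitude)) σ) =
    (1 / 2 : ℂ) • X₀.run ρ k (onQubit d (rotGate false) * σ * (onQubit d (rotGate false))ᴴ) +
    (1 / 2 : ℂ) • X₁.run ρ k (onQubit d (rotGate true) * σ * (onQubit d (rotGate true))ᴴ) := by
  have h2 : (√2 : ℂ)⁻¹ * (√2 : ℂ)⁻¹ = 1 / 2 := by
    have := sqrt_two_inv_mul_self
    rw [one_div, Complex.ofReal_inv] at this
    exact this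
  have hz := zeta12_mul_conj
  rw [cnotStep_of_ne h]
  change X₀.run ρ k (replaceQubit m (basisProj 0) _) + X₁.run ρ k (replaceQubit m (basisProj 0) _) = _
  rw [teleport h _ hσ, teleport h _ hσ, rotAmplitude_zero, rotAmplitude_one, onQubit_smul_conj,
    onQubit_smul_conj, run_smul, run_smul]
  congr 2
  · simp only [map_div₀, map_one, Complex.conj_ofReal]
    linear_combination h2
  · simp only [map_div₀, Complex.conj_conj, Complex.conj_ofReal]
    linear_combination (√2 : ℂ)⁻¹ ^ 2 * hz + h2

/-- Even parity has probability `2/3`, which the two teleportation outcomes share equally; odd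
parity leaves the data untouched. This gives three branches of weight `1/3`. -/
lemma run_consumePair {m : Fin 2 → Q} (hm : Injective m) {d : Q} (hd : ∀ i, m i ≠ d) {σ : Op Q}
    (hσ : Clean (Set.range m) σ) (ρ : ℕ → Op1) (X₀ X₁ R : Protocol Q) (k : ℕ) :
    (consumePair m d X₀ X₁ R).run ρ k
      (replaceQubit (m 0) (tState 1) (replaceQubit (m 1) (tState 1) σ)) =
    ((1 / 3 : ℝ) : ℂ) • X₀.run ρ k (onQubit d (rotGate false) * σ * (onQubit d (rotGate false))ᴴ) +
    ((1 / 3 : ℝ) : ℂ) • X₁.run ρ k (onQubit d (rotGate true) * σ * (onQubit d (rotGate true))ᴴ) +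
    ((1 / 3 : ℝ) : ℂ) • R.run ρ k σ := by
  have h01 : (0 : Fin 2) ≠ 1 := by decide
  have ht1 : (tState 1 : Op1).trace = 1 := (tState_traces 1).1
  have hz : ∀ τ : Op1, put m (replaceQubit 0 τ (zeroState (Fin 2))) σ = replaceQubit (m 0) τ σ :=
    fun τ => by rw [← put_replaceQubit hm, put_zeroState hσ]
  have hH : onQubit (0 : Fin 2) hadamardGate *
      tensorOp (update (fun _ => basisProj 0) 0 (tState 1 ⊙ tState 1)) *
      (onQubit (0 : Fin 2) hadamardGate)ᴴ =
      (2 / 3 : ℂ) • replaceQubit 0 (vecMulVec rotAmplitude (star rotAmplitude))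
        (zeroState (Fin 2)) := by
    rw [← replaceQubit_tensorOp (fun _ => basisProj 0) _ _ (basisProj_trace 0), ← zeroState_eq_tensorOp,
      onQubit_conjTranspose, onQubit_conj_replaceQubit, hadamard_tState_one, replaceQubit_smul_left]
  have htr : (onQubit (1 : Fin 2) (basisProj 1) * (cnotGate 0 1 * tensorOp (fun _ => tState 1) *
      (cnotGate 0 1)ᴴ) * onQubit (1 : Fin 2) (basisProj 1)).trace = 1 / 3 := by
    have h := trace_measure (1 : Fin 2) (cnotGate 0 1 * tensorOp (fun _ => tState 1) *
      (cnotGate 0 1)ᴴ)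
    rw [trace_unitary_conj (cnot_unitary h01), tensorOp_trace, Finset.prod_eq_one fun _ _ => ht1,
      parity_tensorOp, tensorOp_trace, Fin.prod_univ_two, update_self, update_of_ne h01.symm,
      basisProj_trace, mul_one] at h
    have h2 : (tState 1 ⊙ tState 1).trace = 2 / 3 := by
      have := congrArg Matrix.trace hadamard_tState_one
      rw [trace_unitary_conj (by rw [hadamardGate_conjTranspose, hadamardGate_mul_self]),
        Matrix.trace_smul, Matrix.trace_vecMulVec] at this
      rw [this]
      have h2 := sqrt_two_inv_mul_self
      rw [one_div, Complex.ofReal_inv] at h2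
      have hz := zeta12_mul_conj
      simp only [dotProduct, Fin.sum_univ_two, rotAmplitude, Pi.star_apply, smul_eq_mul]
      simp
      linear_combination (√2 : ℂ)⁻¹ ^ 2 * hz + 2 * h2
    rw [h2] at h
    linear_combination h
  rw [consumePair, ← put_pair hm (fun _ => tState 1) hσ, run_cnotStep_put hm h01,
    run_measure_put hm, parity_tensorOp, run_resetList_put hm (by decide) ρ R k _ hσ, htr,
    run_hadamard_put hm, hH, put_smul, hz, run_smul,
    run_teleport (hd 0).symm (hσ.mono (by rintro _ rfl; exact ⟨0, rfl⟩))]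
  rw [smul_add, smul_smul, smul_smul]
  norm_num

end Consume

end MagicDistill

/-! ### Repeating the rotation with noisy states. -/

namespace MagicDistill

set_option linter.unusedSectionVars false

open Matrix Function ComplexConjugate

section Rotation

variable {Q : Type} [Fintype Q] [DecidableEq Q]

/-- Functionals that take values between zero and the trace on positive semidefinite operators. -/
def IsEffectFunctional (φ : Op Q →ₗ[ℝ] ℝ) : Prop :=
  ∀ τ : Op Q, τ.PosSemidef → 0 ≤ φ τ ∧ φ τ ≤ τ.trace.re

lemma IsEffectFunctional.run_mem {φ : Op Q →ₗ[ℝ] ℝ} (hφ : IsEffectFunctional φ) {ρ : ℕ → Op1}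
    (hρ : ∀ i, IsDensity (ρ i)) (P : Protocol Q) (k : ℕ) {σ : Op Q} (hσ : IsDensity σ) :
    φ (P.run ρ k σ) ∈ Set.Icc (0 : ℝ) 1 := by
  have h := hφ _ (run_posSemidef (fun i => (hρ i).1) P k hσ.1)
  rwa [run_trace (fun i => (hρ i).2), hσ.2, Complex.one_re] at h

lemma IsDensity.conj {ι : Type} [Fintype ι] [DecidableEq ι] {σ U : Matrix ι ι ℂ} (hσ : IsDensity σ)
    (hU : Uᴴ * U = 1) : IsDensity (U * σ * Uᴴ) :=
  ⟨hσ.1.mul_mul_conjTranspose_same U, (trace_unitary_conj hU σ).trans hσ.2⟩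

lemma IsDensity.replaceQubit {q : Q} {τ : Op1} {σ : Op Q} (hτ : IsDensity τ) (hσ : IsDensity σ) :
    IsDensity (replaceQubit q τ σ) :=
  ⟨replaceQubit_posSemidef hτ.1 hσ.1, by rw [replaceQubit_trace, hτ.2, hσ.2, one_mul]⟩

lemma tState_eq_mix (f : ℝ) : tState f =
    (((1 + f) / 2 : ℝ) : ℂ) • tState 1 + (((1 - f) / 2 : ℝ) : ℂ) • tState (-1) := by
  ext i j
  simp only [Matrix.add_apply, Matrix.smul_apply, tState_apply, smul_eq_mul]
  fin_cases i <;> fin_cases j <;> simp <;> ring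

lemma tState_mul_self {f : ℝ} (hf : f ^ 2 = 1) : (tState f)ᴴ * tState f = tState f := by
  have h3 : ((f / √3 : ℝ) : ℂ) ^ 2 = 1 / 3 := by
    rw [← Complex.ofReal_pow, div_pow, hf, Real.sq_sqrt (by norm_num)]; norm_num
  have hI := Complex.I_sq
  ext i j
  simp only [Matrix.mul_apply, conjTranspose_apply, tState_apply, Fin.sum_univ_two]
  generalize hg : ((f / √3 : ℝ) : ℂ) = g at h3
  have hgc : conj g = g := by rw [← hg, Complex.conj_ofReal]
  fin_cases i <;> fin_cases j <;> simp [hgc]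
  · linear_combination (3 / 4 : ℂ) * h3 - g ^ 2 / 4 * hI
  · ring
  · ring
  · linear_combination (3 / 4 : ℂ) * h3 - g ^ 2 / 4 * hI

lemma isDensity_tState {f : ℝ} (hf : -1 ≤ f) (hf' : f ≤ 1) : IsDensity (tState f) := by
  have h : ∀ g : ℝ, g ^ 2 = 1 → (tState g).PosSemidef := fun g hg => by
    rw [← tState_mul_self hg]
    exact Matrix.posSemidef_conjTranspose_mul_self _
  refine ⟨?_, (tState_traces f).1⟩
  rw [tState_eq_mix]
  exact ((h 1 (by norm_num)).smul (by exact_mod_cast (by linarith : 0 ≤ (1 + f) / 2))).add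
    ((h (-1) (by norm_num)).smul (by exact_mod_cast (by linarith : 0 ≤ (1 - f) / 2)))

/-- A protocol on two noisy copies of a state is nearly as good as on two perfect copies. -/
lemma run_noisy_pair_le {φ : Op Q →ₗ[ℝ] ℝ} (hφ : IsEffectFunctional φ) {ρ : ℕ → Op1}
    (hρ : ∀ i, IsDensity (ρ i)) {P : Protocol Q} {k : ℕ} {σ : Op Q} (hσ : IsDensity σ) (q r : Q)
    {c η f g : ℝ} (hc : φ (P.run ρ k (replaceQubit q (tState 1) (replaceQubit r (tState 1) σ))) ≤ c)
    (hf : 1 - η ≤ f) (hf' : f ≤ 1) (hg : 1 - η ≤ g) (hg' : g ≤ 1) (hη : η ≤ 1) :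
    φ (P.run ρ k (replaceQubit q (tState f) (replaceQubit r (tState g) σ))) ≤ c + η := by
  -- `V` is affine in each argument with values in `[0, 1]`; expanding around the perfect states,
  -- each defective component has weight at most `η / 2`.
  set V : ℝ → ℝ → ℝ := fun f g =>
    φ (P.run ρ k (replaceQubit q (tState f) (replaceQubit r (tState g) σ))) with hV
  have hmem : ∀ f g, -1 ≤ f → f ≤ 1 → -1 ≤ g → g ≤ 1 → V f g ∈ Set.Icc (0 : ℝ) 1 :=
    fun f g h1 h2 h3 h4 => hφ.run_mem hρ P k
      ((isDensity_tState h1 h2).replaceQubit ((isDensity_tState h3 h4).replaceQubit hσ))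
  have e1 : ∀ f g, V f g = (1 + f) / 2 * V 1 g + (1 - f) / 2 * V (-1) g := by
    intro f g
    simp only [hV]
    conv_lhs => rw [tState_eq_mix f]
    rw [replaceQubit_add_left, replaceQubit_smul_left, replaceQubit_smul_left, run_add, run_smul,
      run_smul, map_add, Complex.coe_smul, Complex.coe_smul, map_smul, map_smul]
    rfl
  have e2 : ∀ f g, V f g = (1 + g) / 2 * V f 1 + (1 - g) / 2 * V f (-1) := by
    intro f g
    simp only [hV]
    conv_lhs => rw [tState_eq_mix g]
    rw [replaceQubit_add_left, replaceQubit_smul_left, replaceQubit_smul_left, replaceQubit_add,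
      replaceQubit_smul, replaceQubit_smul, run_add, run_smul,
      run_smul, map_add, Complex.coe_smul, Complex.coe_smul, map_smul, map_smul]
    rfl
  change V f g ≤ _
  have m1 := (hmem (-1) g (by norm_num) (by norm_num) (by linarith) hg').2
  have m2 := (hmem 1 (-1) (by norm_num) (by norm_num) (by norm_num) (by norm_num)).2
  have m3 := (hmem 1 1 (by norm_num) (by norm_num) (by norm_num) (by norm_num)).1
  have hc' : V 1 1 ≤ c := hc
  rw [e1 f g, e2 1 g]
  have h1 : (1 - f) / 2 * V (-1) g ≤ (1 - f) / 2 := mul_le_of_le_one_right (by linarith) m1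
  have h2 : (1 - g) / 2 * V 1 (-1) ≤ (1 - g) / 2 := mul_le_of_le_one_right (by linarith) m2
  have h3 : (1 + g) / 2 * V 1 1 ≤ c := by nlinarith
  have h4 : 0 ≤ (1 - g) / 2 * V 1 (-1) := mul_nonneg (by linarith)
    (hmem 1 (-1) (by norm_num) (by norm_num) (by norm_num) (by norm_num)).1
  have h5 : 0 ≤ (1 + g) / 2 * V 1 1 := mul_nonneg (by linarith) m3
  nlinarith

/-- The Clifford correction as a protocol. -/
def phaseStep (s : Bool) (d : Q) (P : Protocol Q) : Protocol Q :=
  bif s then .phase d P else .phase d (.phase d (.phase d P))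

lemma numOps_phaseStep (s : Bool) (d : Q) (P : Protocol Q) :
    (phaseStep s d P).numOps ≤ P.numOps + 3 := by
  cases s <;> simp [phaseStep, Protocol.numOps]

lemma run_phaseStep (s : Bool) (d : Q) (ρ : ℕ → Op1) (P : Protocol Q) (k : ℕ) (σ : Op Q) :
    (phaseStep s d P).run ρ k σ = P.run ρ k (onQubit d (phaseCorrection s) * σ *
      (onQubit d (phaseCorrection s))ᴴ) := by
  cases s
  · simp only [phaseStep, phaseCorrection, cond_false, ← onQubit_mul, conjTranspose_mul,
      Protocol.run, Matrix.mul_assoc]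
  · rfl

/-- Rotate the qubit `d` by the angle with sign `s`, in at most `M` attempts. -/
def rotate (T : Q → Protocol Q → Protocol Q → Protocol Q) (m : Fin 2 → Q) (d : Q) (P : Protocol Q) :
    ℕ → Bool → Protocol Q
  -- When the attempts are used up the rotation is omitted, an error that occurs with probability at
  -- most `(11/12) ^ M`.
  | 0, _ => P
  | M + 1, s =>
    let R := rotate T m d P M s
    -- Continuation for the wrong sign: by `rotGate_correct` the rotation still missing has the sign
    -- opposite to `s`.
    let C := phaseStep s d (rotate T m d P M !s)
    prepareList T m (consumePair m d (bif s then C else P) (bif s then P else C) R)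
      (resetList ([0, 1].map m) R) [0, 1]

lemma numOps_rotate {T : Q → Protocol Q → Protocol Q → Protocol Q} {N : ℕ}
    (hT : ∀ q S R, (T q S R).numOps ≤ N + max S.numOps R.numOps) (m : Fin 2 → Q) (d : Q)
    (P : Protocol Q) (M : ℕ) (s : Bool) :
    (rotate T m d P M s).numOps ≤ (2 * N + 9) * M + P.numOps := by
  induction M generalizing s with
  | zero => simp [rotate]
  | succ M ih =>
    set R := rotate T m d P M s
    set C := phaseStep s d (rotate T m d P M !s)
    have hR : R.numOps ≤ (2 * N + 9) * M + P.numOps := ih s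
    have hC : C.numOps ≤ (2 * N + 9) * M + P.numOps + 3 :=
      (numOps_phaseStep _ _ _).trans (Nat.add_le_add_right (ih _) 3)
    change (prepareList T m (consumePair m d (bif s then C else P) (bif s then P else C) R)
      (resetList ([0, 1].map m) R) [0, 1]).numOps ≤ _
    have h1 := numOps_prepareList hT m (consumePair m d (bif s then C else P)
      (bif s then P else C) R) (resetList ([0, 1].map m) R) [0, 1]
    have h2 := numOps_consumePair m d (bif s then C else P) (bif s then P else C) R
    have h3 := numOps_resetList ([0, 1].map m) R
    simp only [List.length_map, List.length_cons, List.length_nil] at h1 h3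
    rw [Nat.mul_succ]
    generalize (2 * N + 9) * M = X at *
    cases s <;> simp only [cond_true, cond_false] at h1 h2 ⊢ <;> omega

/-- Both preparations succeed with probability at least `1/4`, and then the sign is right with
probability `1/3`, at a noise cost `η`. The bound `b` thus evolves by `b ↦ a / 12 + 11 b / 12 + η /
4`, whose fixed point is `a + 3 η`. -/
lemma run_rotate_le {ρ : ℕ → Op1} (hρ : ∀ i, IsDensity (ρ i))
    {T : Q → Protocol Q → Protocol Q → Protocol Q} {m : Fin 2 → Q} (hm : Injective m) {d : Q}
    {W : Set Q} (hd : d ∉ Set.range m ∪ W) (hW : Disjoint W (Set.range m)) {η : ℝ} (hη : 0 ≤ η)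
    (hη' : η ≤ 1) (hT : ∀ i, Prepares ρ (T (m i)) (m i) W (1 - η)) {φ : Op Q →ₗ[ℝ] ℝ}
    (hφ : IsEffectFunctional φ) (P : Protocol Q) {a : ℝ} (ha : 0 ≤ a) (M : ℕ) (s : Bool)
    {σ : Op Q} (hσ : IsDensity σ) (hc : Clean (Set.range m ∪ W) σ)
    (hP : ∀ k, φ (P.run ρ k (onQubit d (rotGate s) * σ * (onQubit d (rotGate s))ᴴ)) ≤ a) (k : ℕ) :
    φ ((rotate T m d P M s).run ρ k σ) ≤ a + 3 * η + (11 / 12) ^ M := by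
  induction M generalizing s σ k with
  | zero =>
    have := (hφ.run_mem hρ P k hσ).2
    simp only [rotate, pow_zero]
    linarith
  | succ M ih =>
    have hc' := hc.mono (Set.subset_union_left (t := W))
    set R := rotate T m d P M s
    set C := phaseStep s d (rotate T m d P M !s)
    set b := a + 3 * η + (11 / 12) ^ M with hb
    have hM : (0 : ℝ) < (11 / 12) ^ M := by positivity
    have hR : ∀ k, φ (R.run ρ k σ) ≤ b := fun k => ih s hσ hc hP k
    have hU : ∀ s, (onQubit d (rotGate s))ᴴ * onQubit d (rotGate s) = 1 := fun s =>
      onQubit_unitary d (rotGate_unitary s)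
    have hV : (onQubit d (phaseCorrection s))ᴴ * onQubit d (phaseCorrection s) = 1 :=
      onQubit_unitary d (phaseCorrection_unitary s)
    have hC : ∀ k, φ (C.run ρ k (onQubit d (rotGate !s) * σ * (onQubit d (rotGate !s))ᴴ)) ≤ b := by
      intro k
      rw [run_phaseStep]
      refine ih (!s) ((hσ.conj (hU _)).conj hV) ?_ ?_ k
      · simp only [onQubit_conjTranspose]
        exact (hc.onQubit_conj hd _ _).onQubit_conj hd _ _
      · intro k
        have : onQubit d (rotGate !s) * (onQubit d (phaseCorrection s) * (onQubit d (rotGate !s) * σ *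
            (onQubit d (rotGate !s))ᴴ) * (onQubit d (phaseCorrection s))ᴴ) *
            (onQubit d (rotGate !s))ᴴ = onQubit d (rotGate s) * σ * (onQubit d (rotGate s))ᴴ := by
          rw [← rotGate_correct s, ← onQubit_mul, ← onQubit_mul]
          simp only [conjTranspose_mul, Matrix.mul_assoc]
        rw [this]
        exact hP k
    have hmain : ∀ k, φ ((consumePair m d (bif s then C else P) (bif s then P else C) R).run ρ k
        (replaceQubit (m 0) (tState 1) (replaceQubit (m 1) (tState 1) σ))) ≤
        1 / 3 * a + 2 / 3 * b := by
      intro k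
      rw [run_consumePair hm (fun i h => hd (Or.inl ⟨i, h⟩)) hc', map_add, map_add, Complex.coe_smul,
        Complex.coe_smul, Complex.coe_smul, map_smul, map_smul, map_smul, smul_eq_mul, smul_eq_mul,
        smul_eq_mul]
      have h1 := hP k
      have h2 := hC k
      have h3 := hR k
      cases s <;> simp only [cond_true, cond_false, Bool.not_true, Bool.not_false] at h1 h2 ⊢ <;>
        linarith
    have := run_prepareList_le hm hT hW (l := [0, 1]) (by decide) (by decide) hc φ
      (S := consumePair m d (bif s then C else P) (bif s then P else C) R)
      (R := resetList ([0, 1].map m) R)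
      (a := 1 / 3 * a + 2 / 3 * b + η) (b := b) (by linarith) ?_ ?_ k
    · refine this.trans ?_
      simp only [List.length_cons, List.length_nil, pow_succ]
      linarith
    · intro k f hf
      rw [put_pair hm _ hc']
      exact run_noisy_pair_le hφ hρ hσ _ _ (hmain k) (hf 0).1 (hf 0).2 (hf 1).1 (hf 1).2 hη'
    · intro k τ hτ
      rw [run_resetList_put hm (by decide) ρ R k τ hc', hτ, one_smul]
      exact hR k

end Rotation

end MagicDistill

/-! ### Effects, trace distance and work qubits. -/

namespace MagicDistill

set_option linter.unusedSectionVars false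

open Matrix Function ComplexConjugate

section Effects

variable {ι : Type} [Fintype ι] [DecidableEq ι]

open scoped MatrixOrder Matrix.Norms.L2Operator in
lemma posSemidef_trace_mul_nonneg {A B : Matrix ι ι ℂ} (hA : A.PosSemidef) (hB : B.PosSemidef) :
    0 ≤ (A * B).trace := by
  obtain ⟨C, rfl⟩ := CStarAlgebra.nonneg_iff_eq_star_mul_self.mp hA.nonneg
  rw [Matrix.mul_assoc, Matrix.trace_mul_comm]
  exact (hB.mul_mul_conjTranspose_same C).trace_nonneg

/-- A one-sided bound suffices, because the complementary effect `1 - E` supplies the other side;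
the traces are real by positivity. -/
lemma traceClose_of_forall_re_le {δ : ℝ} {σ τ : Matrix ι ι ℂ} (hσ : IsDensity σ) (hτ : IsDensity τ)
    (h : ∀ E, IsEffect E → (E * σ).trace.re ≤ (E * τ).trace.re + δ) : TraceClose δ σ τ := by
  intro E hE
  have h1 := h E hE
  have h2 := h (1 - E) ⟨hE.2, by rw [sub_sub_cancel]; exact hE.1⟩
  have e1 := posSemidef_trace_mul_nonneg hE.1 hσ.1
  have e2 := posSemidef_trace_mul_nonneg hE.1 hτ.1
  rw [Complex.nonneg_iff] at e1 e2
  have e3 : (E * σ).trace - (E * τ).trace =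
      (((E * σ).trace.re - (E * τ).trace.re : ℝ) : ℂ) := by
    apply Complex.ext
    · simp
    · simp [← e1.2, ← e2.2]
  rw [e3, Complex.norm_real, Real.norm_eq_abs, abs_le]
  rw [Matrix.sub_mul, Matrix.sub_mul, Matrix.trace_sub, Matrix.trace_sub, Matrix.one_mul,
    Matrix.one_mul, hσ.2, hτ.2, Complex.sub_re, Complex.sub_re] at h2
  constructor <;> linarith

end Effects

section Work

variable {n a : ℕ}

lemma discardWork_withWork (σ : Op (Fin n)) : discardWork (withWork a σ) = σ := by
  ext s t
  simp only [discardWork, withWork, Matrix.of_apply, Sum.elim_inr, Sum.elim_inl, and_self]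
  rw [Finset.sum_eq_single 0]
  · simp
  · intro r _ hr
    exact if_neg fun h => hr (funext h)
  · simp

lemma discardWork_trace (τ : Op (Fin n ⊕ Fin a)) : (discardWork τ).trace = τ.trace := by
  simp only [Matrix.trace, Matrix.diag, discardWork, Matrix.of_apply]
  rw [← Fintype.sum_prod_type']
  exact Fintype.sum_equiv (Equiv.sumArrowEquivProdArrow _ _ _).symm _ _ fun _ => rfl

lemma discardWork_posSemidef {τ : Op (Fin n ⊕ Fin a)} (h : τ.PosSemidef) :
    (discardWork τ).PosSemidef := by
  have : discardWork τ = ∑ r : Fin a → Fin 2, τ.submatrix (fun s => Sum.elim s r)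
      (fun s => Sum.elim s r) := by
    ext s t
    simp [discardWork, Matrix.sum_apply]
  rw [this]
  exact Matrix.posSemidef_sum _ fun r _ => h.submatrix _

lemma IsDensity.withWork {σ : Op (Fin n)} (h : IsDensity σ) : IsDensity (withWork a σ) := by
  refine ⟨?_, by rw [← discardWork_trace, discardWork_withWork, h.2]⟩
  set v : ((Fin n ⊕ Fin a) → Fin 2) → ℂ := fun s => if ∀ j, s (Sum.inr j) = 0 then 1 else 0 with hv
  have : MagicDistill.withWork a σ = diagonal v *
      σ.submatrix (fun s i => s (Sum.inl i)) (fun s i => s (Sum.inl i)) * (diagonal v)ᴴ := by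
    ext s t
    rw [diagonal_conjTranspose, mul_diagonal, diagonal_mul]
    simp only [MagicDistill.withWork, Matrix.of_apply, hv, Pi.star_apply, Matrix.submatrix_apply]
    by_cases h1 : ∀ j, s (Sum.inr j) = 0 <;> by_cases h2 : ∀ j, t (Sum.inr j) = 0 <;> simp [h1, h2]
  rw [this]
  exact (h.1.submatrix _).mul_mul_conjTranspose_same _

lemma clean_withWork (σ : Op (Fin n)) {S : Set (Fin n ⊕ Fin a)} (hS : ∀ i, Sum.inl i ∉ S) :
    Clean S (withWork a σ) := by
  rintro s t ⟨w, hw, hst⟩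
  rcases w with i | j
  · exact (hS i hw).elim
  · rw [withWork, Matrix.of_apply, if_neg]
    rintro ⟨h1, h2⟩
    rcases hst with h | h
    · exact h (h1 j)
    · exact h (h2 j)

lemma withWork_onQubit (q : Fin n) (A B : Op1) (σ : Op (Fin n)) :
    onQubit (Sum.inl q) A * withWork a σ * onQubit (Sum.inl q) B =
      withWork a (onQubit q A * σ * onQubit q B) := by
  have h : ∀ (s : Fin n ⊕ Fin a → Fin 2) b, (fun i => update s (Sum.inl q) b (Sum.inl i)) =
      update (fun i => s (Sum.inl i)) q b := fun s b => by
    ext1 i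
    by_cases hi : i = q
    · subst hi; simp
    · simp [hi]
  ext s t
  rw [onQubit_mul_mul_apply]
  simp only [withWork, Matrix.of_apply, h, ne_eq, reduceCtorEq, not_false_eq_true, update_of_ne,
    onQubit_mul_mul_apply]
  split_ifs <;> simp

lemma withWork_cnot {c t : Fin n} (h : c ≠ t) (σ : Op (Fin n)) :
    cnotGate (Sum.inl c) (Sum.inl t) * withWork a σ * (cnotGate (Sum.inl c) (Sum.inl t))ᴴ =
      withWork a (cnotGate c t * σ * (cnotGate c t)ᴴ) := by
  have hf : ∀ s : Fin n ⊕ Fin a → Fin 2, (fun i => flip (Sum.inl c) (Sum.inl t) s (Sum.inl i)) =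
      flip c t (fun i => s (Sum.inl i)) := fun s => by
    ext1 i
    by_cases hi : i = t
    · subst hi; simp [flip]
    · simp [flip, hi]
  ext s u
  rw [cnot_conj_apply (by simpa using h)]
  simp only [withWork, Matrix.of_apply, hf, cnot_conj_apply h]
  simp [flip]

/-- The probability of the effect `E` after the work qubits have been discarded. -/
noncomputable def effectFunctional (a : ℕ) (E : Op (Fin n)) : Op (Fin n ⊕ Fin a) →ₗ[ℝ] ℝ where
  toFun τ := (E * discardWork τ).trace.re
  map_add' σ τ := by
    have : discardWork (σ + τ) = discardWork σ + discardWork τ := by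
      ext s t; simp [discardWork, Finset.sum_add_distrib]
    rw [this, Matrix.mul_add, Matrix.trace_add, Complex.add_re]
  map_smul' c τ := by
    have : discardWork (c • τ) = c • discardWork τ := by
      ext s t; simp [discardWork, Finset.mul_sum]
    rw [this, Matrix.mul_smul, Matrix.trace_smul, Complex.real_smul, Complex.re_ofReal_mul]
    rfl

lemma isEffectFunctional {E : Op (Fin n)} (hE : IsEffect E) :
    IsEffectFunctional (effectFunctional a E) := by
  intro τ hτ
  have h := discardWork_posSemidef hτ
  have h1 := posSemidef_trace_mul_nonneg hE.1 h
  have h2 := posSemidef_trace_mul_nonneg hE.2 h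
  rw [Matrix.sub_mul, Matrix.one_mul, Matrix.trace_sub, discardWork_trace] at h2
  rw [Complex.nonneg_iff] at h1 h2
  rw [Complex.sub_re] at h2
  exact ⟨h1.1, sub_nonneg.mp h2.1⟩

end Work

end MagicDistill

/-! ### Simulation of circuits gate by gate. -/

namespace MagicDistill

set_option linter.unusedSectionVars false

open Matrix Function ComplexConjugate

/-- The Hadamard gate as an element of the unitary group. -/
noncomputable def hadamardUnitary : Matrix.unitaryGroup (Fin 2) ℂ :=
  ⟨hadamardGate, by
    rw [Matrix.mem_unitaryGroup_iff, star_eq_conjTranspose, hadamardGate_conjTranspose,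
      hadamardGate_mul_self]⟩

/-- The rotations by `± π / 6` as elements of the unitary group. -/
noncomputable def rotUnitary (s : Bool) : Matrix.unitaryGroup (Fin 2) ℂ :=
  ⟨rotGate s, by rw [Matrix.mem_unitaryGroup_iff']; exact rotGate_unitary s⟩

/-- The single-qubit gates of the circuits that are simulated. -/
noncomputable def simGates : Set (Matrix.unitaryGroup (Fin 2) ℂ) :=
  {hadamardUnitary, rotUnitary true, rotUnitary false}

lemma rotGate_conjTranspose (s : Bool) : (rotGate s)ᴴ = rotGate !s := by
  rw [rotGate_eq_diagonal, rotGate_eq_diagonal, diagonal_conjTranspose]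
  congr 1
  ext i
  cases s <;> fin_cases i <;> simp

lemma simGates_inv : ∀ A ∈ simGates, A⁻¹ ∈ simGates := by
  have h1 : hadamardUnitary⁻¹ = hadamardUnitary := Subtype.ext hadamardGate_conjTranspose
  have h2 : ∀ s, (rotUnitary s)⁻¹ = rotUnitary !s := fun s => Subtype.ext (rotGate_conjTranspose s)
  rintro A (rfl | rfl | rfl)
  · rw [h1]; simp [simGates]
  · rw [h2]; simp [simGates]
  · rw [h2]; simp [simGates]

lemma simGates_finite : simGates.Finite := by
  rw [simGates]
  exact Set.toFinite _

section Simulate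

variable {n a : ℕ}

open Classical in
/-- Simulate one gate. -/
noncomputable def simGate
    (T : Fin n ⊕ Fin a → Protocol (Fin n ⊕ Fin a) → Protocol (Fin n ⊕ Fin a) →
      Protocol (Fin n ⊕ Fin a))
    (m : Fin 2 → Fin n ⊕ Fin a) (M : ℕ) : Gate simGates (Fin n) → Protocol (Fin n ⊕ Fin a) →
      Protocol (Fin n ⊕ Fin a)
  | .single q A, P =>
    if A.1 = hadamardUnitary then .hadamard (Sum.inl q) P
    else rotate T m (Sum.inl q) P M (decide (A.1 = rotUnitary true))
  | .cnot c t h, P => .cnot (Sum.inl c) (Sum.inl t) (fun e => h (Sum.inl_injective e)) P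

lemma numOps_simGate
    {T : Fin n ⊕ Fin a → Protocol (Fin n ⊕ Fin a) → Protocol (Fin n ⊕ Fin a) →
      Protocol (Fin n ⊕ Fin a)} {N : ℕ}
    (hT : ∀ q S R, (T q S R).numOps ≤ N + max S.numOps R.numOps)
    (m : Fin 2 → Fin n ⊕ Fin a) (M : ℕ) (g : Gate simGates (Fin n))
    (P : Protocol (Fin n ⊕ Fin a)) :
    (simGate T m M g P).numOps ≤ (2 * N + 9) * M + 1 + P.numOps := by
  cases g with
  | single q A =>
    rw [simGate]
    split_ifs
    · simp only [Protocol.numOps]; omega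
    · exact (numOps_rotate hT m _ P M _).trans (by omega)
  | cnot c t h => simp only [simGate, Protocol.numOps]; omega

lemma simGate_unitary (g : Gate simGates (Fin n)) : g.opᴴ * g.op = 1 := by
  cases g with
  | single q A => exact onQubit_unitary q (Matrix.mem_unitaryGroup_iff'.mp A.1.2)
  | cnot c t h => exact cnot_unitary h

variable {ρ : ℕ → Op1} (hρ : ∀ i, IsDensity (ρ i))
  {T : Fin n ⊕ Fin a → Protocol (Fin n ⊕ Fin a) → Protocol (Fin n ⊕ Fin a) →
    Protocol (Fin n ⊕ Fin a)}
  {m : Fin 2 → Fin a} (hm : Injective m) {W : Set (Fin n ⊕ Fin a)}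
  (hW : Disjoint W (Set.range fun i => (Sum.inr (m i) : Fin n ⊕ Fin a)))
  (hW' : ∀ i, Sum.inl i ∉ W) {η : ℝ} (hη : 0 ≤ η) (hη' : η ≤ 1)
  (hT : ∀ i, Prepares ρ (T (Sum.inr (m i))) (Sum.inr (m i)) W (1 - η))
  {φ : Op (Fin n ⊕ Fin a) →ₗ[ℝ] ℝ} (hφ : IsEffectFunctional φ)

include hρ hm hW hW' hη hη' hT hφ

/-- Only rotations cost an error; Hadamard and CNOT gates are exact. -/
lemma run_simGate_le (M : ℕ) (g : Gate simGates (Fin n)) (P : Protocol (Fin n ⊕ Fin a)) {b : ℝ}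
    (hb : 0 ≤ b) {σ : Op (Fin n)} (hσ : IsDensity σ)
    (hP : ∀ k, φ (P.run ρ k (withWork a (g.op * σ * g.opᴴ))) ≤ b) (k : ℕ) :
    φ ((simGate T (fun i => Sum.inr (m i)) M g P).run ρ k (withWork a σ)) ≤
      b + (3 * η + (11 / 12) ^ M) := by
  have he : (0 : ℝ) ≤ 3 * η + (11 / 12) ^ M := by positivity
  have hmQ : Injective fun i => (Sum.inr (m i) : Fin n ⊕ Fin a) := Sum.inr_injective.comp hm
  have hcl : ∀ i, (Sum.inl i : Fin n ⊕ Fin a) ∉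
      (Set.range fun i => (Sum.inr (m i) : Fin n ⊕ Fin a)) ∪ W := by
    rintro i (⟨j, hj⟩ | h)
    · cases hj
    · exact hW' i h
  cases g with
  | single q A =>
    rw [simGate]
    split_ifs with hA
    · refine le_trans (le_of_eq ?_) ((hP k).trans (by linarith))
      simp only [Gate.op, hA, Protocol.run, onQubit_conjTranspose, withWork_onQubit]
      rfl
    · rw [← add_assoc]
      refine run_rotate_le hρ hmQ (hcl q) hW hη hη' hT hφ P hb M _ hσ.withWork
        (clean_withWork σ hcl) (fun k => ?_) k
      have : (A.1 : Matrix.unitaryGroup (Fin 2) ℂ).1 = rotGate (decide (A.1 = rotUnitary true)) := by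
        rcases A.2 with h | h | h
        · exact (hA h).elim
        · simp only [h, decide_true]; rfl
        · by_cases h' : A.1 = rotUnitary true
          · simp only [h', decide_true]; rfl
          · simp only [h', decide_false]; rw [h]; rfl
      have h2 := hP k
      simp only [Gate.op, this, onQubit_conjTranspose, ← withWork_onQubit] at h2
      rw [onQubit_conjTranspose]
      exact h2
  | cnot c t h =>
    refine le_trans (le_of_eq ?_) ((hP k).trans (by linarith))
    simp only [simGate, Gate.op, Protocol.run, withWork_cnot h]

omit hρ hm hW hW' hη hη' hT hφ

/-- Simulate a circuit. -/
noncomputable def simCircuit (T : Fin n ⊕ Fin a → Protocol (Fin n ⊕ Fin a) →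
      Protocol (Fin n ⊕ Fin a) → Protocol (Fin n ⊕ Fin a))
    (m : Fin 2 → Fin n ⊕ Fin a) (M : ℕ) (L : List (Gate simGates (Fin n))) :
    Protocol (Fin n ⊕ Fin a) :=
  L.foldr (simGate T m M) .done

lemma numOps_simCircuit {N : ℕ}
    (hT : ∀ q S R, (T q S R).numOps ≤ N + max S.numOps R.numOps)
    (m : Fin 2 → Fin n ⊕ Fin a) (M : ℕ) (L : List (Gate simGates (Fin n))) :
    (simCircuit T m M L).numOps ≤ ((2 * N + 9) * M + 1) * L.length := by
  induction L with
  | nil => simp [simCircuit, Protocol.numOps]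
  | cons g L ih =>
    refine (numOps_simGate hT m M g (simCircuit T m M L)).trans ?_
    rw [List.length_cons, Nat.mul_succ]
    omega

lemma circuitOp_unitary (L : List (Gate simGates (Fin n))) : (circuitOp L)ᴴ * circuitOp L = 1 := by
  induction L with
  | nil => simp [circuitOp]
  | cons g L ih =>
    rw [circuitOp, conjTranspose_mul, Matrix.mul_assoc, ← Matrix.mul_assoc _ (circuitOp L), ih,
      Matrix.one_mul, simGate_unitary]

include hρ hm hW hW' hη hη' hT

/-- The errors add up because the bound for one gate holds with the rest of the protocol as its
continuation. -/
lemma run_simCircuit_le (hφ : IsEffectFunctional φ) (M : ℕ) (L : List (Gate simGates (Fin n)))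
    {σ : Op (Fin n)} (hσ : IsDensity σ) (k : ℕ) :
    φ ((simCircuit T (fun i => Sum.inr (m i)) M L).run ρ k (withWork a σ)) ≤
      φ (withWork a (circuitOp L * σ * (circuitOp L)ᴴ)) +
        L.length * (3 * η + (11 / 12) ^ M) := by
  induction L generalizing σ k with
  | nil => simp [simCircuit, circuitOp, Protocol.run]
  | cons g L ih =>
    have hσ' := hσ.conj (simGate_unitary g)
    have h0 := (hφ _ ((hσ'.conj (circuitOp_unitary L)).withWork (a := a)).1).1
    refine (run_simGate_le hρ hm hW hW' hη hη' hT hφ M g _ (add_nonneg h0 (by positivity)) hσ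
      (fun k => ih hσ' k) k).trans (le_of_eq ?_)
    have : circuitOp L * (g.op * σ * g.opᴴ) * (circuitOp L)ᴴ =
        circuitOp (g :: L) * σ * (circuitOp (g :: L))ᴴ := by
      simp only [circuitOp, conjTranspose_mul, Matrix.mul_assoc]
    rw [this, List.length_cons]
    push_cast
    ring

lemma simulates_simCircuit (M : ℕ) (L : List (Gate simGates (Fin n))) {δ : ℝ}
    (hδ : L.length * (3 * η + (11 / 12) ^ M) ≤ δ) :
    Simulates (simCircuit T (fun i => Sum.inr (m i)) M L) ρ (circuitOp L) δ := by
  intro σ hσ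
  have hσ' := hσ.conj (circuitOp_unitary L)
  refine traceClose_of_forall_re_le ?_ hσ' fun E hE => ?_
  · refine ⟨discardWork_posSemidef
      (run_posSemidef (fun i => (hρ i).1) _ _ hσ.withWork.1), ?_⟩
    rw [discardWork_trace, run_trace fun i => (hρ i).2, hσ.withWork.2]
  · have := run_simCircuit_le hρ hm hW hW' hη hη' hT (isEffectFunctional (a := a) hE) M L hσ 0
    have h2 : effectFunctional a E (withWork a (circuitOp L * σ * (circuitOp L)ᴴ)) =
        (E * (circuitOp L * σ * (circuitOp L)ᴴ)).trace.re := by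
      change (E * discardWork _).trace.re = _
      rw [discardWork_withWork]
    rw [h2] at this
    exact this.trans (by linarith)

end Simulate

end MagicDistill

/-! ### Choice of the parameters and size of the protocol. -/

namespace MagicDistill

set_option linter.unusedSectionVars false

open Matrix Function ComplexConjugate

/-- The two work qubits that are consumed by a rotation. -/
def pairWork (J : ℕ) (i : Fin 2) : Fin (4 * J + 2) := ⟨i, by omega⟩

/-- The work qubits of the distillation rounds. -/
def blockWork (n J : ℕ) (j : ℕ) (x : Fin 4) : Fin n ⊕ Fin (4 * J + 2) :=
  -- Positions `0` and `1` belong to `pairWork`, and each round takes four more. The value for `j ≥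
  -- J` is a default that no protocol with `J` rounds touches.
  if h : j < J then Sum.inr ⟨2 + 4 * j + x, by omega⟩ else Sum.inr 0

lemma isDensity_of_isSupply {ε : ℝ} {ρ : ℕ → Op1} (h : IsSupply ε ρ) (i : ℕ) : IsDensity (ρ i) := by
  obtain ⟨f, hf⟩ := h
  exact (hf i).2.1

lemma distill_simulates {ε : ℝ} {ρ : ℕ → Op1} (hρ : IsSupply ε ρ) (hε : 0 < ε) {n : ℕ} (J M : ℕ)
    (L : List (Gate simGates (Fin n))) {δ η : ℝ}
    (hη : 1 - distillMap^[J] (min 1 (√(3 / 7) + ε)) ≤ η) (hη' : η ≤ 1)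
    (hδ : L.length * (3 * η + (11 / 12) ^ M) ≤ δ) :
    Simulates (simCircuit (distill (blockWork n J) J) (fun i => Sum.inr (pairWork J i)) M L) ρ
      (circuitOp L) δ := by
  have hF : min 1 (√(3 / 7) + ε) ∈ Set.Icc (0 : ℝ) 1 :=
    ⟨le_min zero_le_one (by positivity), min_le_left _ _⟩
  have hne : ∀ i < J, ∀ x i', blockWork n J i x ≠ Sum.inr (pairWork J i') := by
    intro i hi x i' h
    rw [blockWork, dif_pos hi, Sum.inr.injEq, pairWork, Fin.mk.injEq] at h
    omega
  have hm : Injective (pairWork J) := fun i i' h => by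
    rw [pairWork, pairWork, Fin.mk.injEq] at h
    exact Fin.ext h
  refine simulates_simCircuit (isDensity_of_isSupply hρ) hm
    (W := {r | ∃ i < J, ∃ x, blockWork n J i x = r}) ?_ ?_
    (by linarith [(iterate_distillMap_mem hF J).2] : 0 ≤ η) hη' ?_ M L hδ
  · rw [Set.disjoint_left]
    rintro r ⟨i, hi, x, hx⟩ ⟨i', hi'⟩
    exact hne i hi x i' (hx.trans hi'.symm)
  · rintro i ⟨j, hj, x, hx⟩
    rw [blockWork, dif_pos hj] at hx
    cases hx
  · intro i
    refine (prepares_distill (suppliesAbove_of_isSupply hρ) hF (J := J) ?_ J le_rfl _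
      fun j hj x => hne j hj x i).mono (by linarith)
    intro i hi i' hi' x x' h
    rw [blockWork, dif_pos hi, blockWork, dif_pos hi', Sum.inr.injEq, Fin.mk.injEq] at h
    have : (x : ℕ) = x' := by omega
    exact ⟨by omega, Fin.ext this⟩

lemma pow_eleven_twelfths_le {M : ℕ} {x : ℝ} (hM : 12 * x ≤ M) :
    (11 / 12 : ℝ) ^ M ≤ Real.exp (-x) := by
  have h : (11 / 12 : ℝ) ≤ Real.exp (-(1 / 12)) := by
    have := Real.one_sub_le_exp_neg (1 / 12)
    linarith
  calc (11 / 12 : ℝ) ^ M ≤ Real.exp (-(1 / 12)) ^ M := pow_le_pow_left₀ (by norm_num) h M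
    _ = Real.exp (-(M / 12)) := by rw [← Real.exp_nat_mul]; congr 1; ring
    _ ≤ Real.exp (-x) := Real.exp_le_exp.mpr (by linarith)

/-- Circuits over `simGates` are simulated with polylogarithmic overhead. -/
lemma exists_simulation {ε : ℝ} (hε : 0 < ε) : ∃ (C : ℝ) (c : ℕ),
    ∀ (n : ℕ) (L : List (Gate simGates (Fin n))) (δ : ℝ), 0 < δ → δ < 1 →
      ∃ (a : ℕ) (P : Protocol (Fin n ⊕ Fin a)),
        (P.numOps : ℝ) ≤ C * L.length * (1 + Real.log (L.length / δ)) ^ c ∧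
        ∀ ρ : ℕ → Op1, IsSupply ε ρ → Simulates P ρ (circuitOp L) δ := by
  obtain ⟨j₀, hj₀⟩ := exists_distill_error_le hε
  -- The constant is `156 = 12 * 13`, times the cost of the preliminary rounds and `4 ^ 15`; of the
  -- exponent `16`, distillation accounts for `15` and the attempts per rotation for `1`.
  refine ⟨156 * 2 ^ (15 * j₀) * 4 ^ 15, 16, fun n L δ hδ hδ1 => ?_⟩
  rcases Nat.eq_zero_or_pos L.length with h0 | hpos
  · obtain rfl := List.eq_nil_of_length_eq_zero h0
    refine ⟨0, .done, by simp [Protocol.numOps], fun ρ _ σ hσ E _ => ?_⟩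
    simp [Protocol.run, discardWork_withWork, circuitOp, hδ.le]
  set l : ℝ := (L.length : ℝ) with hl
  have hl1 : 1 ≤ l := Nat.one_le_cast.mpr hpos
  set ℓ := Real.log (l / δ) with hℓ
  have hlδ : 1 ≤ l / δ := by rw [le_div_iff₀ hδ]; linarith
  have hℓ0 : 0 ≤ ℓ := Real.log_nonneg hlδ
  have hexp : Real.exp (-ℓ) = δ / l := by
    rw [Real.exp_neg, Real.exp_log (by positivity), inv_div]
  -- `2 ^ i ≤ 2 (1 + ℓ) < 2 ^ (i + 1)`: the upper estimate makes `i + 1` further rounds accurate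
  -- enough, and the lower one bounds their cost by a power of `1 + ℓ`.
  obtain ⟨i, hi1, hi2⟩ := exists_nat_pow_near (x := 2 * (1 + ℓ)) (by linarith)
    (by norm_num : (1 : ℝ) < 2)
  have he := Real.exp_one_gt_d9
  -- As `e² > 6`, the term `3 η` takes at most half of the error `δ / l` allowed per gate; the
  -- omitted rotations, bounded in `hMe`, take the other half.
  have hη1 : Real.exp (-2 ^ (i + 1)) ≤ δ / l / 6 := by
    have h2 : Real.exp (-2 ^ (i + 1)) ≤ Real.exp (-ℓ) * (Real.exp 1 * Real.exp 1)⁻¹ := by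
      rw [← Real.exp_add, ← Real.exp_neg, ← Real.exp_add]
      exact Real.exp_le_exp.mpr (by linarith)
    have h6 : (Real.exp 1 * Real.exp 1)⁻¹ ≤ 6⁻¹ := inv_anti₀ (by norm_num) (by nlinarith)
    rw [hexp] at h2
    have := mul_le_mul_of_nonneg_left h6 (by positivity : 0 ≤ δ / l)
    linarith
  set M := ⌈12 * (ℓ + 1)⌉₊ with hM
  have hM1 : 12 * (ℓ + 1) ≤ M := Nat.le_ceil _
  have hM2 : (M : ℝ) ≤ 13 * (1 + ℓ) := by
    have := Nat.ceil_lt_add_one (by positivity : 0 ≤ 12 * (ℓ + 1))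
    linarith
  have hMe : (11 / 12 : ℝ) ^ M ≤ δ / l / 2 := by
    refine (pow_eleven_twelfths_le hM1).trans ?_
    rw [neg_add, Real.exp_add, hexp, Real.exp_neg]
    have h6 : (Real.exp 1)⁻¹ ≤ 2⁻¹ := inv_anti₀ (by norm_num) (by linarith)
    have := mul_le_mul_of_nonneg_left h6 (by positivity : 0 ≤ δ / l)
    linarith
  set J := j₀ + (i + 1) with hJ
  refine ⟨4 * J + 2, simCircuit (distill (blockWork n J) J) (fun i => Sum.inr (pairWork J i)) M L,
    ?_, fun ρ hρ => distill_simulates hρ hε J M L (hj₀ (i + 1)) ?_ ?_⟩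
  · have h1 := numOps_simCircuit (numOps_distill (blockWork n J) J)
      (fun i => Sum.inr (pairWork J i)) M L
    have h2 : ((simCircuit (distill (blockWork n J) J) (fun i => Sum.inr (pairWork J i)) M L).numOps
        : ℝ) ≤ ((2 * 2 ^ (15 * J) + 9) * M + 1) * l := by
      rw [hl]; exact_mod_cast h1
    refine h2.trans ?_
    have hN : (2 : ℝ) ^ (15 * J) ≤ 2 ^ (15 * j₀) * (4 * (1 + ℓ)) ^ 15 := by
      rw [hJ, mul_add, pow_add, mul_comm 15 (i + 1)]
      have h5 : (2 : ℝ) ^ (i + 1) ≤ 4 * (1 + ℓ) := by rw [pow_succ]; linarith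
      have h6 := pow_le_pow_left₀ (by positivity) h5 15
      rw [← pow_mul] at h6
      exact mul_le_mul_of_nonneg_left h6 (by positivity)
    have hN1 : (1 : ℝ) ≤ 2 ^ (15 * J) := one_le_pow₀ (by norm_num)
    have hM0 : (12 : ℝ) ≤ M := by linarith
    have hp : (0 : ℝ) ≤ 12 * (2 ^ (15 * j₀) * (4 * (1 + ℓ)) ^ 15) := by positivity
    have h3 : (2 * 2 ^ (15 * J) + 9) * (M : ℝ) + 1 ≤ 12 * 2 ^ (15 * J) * M := by nlinarith
    have h4 : 12 * 2 ^ (15 * J) * (M : ℝ) ≤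
        12 * (2 ^ (15 * j₀) * (4 * (1 + ℓ)) ^ 15) * (13 * (1 + ℓ)) :=
      mul_le_mul (by linarith) hM2 (by linarith) hp
    calc ((2 * 2 ^ (15 * J) + 9) * (M : ℝ) + 1) * l
        ≤ 12 * (2 ^ (15 * j₀) * (4 * (1 + ℓ)) ^ 15) * (13 * (1 + ℓ)) * l :=
          mul_le_mul_of_nonneg_right (h3.trans h4) (by linarith)
      _ = _ := by ring
  · exact Real.exp_le_one_iff.mpr (by have : (0 : ℝ) < 2 ^ (i + 1) := by positivity
                                      linarith)
  · have : 3 * Real.exp (-2 ^ (i + 1)) + (11 / 12 : ℝ) ^ M ≤ δ / l := by linarith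
    calc l * (3 * Real.exp (-2 ^ (i + 1)) + (11 / 12 : ℝ) ^ M) ≤ l * (δ / l) :=
          mul_le_mul_of_nonneg_left this (by linarith)
      _ = δ := by field_simp

end MagicDistill

/-! ### One-parameter groups in closed monoids of operators. -/

namespace MagicDistill

section OneParameter

open NormedSpace Filter Topology

variable {A : Type*} [CStarAlgebra A]

lemma norm_le_one_of_unitary {U : A} (h : U ∈ unitary A) : ‖U‖ ≤ 1 := by
  rcases subsingleton_or_nontrivial A with _ | _
  · rw [Subsingleton.elim U 0, norm_zero]; exact zero_le_one
  · exact (CStarRing.norm_of_mem_unitary h).le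

lemma norm_pow_sub_pow_le {a b : A} (ha : ‖a‖ ≤ 1) (hb : ‖b‖ ≤ 1) (n : ℕ) :
    ‖a ^ n - b ^ n‖ ≤ n * ‖a - b‖ := by
  induction n with
  | zero => simp
  | succ n ih =>
    have h : a ^ (n + 1) - b ^ (n + 1) = a * (a ^ n - b ^ n) + (a - b) * b ^ n := by
      rw [pow_succ', pow_succ']; noncomm_ring
    have hbn : ‖b ^ n‖ ≤ 1 := by
      rcases Nat.eq_zero_or_pos n with rfl | hn
      · rw [pow_zero]; exact norm_le_one_of_unitary (one_mem _)
      · exact (norm_pow_le' b hn).trans (pow_le_one₀ (norm_nonneg _) hb)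
    rw [h]
    calc _ ≤ ‖a * (a ^ n - b ^ n)‖ + ‖(a - b) * b ^ n‖ := norm_add_le _ _
      _ ≤ ‖a‖ * ‖a ^ n - b ^ n‖ + ‖a - b‖ * ‖b ^ n‖ := add_le_add (norm_mul_le _ _) (norm_mul_le _ _)
      _ ≤ 1 * ‖a ^ n - b ^ n‖ + ‖a - b‖ * 1 := by gcongr
      _ ≤ _ := by push_cast; linarith

lemma exp_smul_mem_unitary {X : A} (hX : X ∈ skewAdjoint A) (t : ℝ) :
    exp (t • X) ∈ unitary A := by
  let +nondep : NormedAlgebra ℚ A := .restrictScalars ℚ ℂ A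
  exact exp_mem_unitary_of_mem_skewAdjoint (skewAdjoint.smul_mem t hX)

/-- The Lie product formula for unitary one-parameter groups. -/
lemma tendsto_exp_mul_exp_pow {X Y : A} (hX : X ∈ skewAdjoint A) (hY : Y ∈ skewAdjoint A) :
    Tendsto (fun n : ℕ => (exp ((1 / ((n : ℝ) + 1)) • X) * exp ((1 / ((n : ℝ) + 1)) • Y)) ^ (n + 1))
      atTop (𝓝 (exp (X + Y))) := by
  let +nondep : NormedAlgebra ℚ A := .restrictScalars ℚ ℂ A
  set f : ℝ → A := fun t => exp (t • X) * exp (t • Y) - exp (t • (X + Y)) with hf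
  -- The product of exponentials agrees with the exponential of the sum to first order, so each of
  -- the `n + 1` factors has error `o(1 / n)`; for unitaries these errors only add.
  have hd : HasDerivAt f 0 0 := by
    have h1 := (hasDerivAt_exp_smul_const X (0 : ℝ)).mul (hasDerivAt_exp_smul_const Y (0 : ℝ))
    have h2 := h1.sub (hasDerivAt_exp_smul_const (X + Y) (0 : ℝ))
    simp only [zero_smul, exp_zero, one_mul, mul_one, sub_self] at h2
    exact h2
  have h0 : f 0 = 0 := by simp [hf]
  have hlim : Tendsto (fun n : ℕ => 1 / ((n : ℝ) + 1)) atTop (𝓝[≠] 0) := by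
    refine tendsto_nhdsWithin_iff.mpr ⟨tendsto_one_div_add_atTop_nhds_zero_nat, ?_⟩
    exact Eventually.of_forall fun n => by
      have : (n : ℝ) + 1 ≠ 0 := by positivity
      simpa using this
  have h1 := (hasDerivAt_iff_tendsto_slope_zero.mp hd).comp hlim
  have h2 := h1.norm
  rw [norm_zero] at h2
  rw [tendsto_iff_norm_sub_tendsto_zero]
  refine squeeze_zero (fun _ => norm_nonneg _) (fun n => ?_) h2
  have hn : (0 : ℝ) < (n : ℝ) + 1 := by positivity
  have h3 : exp (X + Y) = exp ((1 / ((n : ℝ) + 1)) • (X + Y)) ^ (n + 1) := by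
    rw [← exp_nsmul, ← Nat.cast_smul_eq_nsmul ℝ, smul_smul]
    push_cast
    rw [mul_one_div_cancel hn.ne', one_smul]
  rw [h3]
  refine (norm_pow_sub_pow_le
    (norm_le_one_of_unitary (mul_mem (exp_smul_mem_unitary hX _) (exp_smul_mem_unitary hY _)))
    (norm_le_one_of_unitary (exp_smul_mem_unitary (add_mem hX hY) _)) (n + 1)).trans
    (le_of_eq ?_)
  simp only [Function.comp_apply, zero_add, h0, sub_zero, norm_smul, norm_inv]
  rw [one_div, norm_inv, inv_inv, Real.norm_eq_abs, abs_of_pos hn]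
  push_cast
  rfl

/-- The generators of the one-parameter groups in `H`. -/
def oneParam (H : Submonoid A) : Set A := {X | X ∈ skewAdjoint A ∧ ∀ t : ℝ, exp (t • X) ∈ H}

lemma oneParam_smul {H : Submonoid A} {X : A} (hX : X ∈ oneParam H) (c : ℝ) :
    c • X ∈ oneParam H :=
  ⟨skewAdjoint.smul_mem c hX.1, fun t => by rw [smul_smul]; exact hX.2 _⟩

/-- The Lie product formula exhibits the new exponentials as limits of elements of `H`, which is
closed. -/
lemma oneParam_add {H : Submonoid A} (hH : IsClosed (H : Set A)) {X Y : A} (hX : X ∈ oneParam H)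
    (hY : Y ∈ oneParam H) : X + Y ∈ oneParam H := by
  refine ⟨add_mem hX.1 hY.1, fun t => ?_⟩
  have hX' := oneParam_smul hX t
  have hY' := oneParam_smul hY t
  rw [smul_add]
  exact hH.mem_of_tendsto (tendsto_exp_mul_exp_pow hX'.1 hY'.1)
    (Eventually.of_forall fun n => pow_mem (mul_mem (hX'.2 _) (hY'.2 _)) _)

lemma oneParam_conj {H : Submonoid A} {X V : A} (hX : X ∈ oneParam H) (hV : V ∈ unitary A)
    (hVH : V ∈ H) (hVH' : star V ∈ H) : V * X * star V ∈ oneParam H := by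
  let +nondep : NormedAlgebra ℚ A := .restrictScalars ℚ ℂ A
  refine ⟨?_, fun t => ?_⟩
  · rw [skewAdjoint.mem_iff, star_mul, star_mul, star_star, skewAdjoint.mem_iff.mp hX.1]
    noncomm_ring
  · have h := exp_units_conj (Unitary.toUnits ⟨V, hV⟩) (t • X)
    have h1 : ((Unitary.toUnits ⟨V, hV⟩ : Aˣ) : A) = V := rfl
    have h2 : (((Unitary.toUnits ⟨V, hV⟩ : Aˣ)⁻¹ : Aˣ) : A) = star V := rfl
    rw [h1, h2] at h
    have h3 : t • (V * X * star V) = V * (t • X) * star V := by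
      rw [mul_smul_comm, smul_mul_assoc]
    rw [h3, h]
    exact mul_mem (mul_mem hVH (hX.2 t)) hVH'

/-- The one-parameter group generated by a square root of `-1`. -/
lemma exp_smul_of_sq_eq_neg_one {X : A} (hX : X * X = -1) (t : ℝ) :
    exp (t • X) = Real.cos t • (1 : A) + Real.sin t • X := by
  let +nondep : NormedAlgebra ℚ A := .restrictScalars ℚ ℂ A
  -- A square root of `-1` spans a copy of `ℂ`, in which the claim is Euler's formula.
  set f : ℂ →ₐ[ℝ] A := Complex.lift ⟨X, hX⟩ with hf
  have hI : f Complex.I = X := Complex.liftAux_apply_I X hX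
  have hc : Continuous f := f.toLinearMap.continuous_of_finiteDimensional
  have h := map_exp f hc (t • Complex.I)
  rw [map_smul, hI] at h
  rw [← h, ← Complex.exp_eq_exp_ℂ, Complex.real_smul, Complex.exp_mul_I, ← Complex.ofReal_cos,
    ← Complex.ofReal_sin, map_add, ← Complex.real_smul, map_smul, hI]
  congr 1
  rw [← mul_one ((Real.cos t : ℝ) : ℂ), ← Complex.real_smul, map_smul, map_one]

/-- A closed group that contains a rotation by an irrational angle contains the one-parameter
group of the rotation. -/
lemma mem_oneParam_of_irrational {H : Submonoid A} (hH : IsClosed (H : Set A)) {X : A}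
    (hX : X * X = -1) (hXs : X ∈ skewAdjoint A) {θ : ℝ} (hθ : Irrational (θ / (2 * Real.pi)))
    (h1 : exp (θ • X) ∈ H) (h2 : exp ((-θ) • X) ∈ H) : X ∈ oneParam H := by
  let +nondep : NormedAlgebra ℚ A := .restrictScalars ℚ ℂ A
  refine ⟨hXs, fun t => ?_⟩
  -- Irrationality makes the group generated by `θ` and `2π` dense in `ℝ`. Both signs of `t` are
  -- carried along because `H` is only a monoid.
  have key : ∀ t ∈ AddSubgroup.closure {θ, 2 * Real.pi}, exp (t • X) ∈ H ∧ exp ((-t) • X) ∈ H := by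
    intro t ht
    induction ht using AddSubgroup.closure_induction with
    | mem x hx =>
      rcases hx with rfl | rfl
      · exact ⟨h1, h2⟩
      · rw [exp_smul_of_sq_eq_neg_one hX, exp_smul_of_sq_eq_neg_one hX, Real.cos_neg, Real.sin_neg,
          Real.cos_two_pi, Real.sin_two_pi, neg_zero, one_smul, zero_smul, add_zero]
        exact ⟨one_mem _, one_mem _⟩
    | zero => rw [neg_zero, zero_smul, exp_zero]; exact ⟨one_mem _, one_mem _⟩
    | add x y _ _ hx hy =>
      have hc : ∀ x y : ℝ, Commute (x • X) (y • X) := fun x y =>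
        ((Commute.refl X).smul_left x).smul_right y
      rw [neg_add, add_smul, add_smul, exp_add_of_commute (hc _ _), exp_add_of_commute (hc _ _)]
      exact ⟨mul_mem hx.1 hy.1, mul_mem hx.2 hy.2⟩
    | neg x _ hx => rw [neg_neg]; exact hx.symm
  have hd := dense_addSubgroupClosure_pair_iff.mpr hθ
  have hcl : IsClosed {t : ℝ | exp (t • X) ∈ H} := by
    have hc : Continuous fun t : ℝ => exp (t • X) :=
      exp_continuous.comp (continuous_id.smul continuous_const)
    exact hH.preimage hc
  have := hcl.closure_subset_iff.mpr (fun t ht => (key t ht).1)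
  rw [hd.closure_eq] at this
  exact this (Set.mem_univ t)

end OneParameter

end MagicDistill

/-! ### A rotation of infinite order and the generator `iZ`. -/

namespace MagicDistill

set_option linter.unusedSectionVars false

open Matrix Function ComplexConjugate NormedSpace
open scoped Matrix.Norms.L2Operator

section Group

variable {Q : Type} [Fintype Q] [DecidableEq Q]

lemma circuitOp_append {G : Set (Matrix.unitaryGroup (Fin 2) ℂ)} (L L' : List (Gate G Q)) :
    circuitOp (L ++ L') = circuitOp L' * circuitOp L := by
  induction L with
  | nil => simp [circuitOp]
  | cons g L ih => rw [List.cons_append, circuitOp, circuitOp, ih, Matrix.mul_assoc]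

/-- The operators of circuits, up to a global phase. -/
noncomputable def circuitMonoid (Q : Type) [Fintype Q] [DecidableEq Q] : Submonoid (Op Q) where
  carrier := {M | ∃ z : ℂ, ‖z‖ = 1 ∧ ∃ L : List (Gate simGates Q), M = z • circuitOp L}
  one_mem' := ⟨1, norm_one, [], by simp [circuitOp]⟩
  mul_mem' := by
    rintro _ _ ⟨z, hz, L, rfl⟩ ⟨z', hz', L', rfl⟩
    refine ⟨z * z', by rw [norm_mul, hz, hz', one_mul], L' ++ L, ?_⟩
    rw [circuitOp_append, smul_mul_smul_comm]

/-- The operators that are approximated by circuits. -/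
noncomputable def circuitGroup (Q : Type) [Fintype Q] [DecidableEq Q] : Submonoid (Op Q) :=
  (circuitMonoid Q).topologicalClosure

lemma isClosed_circuitGroup : IsClosed (circuitGroup Q : Set (Op Q)) :=
  Submonoid.isClosed_topologicalClosure _

lemma circuitMonoid_le : circuitMonoid Q ≤ circuitGroup Q := Submonoid.le_topologicalClosure _

lemma phase_mem {z : ℂ} (hz : ‖z‖ = 1) : z • (1 : Op Q) ∈ circuitGroup Q :=
  circuitMonoid_le ⟨z, hz, [], by simp [circuitOp]⟩

lemma gate_mem (g : Gate simGates Q) : g.op ∈ circuitGroup Q :=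
  circuitMonoid_le ⟨1, norm_one, [g], by simp [circuitOp]⟩

lemma hadamard_mem (q : Q) : onQubit q hadamardGate ∈ circuitGroup Q :=
  gate_mem (.single q ⟨hadamardUnitary, by simp [simGates]⟩)

lemma rot_mem (q : Q) (s : Bool) : onQubit q (rotGate s) ∈ circuitGroup Q := by
  cases s
  · exact gate_mem (.single q ⟨rotUnitary false, by simp [simGates]⟩)
  · exact gate_mem (.single q ⟨rotUnitary true, by simp [simGates]⟩)

lemma cnot_mem {c t : Q} (h : c ≠ t) : cnotGate c t ∈ circuitGroup Q := gate_mem (.cnot c t h)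

lemma rotGate_cube : rotGate true * (rotGate true * rotGate true) = phaseGate := by
  have h := zeta12_pow_three
  rw [rotGate_eq_diagonal, diagonal_mul_diagonal, diagonal_mul_diagonal]
  ext i j
  fin_cases i <;> fin_cases j <;> simp [phaseGate]
  rw [← h]; ring

lemma phaseGate_mem (q : Q) : onQubit q phaseGate ∈ circuitGroup Q := by
  rw [← rotGate_cube, ← onQubit_mul, ← onQubit_mul]
  exact mul_mem (rot_mem q _) (mul_mem (rot_mem q _) (rot_mem q _))

lemma phaseGate_star_mem (q : Q) : star (onQubit q phaseGate) ∈ circuitGroup Q := by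
  rw [← rotGate_cube, ← onQubit_mul, ← onQubit_mul, star_mul, star_mul, star_eq_conjTranspose,
    onQubit_conjTranspose, rotGate_conjTranspose]
  exact mul_mem (mul_mem (rot_mem q _) (rot_mem q _)) (rot_mem q _)

/-- A single-qubit unitary that is available on every qubit, with its inverse. -/
def Available (V : Op1) : Prop :=
  Vᴴ * V = 1 ∧ ∀ (Q : Type) [Fintype Q] [DecidableEq Q] (q : Q),
    onQubit q V ∈ circuitGroup Q ∧ star (onQubit q V) ∈ circuitGroup Q

lemma mem_unitary_of_conjTranspose_mul {ι : Type} [Fintype ι] [DecidableEq ι] {U : Matrix ι ι ℂ}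
    (h : Uᴴ * U = 1) : U ∈ unitary (Matrix ι ι ℂ) :=
  Matrix.mem_unitaryGroup_iff'.mpr h

lemma available_hadamard : Available hadamardGate := by
  refine ⟨by rw [hadamardGate_conjTranspose, hadamardGate_mul_self], fun Q _ _ q =>
    ⟨hadamard_mem q, ?_⟩⟩
  rw [star_eq_conjTranspose, onQubit_conjTranspose, hadamardGate_conjTranspose]
  exact hadamard_mem q

lemma available_phase : Available phaseGate :=
  ⟨phaseGate_unitary, fun _ _ _ q => ⟨phaseGate_mem q, phaseGate_star_mem q⟩⟩

lemma oneParam_conj_onQubit {X : Op Q} (hX : X ∈ oneParam (circuitGroup Q)) {V : Op1}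
    (hV : Available V) (q : Q) :
    onQubit q V * X * onQubit q Vᴴ ∈ oneParam (circuitGroup Q) := by
  have := oneParam_conj hX (mem_unitary_of_conjTranspose_mul (onQubit_unitary q hV.1))
    (hV.2 Q q).1 (hV.2 Q q).2
  rwa [star_eq_conjTranspose, onQubit_conjTranspose] at this

lemma oneParam_conj_cnot {X : Op Q} (hX : X ∈ oneParam (circuitGroup Q)) {c t : Q} (h : c ≠ t) :
    cnotGate c t * X * (cnotGate c t)ᴴ ∈ oneParam (circuitGroup Q) := by
  refine oneParam_conj hX (mem_unitary_of_conjTranspose_mul (cnot_unitary h)) (cnot_mem h) ?_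
  rw [star_eq_conjTranspose, cnot_conjTranspose h]
  exact cnot_mem h

/-- The generator of the rotation that the word `K² H K² H` performs. -/
noncomputable def rotAxis : Op1 :=
  (-Complex.I / √7) • ((√3 : ℂ) • pauliX + pauliY + (√3 : ℂ) • pauliZ)

lemma sqrt_seven_sq : ((√7 : ℝ) : ℂ) ^ 2 = 7 := by
  rw [← Complex.ofReal_pow, Real.sq_sqrt (by norm_num)]; norm_num

lemma sqrt_seven_ne : ((√7 : ℝ) : ℂ) ≠ 0 := by
  intro h; have := sqrt_seven_sq; rw [h] at this; norm_num at this

lemma rotAxis_apply (i j : Fin 2) : rotAxis i j = (√7 : ℂ) / 7 *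
    !![-Complex.I * √3, -Complex.I * √3 - 1; -Complex.I * √3 + 1, Complex.I * √3] i j := by
  have h7 := sqrt_seven_sq
  have h7' := sqrt_seven_ne
  have hI := Complex.I_sq
  have : -Complex.I / √7 = (√7 : ℂ) / 7 * -Complex.I := by
    field_simp
    linear_combination h7
  rw [rotAxis, this]
  fin_cases i <;> fin_cases j <;> simp [pauliX, pauliY, pauliZ]
  · ring
  · linear_combination (√7 : ℂ) / 7 * hI
  · linear_combination (-(√7 : ℂ) / 7) * hI
  · ring

lemma rotAxis_mul_self : rotAxis * rotAxis = -1 := by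
  have h7 := sqrt_seven_sq
  have h3 := sqrt_three_sq
  have hI := Complex.I_sq
  ext i j
  simp only [Matrix.mul_apply, rotAxis_apply, Fin.sum_univ_two]
  fin_cases i <;> fin_cases j <;> simp
  · linear_combination (2 * √3 ^ 2 * Complex.I ^ 2 - 1) / 49 * h7 + 2 * √3 ^ 2 / 7 * hI - 2 / 7 * h3
  · ring
  · ring
  · linear_combination (2 * √3 ^ 2 * Complex.I ^ 2 - 1) / 49 * h7 + 2 * √3 ^ 2 / 7 * hI - 2 / 7 * h3

lemma rotAxis_conjTranspose : rotAxisᴴ = -rotAxis := by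
  ext i j
  simp only [conjTranspose_apply, rotAxis_apply, Matrix.neg_apply]
  fin_cases i <;> fin_cases j <;> simp <;> ring

lemma hadamard_conj_apply (A : Op1) : hadamardGate * A * hadamardGateᴴ =
    !![(A 0 0 + A 0 1 + A 1 0 + A 1 1) / 2, (A 0 0 - A 0 1 + A 1 0 - A 1 1) / 2;
      (A 0 0 + A 0 1 - A 1 0 - A 1 1) / 2, (A 0 0 - A 0 1 - A 1 0 + A 1 1) / 2] := by
  have h := sqrt_two_inv_mul_self
  rw [hadamardGate_conjTranspose]
  ext i j
  simp only [Matrix.mul_apply, hadamardGate_apply, Fin.sum_univ_two]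
  generalize ((1 / √2 : ℝ) : ℂ) = x at h
  fin_cases i <;> fin_cases j <;> simp
  · linear_combination (A 0 0 + A 0 1 + A 1 0 + A 1 1) * h
  · linear_combination (A 0 0 - A 0 1 + A 1 0 - A 1 1) * h
  · linear_combination (A 0 0 + A 0 1 - A 1 0 - A 1 1) * h
  · linear_combination (A 0 0 - A 0 1 - A 1 0 + A 1 1) * h

lemma hadamard_conj_pauliZ : hadamardGate * pauliZ * hadamardGateᴴ = pauliX := by
  rw [hadamard_conj_apply]
  ext i j
  fin_cases i <;> fin_cases j <;> simp [pauliZ, pauliX]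

lemma phase_conj_pauliX : phaseGate * pauliX * phaseGateᴴ = pauliY := by
  ext i j
  fin_cases i <;> fin_cases j <;> simp [phaseGate, pauliX, pauliY, Matrix.mul_apply]

lemma hadamard_phase_conj_pauliY :
    hadamardGate * (phaseGate * pauliY * phaseGateᴴ) * hadamardGateᴴ = -pauliZ := by
  rw [hadamard_conj_apply]
  ext i j
  fin_cases i <;> fin_cases j <;> simp [phaseGate, pauliY, pauliZ, Matrix.mul_apply]

lemma rotAxis_sub : rotAxis - hadamardGate * rotAxis * hadamardGateᴴ =
    (-2 * √7 / 7 : ℝ) • (Complex.I • pauliY) := by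
  have hI := Complex.I_sq
  rw [hadamard_conj_apply]
  ext i j
  simp only [Matrix.sub_apply, rotAxis_apply, Matrix.smul_apply]
  fin_cases i <;> fin_cases j <;> simp [pauliY] <;> ring

/-- The word `K² H K² H` is a rotation with cosine `3/4`. -/
lemma rot_word : rotGate true * rotGate true *
    (hadamardGate * (rotGate true * rotGate true) * hadamardGateᴴ) =
    (zeta12 ^ 2) • ((3 / 4 : ℝ) • (1 : Op1) + (√7 / 4 : ℝ) • rotAxis) := by
  have h7 := sqrt_seven_sq
  have h3 := sqrt_three_sq
  have hI := Complex.I_sq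
  have hz : zeta12 ^ 2 = (1 + √3 * Complex.I) / 2 := by
    rw [zeta12]; linear_combination h3 / 4 + hI / 4
  have hz' : zeta12 * zeta12 = (1 + √3 * Complex.I) / 2 := by rw [← hz]; ring
  rw [hadamard_conj_apply, rotGate_eq_diagonal, diagonal_mul_diagonal, hz]
  ext i j
  simp only [diagonal_mul, Matrix.smul_apply, Matrix.add_apply, rotAxis_apply]
  have h77 : ∀ x : ℂ, (√7 : ℂ) / 4 * ((√7 : ℂ) / 7 * x) = x / 4 := fun x => by
    linear_combination x / 28 * h7
  fin_cases i <;> fin_cases j <;> simp [hz', h77]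
  · linear_combination (√3 : ℂ) ^ 2 / 8 * hI - 1 / 8 * h3
  · linear_combination (√3 : ℂ) ^ 2 / 8 * hI - 1 / 8 * h3
  · left; ring
  · left; ring

/-- By Niven's theorem a rational cosine of a rational multiple of `π` is `0`, `±1/2` or `±1`. -/
lemma irrational_arccos : Irrational (Real.arccos (3 / 4) / (2 * Real.pi)) := by
  rintro ⟨r, hr⟩
  have hpi := Real.pi_pos
  have hcos : Real.cos (Real.arccos (3 / 4)) = 3 / 4 := Real.cos_arccos (by norm_num) (by norm_num)
  have h := niven (θ := Real.arccos (3 / 4)) ⟨2 * r, by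
    push_cast; rw [hr]; field_simp⟩ ⟨3 / 4, by rw [hcos]; norm_num⟩
  rw [hcos] at h
  simp only [Set.mem_insert_iff, Set.mem_singleton_iff] at h
  norm_num at h

lemma sin_arccos_three_quarters : Real.sin (Real.arccos (3 / 4)) = √7 / 4 := by
  rw [Real.sin_arccos, show (1 : ℝ) - (3 / 4) ^ 2 = 7 / 4 ^ 2 by norm_num,
    Real.sqrt_div (by norm_num), Real.sqrt_sq (by norm_num)]

lemma norm_zeta12 : ‖zeta12‖ = 1 := by
  have h := zeta12_mul_conj
  rw [Complex.mul_conj, Complex.normSq_eq_norm_sq] at h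
  have h2 : ‖zeta12‖ ^ 2 = 1 := by exact_mod_cast h
  exact (pow_eq_one_iff_of_nonneg (norm_nonneg _) (by norm_num)).mp h2

lemma onQubit_real_smul (q : Q) (c : ℝ) (A : Op1) : onQubit q (c • A) = c • onQubit q A := by
  rw [← Complex.coe_smul, onQubit_smul, Complex.coe_smul]

lemma onQubit_neg (q : Q) (A : Op1) : onQubit q (-A) = -onQubit q A := by
  rw [← neg_one_smul ℂ A, onQubit_smul, neg_one_smul]

lemma onQubit_sub (q : Q) (A B : Op1) : onQubit q (A - B) = onQubit q A - onQubit q B := by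
  rw [sub_eq_add_neg, onQubit_add, onQubit_neg, ← sub_eq_add_neg]

/-- Up to a phase, the square of the gate is a rotation about `Z` with half-angle `π / 6`, and its
Hadamard conjugate is the same about `X`. Their product has cosine `cos² (π / 6) = 3/4`, hence an
irrational angle. -/
lemma rotAxis_mem_oneParam (q : Q) : onQubit q rotAxis ∈ oneParam (circuitGroup Q) := by
  have hsq : onQubit q rotAxis * onQubit q rotAxis = -1 := by
    rw [onQubit_mul, rotAxis_mul_self, onQubit_neg, onQubit_one]
  have hskew : onQubit q rotAxis ∈ skewAdjoint (Op Q) := by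
    rw [skewAdjoint.mem_iff, star_eq_conjTranspose, onQubit_conjTranspose, rotAxis_conjTranspose,
      onQubit_neg]
  have hexp : exp (Real.arccos (3 / 4) • onQubit q rotAxis) =
      (conj zeta12 ^ 2) • (onQubit q (rotGate true) * onQubit q (rotGate true) *
        (onQubit q hadamardGate * (onQubit q (rotGate true) * onQubit q (rotGate true)) *
          onQubit q hadamardGate)) := by
    have h := rot_word
    rw [hadamardGate_conjTranspose] at h
    rw [exp_smul_of_sq_eq_neg_one hsq, Real.cos_arccos (by norm_num) (by norm_num),
      sin_arccos_three_quarters]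
    simp only [onQubit_mul]
    rw [h, onQubit_smul, smul_smul, ← mul_pow, mul_comm (conj zeta12), zeta12_mul_conj, one_pow,
      one_smul, onQubit_add, onQubit_real_smul, onQubit_real_smul, onQubit_one]
  have hmem : exp (Real.arccos (3 / 4) • onQubit q rotAxis) ∈ circuitGroup Q := by
    rw [hexp, ← one_mul (_ * _), ← smul_mul_assoc]
    refine mul_mem (phase_mem ?_) (mul_mem (mul_mem (rot_mem q _) (rot_mem q _))
      (mul_mem (mul_mem (hadamard_mem q) (mul_mem (rot_mem q _) (rot_mem q _))) (hadamard_mem q)))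
    rw [norm_pow, RCLike.norm_conj, norm_zeta12, one_pow]
  have hmem' : exp ((-Real.arccos (3 / 4)) • onQubit q rotAxis) ∈ circuitGroup Q := by
    have h : exp ((-Real.arccos (3 / 4)) • onQubit q rotAxis) =
        star (exp (Real.arccos (3 / 4) • onQubit q rotAxis)) := by
      rw [star_exp, star_smul, skewAdjoint.mem_iff.mp hskew, star_trivial, smul_neg, neg_smul]
    rw [h, hexp]
    simp only [star_smul, star_mul, star_eq_conjTranspose, onQubit_conjTranspose,
      rotGate_conjTranspose, hadamardGate_conjTranspose]
    rw [← one_mul (_ * _), ← smul_mul_assoc]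
    refine mul_mem (phase_mem ?_) (mul_mem (mul_mem (hadamard_mem q)
      (mul_mem (mul_mem (rot_mem q _) (rot_mem q _)) (hadamard_mem q)))
      (mul_mem (rot_mem q _) (rot_mem q _)))
    rw [norm_star, norm_pow, RCLike.norm_conj, norm_zeta12, one_pow]
  exact mem_oneParam_of_irrational isClosed_circuitGroup hsq hskew irrational_arccos hmem hmem'

/-- The Hadamard gate exchanges `X` and `Z` and reverses `Y`, so the axis minus its conjugate is a
multiple of `iY`, which Clifford conjugation carries to `iZ`. -/
lemma I_pauliZ_mem_oneParam (q : Q) : onQubit q (Complex.I • pauliZ) ∈ oneParam (circuitGroup Q) := by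
  have h1 := rotAxis_mem_oneParam q
  have h2 := oneParam_conj_onQubit h1 available_hadamard q
  rw [onQubit_mul, onQubit_mul] at h2
  have h3 := oneParam_add isClosed_circuitGroup h1 (oneParam_smul h2 (-1))
  rw [neg_one_smul, ← sub_eq_add_neg, ← onQubit_sub, rotAxis_sub] at h3
  have h4 := oneParam_conj_onQubit (oneParam_conj_onQubit h3 available_phase q)
    available_hadamard q
  rw [onQubit_mul, onQubit_mul, onQubit_mul, onQubit_mul] at h4
  simp only [Matrix.mul_smul, Matrix.smul_mul] at h4
  rw [hadamard_phase_conj_pauliY] at h4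
  have h5 := oneParam_smul h4 (7 / (2 * √7))
  rw [← onQubit_real_smul, smul_smul] at h5
  have h7 : (7 / (2 * √7)) * (-2 * √7 / 7) = (-1 : ℝ) := by field_simp
  rwa [h7, smul_neg, neg_one_smul, neg_neg] at h5

end Group

end MagicDistill

/-! ### The generators span all matrices. -/

namespace MagicDistill

set_option linter.unusedSectionVars false

open Matrix Function ComplexConjugate NormedSpace
open scoped Matrix.Norms.L2Operator

section Span

variable {Q : Type} [Fintype Q] [DecidableEq Q]

lemma oneParam_sub {X Y : Op Q} (hX : X ∈ oneParam (circuitGroup Q))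
    (hY : Y ∈ oneParam (circuitGroup Q)) : X - Y ∈ oneParam (circuitGroup Q) := by
  have := oneParam_add isClosed_circuitGroup hX (oneParam_smul hY (-1))
  rwa [neg_one_smul, ← sub_eq_add_neg] at this

lemma zero_mem_oneParam : (0 : Op Q) ∈ oneParam (circuitGroup Q) :=
  ⟨zero_mem _, fun t => by rw [smul_zero, exp_zero]; exact one_mem _⟩

/-- The complex span of the generators of one-parameter groups of approximated operators. -/
noncomputable def generatorSpace (Q : Type) [Fintype Q] [DecidableEq Q] :
    Submodule ℂ (Op Q) where
  -- The conditions concern the Hermitian part times `i` and the skew part, each doubled. This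
  -- complexifies the real space `oneParam`, so that products of arbitrary matrices can be expanded
  -- in Paulis.
  carrier := {M | Complex.I • (M + Mᴴ) ∈ oneParam (circuitGroup Q) ∧
    M - Mᴴ ∈ oneParam (circuitGroup Q)}
  zero_mem' := by
    simp only [Set.mem_ofPred_eq, conjTranspose_zero, add_zero, smul_zero, sub_zero, and_self]
    exact zero_mem_oneParam
  add_mem' := by
    rintro M N ⟨h1, h2⟩ ⟨h3, h4⟩
    have e1 : Complex.I • (M + N + (M + N)ᴴ) =
        Complex.I • (M + Mᴴ) + Complex.I • (N + Nᴴ) := by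
      rw [conjTranspose_add, ← smul_add]; congr 1; abel
    have e2 : M + N - (M + N)ᴴ = (M - Mᴴ) + (N - Nᴴ) := by
      rw [conjTranspose_add]; abel
    constructor
    · rw [e1]; exact oneParam_add isClosed_circuitGroup h1 h3
    · rw [e2]; exact oneParam_add isClosed_circuitGroup h2 h4
  smul_mem' := by
    rintro c M ⟨h1, h2⟩
    have e1 : Complex.I • (c • M + (c • M)ᴴ) =
        c.re • (Complex.I • (M + Mᴴ)) - c.im • (M - Mᴴ) := by
      ext s t
      simp only [Matrix.smul_apply, Matrix.add_apply, Matrix.sub_apply, conjTranspose_apply,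
        smul_eq_mul, star_mul']
      apply Complex.ext <;> simp <;> ring
    have e2 : c • M - (c • M)ᴴ = c.re • (M - Mᴴ) + c.im • (Complex.I • (M + Mᴴ)) := by
      ext s t
      simp only [Matrix.smul_apply, Matrix.add_apply, Matrix.sub_apply, conjTranspose_apply,
        smul_eq_mul, star_mul']
      apply Complex.ext <;> simp <;> ring
    constructor
    · rw [e1]; exact oneParam_sub (oneParam_smul h1 _) (oneParam_smul h2 _)
    · rw [e2]; exact oneParam_add isClosed_circuitGroup (oneParam_smul h2 _) (oneParam_smul h1 _)

lemma mem_generatorSpace_of_hermitian {M : Op Q} (hM : Mᴴ = M)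
    (h : Complex.I • M ∈ oneParam (circuitGroup Q)) : M ∈ generatorSpace Q := by
  refine ⟨?_, ?_⟩
  · rw [hM, smul_add]
    exact oneParam_add isClosed_circuitGroup h h
  · rw [hM, sub_self]; exact zero_mem_oneParam

lemma mem_oneParam_of_skewAdjoint {M : Op Q} (hM : M ∈ skewAdjoint (Op Q))
    (h : M ∈ generatorSpace Q) : M ∈ oneParam (circuitGroup Q) := by
  have h2 := oneParam_smul h.2 (1 / 2)
  rw [← star_eq_conjTranspose, skewAdjoint.mem_iff.mp hM, sub_neg_eq_add, ← two_smul ℝ M,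
    smul_smul] at h2
  norm_num at h2
  exact h2

lemma generatorSpace_conj {M : Op Q} (hM : M ∈ generatorSpace Q) {V : Op1} (hV : Available V)
    (q : Q) : onQubit q V * M * onQubit q Vᴴ ∈ generatorSpace Q := by
  have e : (onQubit q V * M * onQubit q Vᴴ)ᴴ = onQubit q V * Mᴴ * onQubit q Vᴴ := by
    rw [conjTranspose_mul, conjTranspose_mul, onQubit_conjTranspose, onQubit_conjTranspose,
      conjTranspose_conjTranspose, Matrix.mul_assoc]
  refine ⟨?_, ?_⟩
  · rw [e, ← Matrix.add_mul, ← Matrix.mul_add, ← Matrix.smul_mul, ← Matrix.mul_smul]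
    exact oneParam_conj_onQubit hM.1 hV q
  · rw [e, ← Matrix.sub_mul, ← Matrix.mul_sub]
    exact oneParam_conj_onQubit hM.2 hV q

lemma tensorOp_conjTranspose (A : Q → Op1) : (tensorOp A)ᴴ = tensorOp fun j => (A j)ᴴ := by
  ext s t
  simp [tensorOp, conjTranspose_apply]

lemma onQubit_conj_tensorOp (q : Q) (U V : Op1) (A : Q → Op1) :
    onQubit q U * tensorOp A * onQubit q V = tensorOp (update A q (U * A q * V)) := by
  have h : onQubit q V = tensorOp (update (fun _ => 1) q V) := by
    have := onQubit_mul_tensorOp q V (fun _ => (1 : Op1))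
    rwa [tensorOp_one, Matrix.mul_one, Matrix.mul_one] at this
  rw [onQubit_mul_tensorOp, h, tensorOp_mul]
  congr 1
  ext1 j
  by_cases hj : j = q
  · subst hj; simp
  · simp [hj]

/-- The Pauli `Z` operators on the qubits in `S`. -/
noncomputable def zString (S : Finset Q) : Q → Op1 := fun j => if j ∈ S then pauliZ else 1

lemma zString_hermitian (S : Finset Q) : (tensorOp (zString S))ᴴ = tensorOp (zString S) := by
  rw [tensorOp_conjTranspose]
  congr 1
  ext1 j
  simp only [zString]
  split_ifs
  · exact pauliZ_conjTranspose
  · exact conjTranspose_one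

lemma tensorOp_zString (S : Finset Q) : tensorOp (zString S) =
    diagonal fun s => ∏ j ∈ S, (-1 : ℂ) ^ (s j).val := by
  have hz : pauliZ = diagonal fun b : Fin 2 => (-1 : ℂ) ^ b.val := by
    ext i j; fin_cases i <;> fin_cases j <;> simp [pauliZ]
  ext s t
  simp only [tensorOp, zString, Matrix.of_apply]
  by_cases h : s = t
  · subst h
    rw [diagonal_apply_eq, ← Finset.prod_subset (Finset.subset_univ S)]
    · refine Finset.prod_congr rfl fun j hj => ?_
      rw [if_pos hj, hz, diagonal_apply_eq]
    · intro j _ hj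
      rw [if_neg hj, Matrix.one_apply_eq]
  · rw [diagonal_apply_ne _ h]
    obtain ⟨j, hj⟩ := Function.ne_iff.mp h
    refine Finset.prod_eq_zero (Finset.mem_univ j) ?_
    split_ifs
    · rw [hz, diagonal_apply_ne _ hj]
    · rw [Matrix.one_apply_ne hj]

/-- The CNOT adds the control bit to the target bit, so the sign attached to `t` picks up the one
attached to `c`. -/
lemma cnot_conj_zString {S : Finset Q} {c t : Q} (ht : t ∈ S) (hc : c ∉ S) :
    cnotGate c t * tensorOp (zString S) * (cnotGate c t)ᴴ = tensorOp (zString (insert c S)) := by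
  have hct : c ≠ t := fun h => hc (h ▸ ht)
  have hsign : ∀ x y : Fin 2, (-1 : ℂ) ^ (x + y).val = (-1) ^ y.val * (-1) ^ x.val := by
    intro x y
    fin_cases x <;> fin_cases y <;> simp
  ext s u
  rw [cnot_conj_apply hct, tensorOp_zString, tensorOp_zString]
  by_cases h : s = u
  · subst h
    rw [diagonal_apply_eq, diagonal_apply_eq, Finset.prod_insert hc, ← Finset.mul_prod_erase _ _ ht,
      ← Finset.mul_prod_erase S (fun j => (-1 : ℂ) ^ (s j).val) ht, ← mul_assoc]
    congr 1
    · simp only [flip, update_self, hsign]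
    · refine Finset.prod_congr rfl fun j hj => ?_
      rw [flip, update_of_ne (Finset.ne_of_mem_erase hj)]
  · rw [diagonal_apply_ne _ h, diagonal_apply_ne]
    intro h'
    exact h (by rw [← flip_flip hct s, h', flip_flip hct])

lemma tensorOp_zString_singleton (q : Q) : tensorOp (zString {q}) = onQubit q pauliZ := by
  have := onQubit_mul_tensorOp q pauliZ (fun _ => (1 : Op1))
  rw [tensorOp_one, Matrix.mul_one, Matrix.mul_one] at this
  rw [this]
  congr 1
  ext1 j
  by_cases hj : j = q
  · subst hj; simp [zString]
  · simp [zString, hj]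

/-- The string grows by one qubit with each CNOT conjugation, from a single `Z`. The empty string
generates the global phases, which are in the group by construction. -/
lemma I_zString_mem_oneParam (S : Finset Q) :
    Complex.I • tensorOp (zString S) ∈ oneParam (circuitGroup Q) := by
  induction S using Finset.induction_on with
  | empty =>
    have h : tensorOp (zString (∅ : Finset Q)) = 1 := by
      rw [← tensorOp_one]; congr 1
    have hX : (Complex.I • (1 : Op Q)) * (Complex.I • (1 : Op Q)) = -1 := by
      rw [smul_mul_smul_comm, Complex.I_mul_I, Matrix.mul_one, neg_one_smul]
    rw [h]
    refine ⟨?_, fun t => ?_⟩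
    · rw [skewAdjoint.mem_iff, star_smul, star_one, Complex.star_def, Complex.conj_I, neg_smul]
    · rw [exp_smul_of_sq_eq_neg_one hX]
      have : Real.cos t • (1 : Op Q) + Real.sin t • Complex.I • (1 : Op Q) =
          Complex.exp (t * Complex.I) • 1 := by
        rw [Complex.exp_mul_I, add_smul, mul_smul, ← Complex.ofReal_cos, ← Complex.ofReal_sin,
          Complex.coe_smul, Complex.coe_smul]
      rw [this]
      exact phase_mem (Complex.norm_exp_ofReal_mul_I t)
  | insert c S hc ih =>
    rcases S.eq_empty_or_nonempty with rfl | ⟨t, ht⟩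
    · rw [insert_empty_eq, tensorOp_zString_singleton, ← onQubit_smul]
      exact I_pauliZ_mem_oneParam c
    · rw [← cnot_conj_zString ht hc]
      have := oneParam_conj_cnot ih (fun h => hc (h ▸ ht) : c ≠ t)
      rwa [Matrix.mul_smul, Matrix.smul_mul] at this

lemma op1_eq_pauli (A : Op1) : A = ((A 0 0 + A 1 1) / 2) • (1 : Op1) + ((A 0 0 - A 1 1) / 2) • pauliZ
    + ((A 0 1 + A 1 0) / 2) • pauliX + (Complex.I * (A 0 1 - A 1 0) / 2) • pauliY := by
  have hI := Complex.I_sq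
  ext i j
  fin_cases i <;> fin_cases j <;> simp [pauliX, pauliY, pauliZ]
  · ring
  · linear_combination (A 0 1 - A 1 0) / 2 * hI
  · linear_combination -(A 0 1 - A 1 0) / 2 * hI
  · ring

lemma tensorOp_update_add (A : Q → Op1) (q : Q) (B C : Op1) :
    tensorOp (update A q (B + C)) = tensorOp (update A q B) + tensorOp (update A q C) := by
  have h : ∀ (B : Op1) (s t : Q → Fin 2), tensorOp (update A q B) s t =
      B (s q) (t q) * ∏ j ∈ Finset.univ.erase q, A j (s j) (t j) := by
    intro B s t
    simp only [tensorOp, Matrix.of_apply]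
    rw [← Finset.mul_prod_erase _ _ (Finset.mem_univ q), update_self]
    congr 1
    refine Finset.prod_congr rfl fun j hj => ?_
    rw [update_of_ne (Finset.ne_of_mem_erase hj)]
  ext s t
  rw [Matrix.add_apply, h, h, h, Matrix.add_apply, add_mul]

lemma tensorOp_update_smul (A : Q → Op1) (q : Q) (c : ℂ) (B : Op1) :
    tensorOp (update A q (c • B)) = c • tensorOp (update A q B) := by
  have h := onQubit_conj_tensorOp q (c • (1 : Op1)) 1 (update A q B)
  rw [update_self, update_idem, Matrix.smul_mul, Matrix.one_mul, Matrix.mul_one] at h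
  rw [← h, onQubit_smul, onQubit_one, Matrix.mul_one, Matrix.smul_mul, Matrix.one_mul]

/-- Induction on the set of unrestricted factors: at the new position, Hadamard and phase gates turn
`Z` into `X` and `Y`, and linearity gives every matrix. -/
lemma tensorOp_mem_generatorSpace (F : Finset Q) :
    ∀ A : Q → Op1, (∀ j ∉ F, A j = 1 ∨ A j = pauliZ) → tensorOp A ∈ generatorSpace Q := by
  classical
  induction F using Finset.induction_on with
  | empty =>
    intro A hA
    have h : A = zString (Finset.univ.filter fun j => A j = pauliZ) := by
      ext1 j
      simp only [zString, Finset.mem_filter, Finset.mem_univ, true_and]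
      split_ifs with hj
      · exact hj
      · exact (hA j (by simp)).resolve_right hj
    rw [h]
    exact mem_generatorSpace_of_hermitian (zString_hermitian _) (I_zString_mem_oneParam _)
  | insert q F hq ih =>
    intro A hA
    have h0 : ∀ B : Op1, B = 1 ∨ B = pauliZ → tensorOp (update A q B) ∈ generatorSpace Q := by
      intro B hB
      refine ih _ fun j hj => ?_
      by_cases hjq : j = q
      · subst hjq; rwa [update_self]
      · rw [update_of_ne hjq]
        exact hA j (by simp [hjq, hj])
    have h1 := h0 1 (Or.inl rfl)
    have hZ := h0 pauliZ (Or.inr rfl)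
    have hX := generatorSpace_conj hZ available_hadamard q
    rw [onQubit_conj_tensorOp, update_self, update_idem, hadamard_conj_pauliZ] at hX
    have hY := generatorSpace_conj hX available_phase q
    rw [onQubit_conj_tensorOp, update_self, update_idem, phase_conj_pauliX] at hY
    have e : A = update A q (A q) := (update_eq_self q A).symm
    rw [e, op1_eq_pauli (A q), tensorOp_update_add, tensorOp_update_add, tensorOp_update_add,
      tensorOp_update_smul, tensorOp_update_smul, tensorOp_update_smul, tensorOp_update_smul]
    exact add_mem (add_mem (add_mem (Submodule.smul_mem _ _ h1) (Submodule.smul_mem _ _ hZ))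
      (Submodule.smul_mem _ _ hX)) (Submodule.smul_mem _ _ hY)

lemma generatorSpace_eq_top : generatorSpace Q = ⊤ := by
  rw [eq_top_iff]
  intro M _
  rw [Matrix.matrix_eq_sum_single M]
  refine sum_mem fun s _ => sum_mem fun t _ => ?_
  have h : Matrix.single s t (M s t) =
      M s t • tensorOp fun j => Matrix.single (s j) (t j) (1 : ℂ) := by
    ext u v
    simp only [Matrix.single, Matrix.of_apply, Matrix.smul_apply, tensorOp, smul_eq_mul]
    rw [Fintype.prod_boole, mul_ite, mul_one, mul_zero]
    refine if_congr ?_ rfl rfl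
    simp only [funext_iff, forall_and]
  rw [h]
  exact Submodule.smul_mem _ _
    (tensorOp_mem_generatorSpace Finset.univ _ fun j hj => (hj (Finset.mem_univ j)).elim)

lemma skewAdjoint_mem_oneParam {M : Op Q} (hM : M ∈ skewAdjoint (Op Q)) :
    M ∈ oneParam (circuitGroup Q) :=
  mem_oneParam_of_skewAdjoint hM (by rw [generatorSpace_eq_top]; trivial)

end Span

end MagicDistill

/-! ### Approximation of every unitary. -/

namespace MagicDistill

set_option linter.unusedSectionVars false

open Matrix Function ComplexConjugate NormedSpace
open scoped Matrix.Norms.L2Operator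

section Universal

variable {Q : Type} [Fintype Q] [DecidableEq Q]

/-- The spectrum is finite and the circle is not, so a phase can move the spectrum away from `-1`,
the cut of the argument used for the logarithm. -/
lemma exists_phase_neg_one_notMem_spectrum (U : Op Q) :
    ∃ z : ℂ, ‖z‖ = 1 ∧ -1 ∉ spectrum ℂ (z • U) := by
  have hfin : (spectrum ℂ U).Finite := Matrix.finite_spectrum U
  have hinf : (Metric.sphere (0 : ℂ) 1).Infinite :=
    (isPreconnected_sphere (by rw [Complex.rank_real_complex]; norm_num)
      0 1).infinite_of_nontrivial ⟨1, by simp, -1, by simp, by norm_num⟩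
  obtain ⟨w, hw1, hw⟩ := hinf.exists_notMem_finite hfin
  rw [mem_sphere_zero_iff_norm] at hw1
  have hww : conj w * w = 1 := by
    rw [← Complex.normSq_eq_conj_mul_self, Complex.normSq_eq_norm_sq, hw1]; simp
  refine ⟨-conj w, by rw [norm_neg, RCLike.norm_conj, hw1], fun h => hw ?_⟩
  have hw0 : -conj w ≠ 0 := fun h0 => by
    rw [neg_eq_zero] at h0
    rw [h0, zero_mul] at hww
    exact zero_ne_one hww
  have h1 : Units.mk0 (-conj w) hw0 • w = -1 := by
    rw [Units.smul_def, Units.val_mk0, smul_eq_mul, neg_mul, hww]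
  rw [← h1] at h
  exact spectrum.smul_mem_smul_iff.mp h

/-- Up to a phase the unitary is `exp (i a)` with `a` self-adjoint, and `i a` is a generator because
all skew-adjoint matrices are. -/
lemma unitary_mem_circuitGroup {U : Op Q} (hU : U ∈ unitary (Op Q)) : U ∈ circuitGroup Q := by
  obtain ⟨z, hz, hspec⟩ := exists_phase_neg_one_notMem_spectrum U
  have hz' : conj z * z = 1 := by
    rw [← Complex.normSq_eq_conj_mul_self, Complex.normSq_eq_norm_sq, hz]; simp
  have hzU : z • U ∈ unitary (Op Q) := by
    rw [Unitary.mem_iff] at hU ⊢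
    rw [star_smul, smul_mul_smul_comm, smul_mul_smul_comm, hU.1, hU.2, Complex.star_def, hz',
      mul_comm, hz', one_smul]
    exact ⟨rfl, rfl⟩
  have hnorm := (Unitary.norm_sub_one_lt_two_iff hzU).mpr hspec
  have h := expUnitary_argSelfAdjoint (u := ⟨z • U, hzU⟩) hnorm
  set a := Unitary.argSelfAdjoint (⟨z • U, hzU⟩ : unitary (Op Q))
  have h2 : exp (Complex.I • (a : Op Q)) = z • U := by
    rw [← selfAdjoint.expUnitary_coe, h]
  have hskew : Complex.I • (a : Op Q) ∈ skewAdjoint (Op Q) :=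
    a.2.smul_mem_skewAdjoint Complex.conj_I
  have h3 := (skewAdjoint_mem_oneParam hskew).2 1
  rw [one_smul, h2] at h3
  have h4 := mul_mem (phase_mem (Q := Q) (z := conj z) (by rw [RCLike.norm_conj, hz])) h3
  rwa [smul_mul_smul_comm, hz', one_smul, Matrix.one_mul] at h4

open scoped MatrixOrder in
-- In the Heisenberg picture the probabilities differ by the expectation of `X = Vᴴ E V - Uᴴ E U`,
-- and `‖X‖ ≤ 2 ‖V - U‖` since `E` is a contraction.
lemma traceClose_of_norm_sub_le {U V : Op Q} (hU : U ∈ unitary (Op Q)) (hV : V ∈ unitary (Op Q))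
    {δ : ℝ} (h : ‖V - U‖ ≤ δ) {σ : Op Q} (hσ : IsDensity σ) :
    TraceClose (2 * δ) (V * σ * Vᴴ) (U * σ * Uᴴ) := by
  have hU' : Uᴴ * U = 1 := (Unitary.mem_iff.mp hU).1
  have hV' : Vᴴ * V = 1 := (Unitary.mem_iff.mp hV).1
  refine traceClose_of_forall_re_le (hσ.conj hV') (hσ.conj hU') fun E hE => ?_
  have hE1 : ‖E‖ ≤ 1 := by
    rw [CStarAlgebra.norm_le_one_iff_of_nonneg E hE.1.nonneg, Matrix.le_iff]
    exact hE.2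
  set X : Op Q := Vᴴ * E * V - Uᴴ * E * U with hX
  have hXs : IsSelfAdjoint X := by
    have hEs : Eᴴ = E := hE.1.1
    rw [IsSelfAdjoint, star_eq_conjTranspose, hX, conjTranspose_sub]
    simp only [conjTranspose_mul, conjTranspose_conjTranspose, hEs, Matrix.mul_assoc]
  have hXn : ‖X‖ ≤ 2 * δ := by
    have e : X = Vᴴ * E * (V - U) + star (V - U) * (E * U) := by
      rw [star_eq_conjTranspose, conjTranspose_sub, hX]; noncomm_ring
    have hVn : ‖Vᴴ‖ ≤ 1 := by
      rw [← star_eq_conjTranspose, norm_star]; exact norm_le_one_of_unitary hV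
    have hUn := norm_le_one_of_unitary hU
    have h0 := norm_nonneg (V - U)
    have h1 : ‖Vᴴ * E‖ ≤ 1 := (norm_mul_le _ _).trans (mul_le_one₀ hVn (norm_nonneg _) hE1)
    have h2 : ‖E * U‖ ≤ 1 := (norm_mul_le _ _).trans (mul_le_one₀ hE1 (norm_nonneg _) hUn)
    rw [e]
    calc _ ≤ ‖Vᴴ * E * (V - U)‖ + ‖star (V - U) * (E * U)‖ := norm_add_le _ _
      _ ≤ ‖Vᴴ * E‖ * ‖V - U‖ + ‖star (V - U)‖ * ‖E * U‖ :=
        add_le_add (norm_mul_le _ _) (norm_mul_le _ _)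
      _ ≤ 1 * δ + δ * 1 := by
        rw [norm_star]
        gcongr
        exact h0.trans h
      _ = 2 * δ := by ring
  have hle : (algebraMap ℝ (Op Q) ‖X‖ - X).PosSemidef :=
    Matrix.le_iff.mp hXs.le_algebraMap_norm_self
  have h1 := posSemidef_trace_mul_nonneg hle hσ.1
  rw [Matrix.sub_mul, Matrix.trace_sub, Algebra.algebraMap_eq_smul_one, Matrix.smul_mul,
    Matrix.one_mul, Matrix.trace_smul, hσ.2, Complex.nonneg_iff, Complex.sub_re] at h1
  have h2 : (X * σ).trace = (E * (V * σ * Vᴴ)).trace - (E * (U * σ * Uᴴ)).trace := by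
    have e : ∀ V : Op Q, (Vᴴ * E * V * σ).trace = (E * (V * σ * Vᴴ)).trace := fun V => by
      rw [Matrix.mul_assoc, Matrix.mul_assoc, Matrix.trace_mul_comm]
      simp only [Matrix.mul_assoc]
    rw [hX, Matrix.sub_mul, Matrix.trace_sub, e, e]
  rw [h2, Complex.sub_re] at h1
  have h3 : ((‖X‖ : ℝ) • (1 : ℂ)).re = ‖X‖ := by simp
  rw [h3] at h1
  linarith [h1.1]

lemma isUniversalGateSet_simGates : IsUniversalGateSet simGates := by
  intro n U δ hδ
  have hU : U.1 ∈ unitary (Op (Fin n)) := U.2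
  obtain ⟨_, ⟨z, hz, L, rfl⟩, hd⟩ := Metric.mem_closure_iff.mp (unitary_mem_circuitGroup hU)
    (δ / 2) (by linarith)
  refine ⟨L, fun σ hσ => ?_⟩
  have hz' : z * conj z = 1 := by
    rw [Complex.mul_conj, Complex.normSq_eq_norm_sq, hz]; simp
  have hL : circuitOp L ∈ unitary (Op (Fin n)) :=
    mem_unitary_of_conjTranspose_mul (circuitOp_unitary L)
  have hV : z • circuitOp L ∈ unitary (Op (Fin n)) := by
    refine mem_unitary_of_conjTranspose_mul ?_
    rw [conjTranspose_smul, smul_mul_smul_comm, circuitOp_unitary, Complex.star_def, mul_comm, hz',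
      one_smul]
  rw [dist_comm, dist_eq_norm] at hd
  have h := traceClose_of_norm_sub_le hU hV hd.le hσ
  rw [conjTranspose_smul, Matrix.smul_mul, Matrix.smul_mul, Matrix.mul_smul, smul_smul,
    Complex.star_def, hz', one_smul, mul_div_cancel₀ _ (by norm_num)] at h
  exact h

end Universal

end MagicDistill

theorem lemma1 :
    -- every unitary is performed to any accuracy by a protocol that knows only `ε`
    (∀ ε : ℝ, 0 < ε → ∀ (n : ℕ) (U : Matrix.unitaryGroup (Fin n → Fin 2) ℂ) (δ : ℝ), 0 < δ →
      ∃ (a : ℕ) (P : Protocol (Fin n ⊕ Fin a)),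
        ∀ ρ : ℕ → Op1, IsSupply ε ρ → Simulates P ρ U.1 δ) ∧
    -- circuits over a finite universal gate set are simulated with polylogarithmic overhead
    (∃ G : Set (Matrix.unitaryGroup (Fin 2) ℂ),
      G.Finite ∧ (∀ A ∈ G, A⁻¹ ∈ G) ∧ IsUniversalGateSet G ∧
      ∀ ε : ℝ, 0 < ε → ∃ (C : ℝ) (c : ℕ),
        ∀ (n : ℕ) (L : List (Gate G (Fin n))) (δ : ℝ), 0 < δ → δ < 1 →
          ∃ (a : ℕ) (P : Protocol (Fin n ⊕ Fin a)),
            (P.numOps : ℝ) ≤ C * L.length * (1 + Real.log (L.length / δ)) ^ c ∧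
            ∀ ρ : ℕ → Op1, IsSupply ε ρ → Simulates P ρ (circuitOp L) δ) ∧
    -- one round of distillation with five unequal inputs
    (∀ f ∈ Set.Icc (0 : Fin 5 → ℝ) 1,
      0 < acceptProb f ∧ distillOutput f = tState (-outFidelity f)) ∧
    MonotoneOn outFidelity (Set.Icc 0 1) ∧
    MonotoneOn acceptProb (Set.Icc 0 1) ∧
    StrictMonoOn outFidelity {f | ∀ i, f i ∈ Set.Ioo (0 : ℝ) 1} ∧
    StrictMonoOn acceptProb {f | ∀ i, f i ∈ Set.Ioo (0 : ℝ) 1} := by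
  have huniv := isUniversalGateSet_simGates
  refine ⟨?_, ⟨simGates, simGates_finite, simGates_inv, huniv, fun ε hε => exists_simulation hε⟩,
    ?_, outFidelity_monotoneOn, acceptProb_monotoneOn, outFidelity_strictMonoOn,
    acceptProb_strictMonoOn⟩
  · intro ε hε n U δ hδ
    obtain ⟨C, c, h⟩ := exists_simulation hε
    obtain ⟨L, hL⟩ := huniv n U (δ / 2) (by linarith)
    -- Half of the error goes to the approximating circuit and half to its simulation; the cap `1/2`
    -- is there because simulation requires an error below `1`.
    obtain ⟨a, P, _, hP⟩ := h n L (min (δ / 2) (1 / 2)) (by positivity)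
      ((min_le_right _ _).trans_lt (by norm_num))
    refine ⟨a, P, fun ρ hρ σ hσ E hE => ?_⟩
    have h1 := hP ρ hρ σ hσ E hE
    have h2 := hL σ hσ E hE
    have h3 := norm_add_le ((E * discardWork (P.run ρ 0 (withWork a σ))).trace -
      (E * (circuitOp L * σ * (circuitOp L).conjTranspose)).trace)
      ((E * (circuitOp L * σ * (circuitOp L).conjTranspose)).trace -
        (E * (U.1 * σ * U.1.conjTranspose)).trace)
    rw [sub_add_sub_cancel] at h3
    linarith [min_le_left (δ / 2) (1 / 2)]
  · intro f hf
    refine ⟨by linarith [acceptProb_pos hf], ?_⟩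
    rw [distillOutput_eq (acceptProb_ne_zero hf), outFidelity_eq (acceptProb_ne_zero hf)]
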